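/- Let $g_0$ be the round metric of curvature $1$ on $S^2\subset\mathbb R^3$, and also the metric it induces on $\mathbb{RP}^2=S^2/\{\pm1\}$; let $p:S^2\to\mathbb{RP}^2$ be the projection, $dg_0$ the area measure and $\Delta=\operatorname{div}\operatorname{grad}$ the Laplacian of $(S^2,g_0)$. Let $$G(x,y)=\frac1{2\pi}\log\frac{2}{|x-y|}-\frac1{4\pi}\in\mathbb R\cup\{+\infty\}$$ be the Green function of $S^2$ (so $-\Delta_x G(x,y)=\delta_y-\frac1{4\pi}$ and $\int_{S^2} G(x,y)\,dg_0(x)=0$). Let $\mu$ be a finite signed Borel measure on $S^2$ with $\mu(S^2)=0$, and let $u$ be a function on $\mathbb{RP}^2$ with values in $[-\infty,+\infty]$ whose lift to $S^2$ is the potential of $\mu$: $$u(p(x))=\int_{S^2}G(x,y)\,d\mu(y)\qquad(x\in S^2),$$ with the convention $\infty-\infty=-\infty$ where the integral is indeterminate (this happens only on a polar set). Consider the singular Riemannian metric $g=e^u g_0$ on $\mathbb{RP}^2$. Its area is $$\operatorname{area}(g)=\int_{\mathbb{RP}^2}e^u\,dg_0=\tfrac12\int_{S^2}e^{u\circ p}\,dg_0\in[0,\infty],$$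 and its systole $\operatorname{sys}(g)\in[0,\infty]$ is the infimum of the lengths $\int_0^1 e^{u(c(t))/2}\,|c'(t)|_{g_0}\,dt$ over all noncontractible $C^1$ loops $c:[0,1]\to\mathbb{RP}^2$ (the velocities at the two ends need not agree, and the velocity may vanish). Then $$\operatorname{area}(g)\ \ge\ \frac2\pi\,\operatorname{sys}(g)^2 .$$ Moreover, equality holds if and only if $g$ has constant Gaussian curvature, meaning that $\operatorname{area}(g)<\infty$, that $u\circ p$ is finite almost everywhere and integrable on $S^2$, and that there is a constant $K\in\mathbb R$ such that the curvature measure of $g$ is $K$ times its area measure, i.e. $dg_0-\frac12\Delta(u\circ p)=K\,e^{u\circ p}\,dg_0$ on $S^2$ in the sense of distributions. -/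

import Mathlib

open MeasureTheory Set
open scoped ENNReal

noncomputable section

/-- The unit sphere `S²` in Euclidean 3-space; `dist` on it is the chordal distance. -/
abbrev S2 : Type := Metric.sphere (0 : EuclideanSpace ℝ (Fin 3)) 1

/-- The antipodal relation `x ∼ y ↔ x = ± y` on `S²`. -/
def antipodalSetoid : Setoid S2 where
  r x y := x = y ∨ x = -y
  iseqv :=
    { refl := fun _ => Or.inl rfl
      symm := by
        rintro x y (h | h)
        · exact Or.inl h.symm
        · exact Or.inr (by rw [h, neg_neg])
      trans := by
        rintro x y z (h | h) (h' | h')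
        · exact Or.inl (h.trans h')
        · exact Or.inr (h.trans h')
        · exact Or.inr (by rw [h, h'])
        · exact Or.inl (by rw [h, h', neg_neg]) }

/-- The real projective plane `S² / ±1`, with the quotient topology and quotient `σ`-algebra. -/
abbrev RP2 : Type := Quotient antipodalSetoid

/-- The orientation double cover `S² → ℝP²`. -/
def toRP2 (x : S2) : RP2 := Quotient.mk antipodalSetoid x

/-- The area measure of the round metric `g₀` of `S²` (total mass `4π`). -/
def sphereArea : Measure S2 :=
  (volume : Measure (EuclideanSpace ℝ (Fin 3))).toSphere

/-- The area measure of the round metric `g₀` of `ℝP²` (total mass `2π`): each point of `ℝP²`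
has two preimages under the local isometry `S² → ℝP²`. -/
def roundArea : Measure RP2 := (2⁻¹ : ℝ≥0∞) • Measure.map toRP2 sphereArea

/-- The Green function of `(S², g₀)`: the mean-zero solution of `-Δ G(·, y) = δ_y - 1 / (4π)`,
where `Δ = div grad`, equal to `+∞` on the diagonal. -/
def greenFunction (x y : S2) : EReal :=
  open Classical in
  if x = y then ⊤
  else ((1 / (2 * Real.pi) * Real.log (2 / dist x y) - 1 / (4 * Real.pi) : ℝ) : EReal)

/-- The integral of an extended real function `f` against a signed measure `μ`, computed from
the positive and negative parts of `f` and the Jordan decomposition of `μ`. Where it has the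
indeterminate form `∞ - ∞` its value is `-∞`. -/
def signedIntegral (μ : SignedMeasure S2) (f : S2 → EReal) : EReal :=
  (((∫⁻ y, (f y).toENNReal ∂μ.toJordanDecomposition.posPart) +
      ∫⁻ y, (-f y).toENNReal ∂μ.toJordanDecomposition.negPart : ℝ≥0∞) : EReal) -
  (((∫⁻ y, (-f y).toENNReal ∂μ.toJordanDecomposition.posPart) +
      ∫⁻ y, (f y).toENNReal ∂μ.toJordanDecomposition.negPart : ℝ≥0∞) : EReal)

/-- The potential `x ↦ ∫ G(x, y) dμ(y)`. It is finite outside a polar set, which is negligible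
both for the area measure and for the arc length of every `C¹` curve. -/
def greenPotential (μ : SignedMeasure S2) (x : S2) : EReal :=
  signedIntegral μ (greenFunction x)

/-- The area of `(ℝP², e^u g₀)`. -/
def area (u : RP2 → EReal) : ℝ≥0∞ := ∫⁻ x, (u x).exp ∂roundArea

/-- The length for `e^u g₀` of the curve in `ℝP²` covered by a curve `γ : [0,1] → S²`, that is
the integral of `e^{u/2}` against the arc length of `g₀`. -/
def curveLength (u : RP2 → EReal) (γ : ℝ → S2) : ℝ≥0∞ :=
  ∫⁻ t in Icc (0 : ℝ) 1, (u (toRP2 (γ t))).exp ^ (1 / 2 : ℝ) *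
    ‖derivWithin (fun s => (γ s : EuclideanSpace ℝ (Fin 3))) (Icc 0 1) t‖ₑ

/-- `γ` is a `C¹` lift to `S²` of the loop `c` of `ℝP²`. Every loop of `ℝP²` lifts to a path of
`S²`, which need not be closed, and the loop is `C¹` on `[0,1]` exactly when its lift is.
The velocity may vanish, so a piecewise `C¹` loop is of this form after reparametrization. -/
def IsC1Lift {x : RP2} (c : Path x x) (γ : ℝ → S2) : Prop :=
  ContDiffOn ℝ 1 (fun s => (γ s : EuclideanSpace ℝ (Fin 3))) (Icc 0 1) ∧
    ∀ t : unitInterval, toRP2 (γ t) = c t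

/-- The systole of `(ℝP², e^u g₀)`: the infimum of the lengths of the noncontractible loops. -/
def systole (u : RP2 → EReal) : ℝ≥0∞ :=
  ⨅ (x : RP2) (c : Path x x) (_ : ¬ c.Homotopic (Path.refl x))
    (γ : ℝ → S2) (_ : IsC1Lift c γ), curveLength u γ

/-- The Laplace–Beltrami operator `div grad` of `(S², g₀)` applied to the restriction of `φ`
to the sphere: the Euclidean Laplacian of the extension that is constant along rays. -/
def sphereLaplacian (φ : EuclideanSpace ℝ (Fin 3) → ℝ) (x : S2) : ℝ :=
  Laplacian.laplacian (fun y : EuclideanSpace ℝ (Fin 3) => φ (‖y‖⁻¹ • y))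
    (x : EuclideanSpace ℝ (Fin 3))

/-- The singular metric `g = e^u g₀` has constant Gaussian curvature: for some `K`, its curvature
measure `dg₀ - (1/2) Δu` is `K` times its area measure `e^u dg₀`, where `Δu` is taken in the sense
of distributions (the equation is written on the double cover). -/
def HasConstantGaussianCurvature (u : RP2 → EReal) : Prop :=
  area u ≠ ∞ ∧
  (∀ᵐ x ∂sphereArea, u (toRP2 x) ≠ ⊤ ∧ u (toRP2 x) ≠ ⊥) ∧
  Integrable (fun x => (u (toRP2 x)).toReal) sphereArea ∧
  ∃ K : ℝ, ∀ φ : EuclideanSpace ℝ (Fin 3) → ℝ, ContDiff ℝ (⊤ : ℕ∞) φ →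
    (∫ x, φ x ∂sphereArea) -
        1 / 2 * ∫ x, (u (toRP2 x)).toReal * sphereLaplacian φ x ∂sphereArea =
      K * ∫ x, φ x * (u (toRP2 x)).exp.toReal ∂sphereArea

end

/-! The inequality is integral geometry. Half of a great circle projects to a noncontractible loop,
so its length for `g` is at least the systole. On a random great circle, each point at a fixed
parameter is uniformly distributed (`map_circlePoint`), because a finite measure invariant under all
isometries is a multiple of the area (`eq_smul_sphereArea_of_invariant`). Averaging the lengths
gives `4 sys ≤ ∫ e^{u/2}` over the sphere (`four_mul_systole_le`), and Cauchy–Schwarz gives Pu's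
inequality (`systole_sq_le_area`).

If equality holds and the area is finite, equality in Cauchy–Schwarz makes `e^u` constant almost
everywhere, so the curvature is constant. The area is finite because the systole is
(`systole_lt_top`): some great circle is null for the positive part of `μ`, a thin band around it
has little positive mass, and there `e^{u/2}` is integrable by Jensen's inequality. Averaging over
the great circles inside the band then bounds the systole.

Conversely, let the curvature be constant. The curvature equation, read as an equality of measures,
becomes an integral equation `f = exp (a ∫ k f - b)` for `f = e^u`, with `k` the logarithmic kernel.
Small mass and Jensen's inequality make `f` square integrable and then bounded; since the
logarithmic potential gains a derivative, `f` agrees almost everywhere with a smooth function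
(`exists_smooth_of_integral_eq`).

It remains to show that an even smooth solution of `ΔW = 2 - 2 e^W` on the sphere vanishes
(`eq_zero_of_rotLaplacian_eq`). The function `V = |y| e^{-W/2}` on punctured space is homogeneous of
degree one and satisfies `V ΔV = 1 + |∇V|²`. Taking the Laplacian of this equation gives `V ΔΔV = 2
|D²V|² - (ΔV)²`, which is nonnegative because the Hessian annihilates `y` and so lives on a plane.
But `ΔV` has degree `-1`, so `ΔΔV` restricted to the sphere is a spherical Laplacian and has
integral zero. Hence `ΔΔV = 0`, the Hessian is pure trace, and `∇V - (ΔV / 2) y` is a constant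
vector; evenness kills this vector, leaving `V = |y|`.

Thus `e^u` is constant almost everywhere, the curvature equation gives `μ = 0`, and `u` vanishes
identically. For the round metric both sides equal `2π`; its systole is `π` because a
noncontractible loop lifts to a path between antipodal points. -/

/-! ### The round sphere: isometries, rotations and the rotation fields -/

noncomputable section

/-- Euclidean 3-space. -/
abbrev E3 : Type := EuclideanSpace ℝ (Fin 3)

instance : IsFiniteMeasure sphereArea := by unfold sphereArea; infer_instance

instance : sphereArea.IsOpenPosMeasure := by unfold sphereArea; infer_instance

lemma S2.norm_coe (x : S2) : ‖(x : E3)‖ = 1 := by simp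

lemma S2.coe_ne_zero (x : S2) : (x : E3) ≠ 0 := by
  intro h; have := S2.norm_coe x; simp [h] at this

lemma S2.inner_self (x : S2) : inner ℝ (x : E3) (x : E3) = 1 := by
  rw [real_inner_self_eq_norm_sq, S2.norm_coe]; norm_num

lemma S2.inner_le_one (x y : S2) : inner ℝ (x : E3) (y : E3) ≤ 1 := by
  simpa [S2.norm_coe] using real_inner_le_norm (x : E3) y

lemma S2.neg_one_le_inner (x y : S2) : -1 ≤ inner ℝ (x : E3) (y : E3) := by
  have := abs_le.1 (abs_real_inner_le_norm (x : E3) y)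
  simpa [S2.norm_coe] using this.1

lemma S2.inner_eq_one_iff (x y : S2) : inner ℝ (x : E3) (y : E3) = 1 ↔ x = y := by
  rw [inner_eq_one_iff_of_norm_eq_one (S2.norm_coe x) (S2.norm_coe y), Subtype.coe_inj]

lemma S2.inner_lt_one {x y : S2} (h : x ≠ y) : inner ℝ (x : E3) (y : E3) < 1 :=
  lt_of_le_of_ne (S2.inner_le_one x y) fun h' => h ((S2.inner_eq_one_iff x y).1 h')

lemma S2.dist_sq (x y : S2) : dist x y ^ 2 = 2 * (1 - inner ℝ (x : E3) (y : E3)) := by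
  rw [Subtype.dist_eq, dist_eq_norm, norm_sub_sq_real, S2.norm_coe, S2.norm_coe]; ring

lemma sphereArea_univ : sphereArea univ = ENNReal.ofReal (4 * Real.pi) := by
  rw [sphereArea, Measure.toSphere_apply_univ, EuclideanSpace.volume_ball_fin_three]
  simp only [finrank_euclideanSpace, Fintype.card_fin, ENNReal.ofReal_one, one_pow, one_mul]
  rw [show ((3 : ℕ) : ℝ≥0∞) = ENNReal.ofReal 3 by norm_num, ← ENNReal.ofReal_mul (by norm_num)]
  congr 1; ring

lemma sphereArea_real_univ : sphereArea.real univ = 4 * Real.pi := by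
  rw [measureReal_def, sphereArea_univ, ENNReal.toReal_ofReal (by positivity)]

/-- The action of a linear isometry on the sphere. -/
def sphereMap (L : E3 ≃ₗᵢ[ℝ] E3) (x : S2) : S2 :=
  ⟨L x, by simp⟩

@[simp] lemma coe_sphereMap (L : E3 ≃ₗᵢ[ℝ] E3) (x : S2) : (sphereMap L x : E3) = L x := rfl

lemma continuous_sphereMap (L : E3 ≃ₗᵢ[ℝ] E3) : Continuous (sphereMap L) :=
  (L.continuous.comp continuous_subtype_val).subtype_mk _

lemma measurable_sphereMap (L : E3 ≃ₗᵢ[ℝ] E3) : Measurable (sphereMap L) :=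
  (continuous_sphereMap L).measurable

lemma sphereMap_symm (L : E3 ≃ₗᵢ[ℝ] E3) (x : S2) : sphereMap L.symm (sphereMap L x) = x := by
  ext1; simp

lemma sphereMap_symm' (L : E3 ≃ₗᵢ[ℝ] E3) (x : S2) : sphereMap L (sphereMap L.symm x) = x := by
  ext1; simp

-- The area of `s` is a multiple of the volume of the cone over `s`, and a linear isometry carries
-- cones to cones and preserves volume.
open scoped Pointwise in
lemma measurePreserving_sphereMap (L : E3 ≃ₗᵢ[ℝ] E3) :
    MeasurePreserving (sphereMap L) sphereArea sphereArea := by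
  refine ⟨measurable_sphereMap L, Measure.ext fun s hs => ?_⟩
  rw [Measure.map_apply (measurable_sphereMap L) hs, sphereArea,
    Measure.toSphere_apply' _ hs, Measure.toSphere_apply' _ (measurable_sphereMap L hs)]
  congr 1
  rw [← L.measurePreserving.measure_preimage_equiv (f := L.toHomeomorph.toMeasurableEquiv)
    (Ioo (0 : ℝ) 1 • (Subtype.val '' s))]
  congr 1
  ext z
  simp only [mem_smul, mem_image, mem_preimage]
  constructor
  · rintro ⟨r, hr, _, ⟨x, hx, rfl⟩, rfl⟩
    exact ⟨r, hr, _, ⟨_, hx, rfl⟩, by simp⟩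
  · rintro ⟨r, hr, _, ⟨x, hx, rfl⟩, h⟩
    refine ⟨r, hr, _, ⟨sphereMap L.symm x, by rwa [sphereMap_symm'], rfl⟩, ?_⟩
    apply L.injective
    simpa using h

lemma integral_sphereMap (L : E3 ≃ₗᵢ[ℝ] E3) (f : S2 → ℝ) :
    ∫ x, f (sphereMap L x) ∂sphereArea = ∫ x, f x ∂sphereArea :=
  (measurePreserving_sphereMap L).integral_comp
    ((⟨⟨sphereMap L, sphereMap L.symm, sphereMap_symm L, sphereMap_symm' L⟩,
      continuous_sphereMap L, continuous_sphereMap L.symm⟩ : S2 ≃ₜ S2).measurableEmbedding) f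

/-- The isometry is the reflection in the plane orthogonal to `x - y`. Transitivity makes integrals
of invariant kernels independent of the pole. -/
lemma exists_sphereMap_eq (x y : S2) : ∃ L : E3 ≃ₗᵢ[ℝ] E3, sphereMap L x = y := by
  refine ⟨(ℝ ∙ ((x : E3) - y))ᗮ.reflection, ?_⟩
  ext1
  exact Submodule.reflection_sub (by rw [S2.norm_coe, S2.norm_coe])

/-! ### Rotations in a coordinate plane -/

/-- The standard basis vectors. -/
def stdVec (i : Fin 3) : E3 := EuclideanSpace.single i 1

@[simp] lemma inner_stdVec (i : Fin 3) (x : E3) : inner ℝ (stdVec i) x = x i := by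
  simp [stdVec, EuclideanSpace.inner_single_left]

@[simp] lemma inner_stdVec_right (i : Fin 3) (x : E3) : inner ℝ x (stdVec i) = x i := by
  rw [real_inner_comm, inner_stdVec]

lemma stdVec_apply (i j : Fin 3) : stdVec i j = if j = i then 1 else 0 := by
  simp [stdVec]

@[simp] lemma norm_stdVec (i : Fin 3) : ‖stdVec i‖ = 1 := by simp [stdVec]

lemma sum_smul_stdVec (x : E3) : ∑ i, x i • stdVec i = x := by
  ext j; simp [stdVec_apply]

/-- The infinitesimal generator of the rotations in the `(i, j)` coordinate plane. -/
def rotGen (i j : Fin 3) : E3 →L[ℝ] E3 :=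
  (EuclideanSpace.proj j : E3 →L[ℝ] ℝ).smulRight (stdVec i) -
    (EuclideanSpace.proj i : E3 →L[ℝ] ℝ).smulRight (stdVec j)

lemma rotGen_apply (i j : Fin 3) (x : E3) :
    rotGen i j x = x j • stdVec i - x i • stdVec j := by
  simp [rotGen]

@[simp] lemma rotGen_self (i : Fin 3) (x : E3) : rotGen i i x = 0 := by simp [rotGen_apply]

/-- The linear map underlying the rotation by the angle `t` in the `(i, j)` coordinate plane. -/
def rotLin (i j : Fin 3) (t : ℝ) : E3 →ₗ[ℝ] E3 where
  toFun x := x + (Real.cos t - 1) • (x i • stdVec i + x j • stdVec j) +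
    Real.sin t • (x j • stdVec i - x i • stdVec j)
  map_add' x y := by simp only [PiLp.add_apply, add_smul]; module
  map_smul' c x := by simp only [PiLp.smul_apply, smul_eq_mul, RingHom.id_apply]; module

lemma norm_rotLin {i j : Fin 3} (hij : i ≠ j) (t : ℝ) (x : E3) : ‖rotLin i j t x‖ = ‖x‖ := by
  rw [← sq_eq_sq₀ (norm_nonneg _) (norm_nonneg _)]
  simp only [← real_inner_self_eq_norm_sq, rotLin, LinearMap.coe_mk, AddHom.coe_mk, inner_add_left,
    inner_add_right, inner_smul_left, inner_smul_right, inner_sub_left, inner_sub_right,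
    inner_stdVec, inner_stdVec_right, RCLike.conj_to_real, stdVec_apply, hij, hij.symm, if_true,
    if_false]
  have := Real.sin_sq_add_cos_sq t
  linear_combination (x i ^ 2 + x j ^ 2) * this

/-- The rotation by the angle `t` in the `(i, j)` coordinate plane. -/
def rot {i j : Fin 3} (hij : i ≠ j) (t : ℝ) : E3 ≃ₗᵢ[ℝ] E3 :=
  (⟨rotLin i j t, norm_rotLin hij t⟩ : E3 →ₗᵢ[ℝ] E3).toLinearIsometryEquiv rfl

lemma rot_apply {i j : Fin 3} (hij : i ≠ j) (t : ℝ) (x : E3) :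
    rot hij t x = x + (Real.cos t - 1) • (x i • stdVec i + x j • stdVec j) +
      Real.sin t • (x j • stdVec i - x i • stdVec j) := rfl

@[simp] lemma rot_zero {i j : Fin 3} (hij : i ≠ j) (x : E3) : rot hij 0 x = x := by
  simp [rot_apply]

lemma hasDerivAt_rot {i j : Fin 3} (hij : i ≠ j) (x : E3) (t : ℝ) :
    HasDerivAt (fun s => rot hij s x) (rotGen i j (rot hij t x)) t := by
  simp only [rot_apply]
  have h1 : HasDerivAt (fun s => (Real.cos s - 1) • (x i • stdVec i + x j • stdVec j))
      ((-Real.sin t) • (x i • stdVec i + x j • stdVec j)) t :=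
    ((Real.hasDerivAt_cos t).sub_const 1).smul_const _
  have h2 : HasDerivAt (fun s => Real.sin s • (x j • stdVec i - x i • stdVec j))
      (Real.cos t • (x j • stdVec i - x i • stdVec j)) t :=
    (Real.hasDerivAt_sin t).smul_const _
  convert! (h1.const_add x).add h2 using 1
  simp only [rotGen_apply, PiLp.add_apply, PiLp.smul_apply, PiLp.sub_apply, stdVec_apply, hij,
    hij.symm, if_true, if_false, smul_eq_mul]
  module

/-- The derivative of `F` along the rotation field in the `(i, j)` coordinate plane. -/
def rotDeriv (i j : Fin 3) (F : E3 → ℝ) (y : E3) : ℝ := fderiv ℝ F y (rotGen i j y)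

lemma rotDeriv_self (i : Fin 3) (F : E3 → ℝ) (y : E3) : rotDeriv i i F y = 0 := by
  simp [rotDeriv]

lemma hasDerivAt_comp_rot {i j : Fin 3} (hij : i ≠ j) {F : E3 → ℝ} {x : E3} {t : ℝ}
    (hF : DifferentiableAt ℝ F (rot hij t x)) :
    HasDerivAt (fun s => F (rot hij s x)) (rotDeriv i j F (rot hij t x)) t :=
  hF.hasFDerivAt.comp_hasDerivAt t (hasDerivAt_rot hij x t)

lemma ContDiffAt.rotDeriv {n m : WithTop ℕ∞} {F : E3 → ℝ} {y : E3} (h : ContDiffAt ℝ n F y)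
    (hm : m + 1 ≤ n) (i j : Fin 3) : ContDiffAt ℝ m (rotDeriv i j F) y :=
  (h.fderiv_right hm).clm_apply (rotGen i j).contDiff.contDiffAt

lemma integrable_sphere {f : S2 → ℝ} (hf : Continuous f) : Integrable f sphereArea :=
  hf.integrable_of_hasCompactSupport (HasCompactSupport.of_compactSpace f)

lemma continuous_sphere_of_contDiffAt {n : WithTop ℕ∞} {F : E3 → ℝ}
    (h : ∀ x : S2, ContDiffAt ℝ n F x) : Continuous fun x : S2 => F x :=
  continuous_iff_continuousAt.2 fun x =>
    ContinuousAt.comp (f := Subtype.val) (g := F) (h x).continuousAt continuousAt_subtype_val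

lemma exists_bound_sphere {f : S2 → ℝ} (hf : Continuous f) : ∃ C, ∀ x, |f x| ≤ C := by
  obtain ⟨C, hC⟩ := (isCompact_range hf).isBounded.exists_norm_le
  exact ⟨C, fun x => hC _ ⟨x, rfl⟩⟩

lemma MeasureTheory.Integrable.mul_continuous_sphere {ν : Measure S2} {k f : S2 → ℝ}
    (hk : Integrable k ν) (hf : Continuous f) : Integrable (fun x => k x * f x) ν := by
  obtain ⟨C, hC⟩ := exists_bound_sphere hf
  exact hk.mul_bdd (c := C) hf.aestronglyMeasurable (.of_forall hC)

/-- Differentiation under the integral sign along rotations. -/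
lemma hasDerivAt_integral_rot {i j : Fin 3} (hij : i ≠ j) {F : E3 → ℝ} {k : S2 → ℝ}
    (hk : Integrable k sphereArea) (hF : ∀ x : S2, ContDiffAt ℝ 1 F x) :
    HasDerivAt (fun t => ∫ x : S2, k x * F (rot hij t x) ∂sphereArea)
      (∫ x : S2, k x * rotDeriv i j F x ∂sphereArea) 0 := by
  have hc : Continuous fun x : S2 => rotDeriv i j F x :=
    continuous_sphere_of_contDiffAt fun x => (hF x).rotDeriv (m := 0) (by simp) i j
  obtain ⟨C, hC⟩ := exists_bound_sphere hc
  have hcF (t : ℝ) : Continuous fun x : S2 => F (rot hij t x) :=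
    (continuous_sphere_of_contDiffAt hF).comp (continuous_sphereMap (rot hij t))
  have := (hasDerivAt_integral_of_dominated_loc_of_deriv_le (μ := sphereArea) (𝕜 := ℝ)
    (F := fun t (x : S2) => k x * F (rot hij t x))
    (F' := fun t (x : S2) => k x * rotDeriv i j F (rot hij t x))
    (x₀ := 0) (s := univ) (bound := fun x => ‖k x‖ * C) Filter.univ_mem
    (.of_forall fun t => hk.aestronglyMeasurable.mul (hcF t).aestronglyMeasurable)
    (hk.mul_continuous_sphere (hcF 0))
    (by simpa using (hk.mul_continuous_sphere hc).aestronglyMeasurable)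
    (.of_forall fun x t _ => ?_) (hk.norm.mul_const C) (.of_forall fun x t _ => ?_)).2
  · simpa using this
  · rw [norm_mul]
    exact mul_le_mul_of_nonneg_left (hC (sphereMap (rot hij t) x)) (norm_nonneg _)
  · exact (hasDerivAt_comp_rot hij
      ((hF (sphereMap (rot hij t) x)).differentiableAt one_ne_zero)).const_mul _

/-- Rotations preserve area, so the integral of `F` composed with a rotation does not depend on the
angle. This plays the role of the divergence theorem. -/
lemma integral_rotDeriv {F : E3 → ℝ} (hF : ∀ x : S2, ContDiffAt ℝ 1 F x) (i j : Fin 3) :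
    ∫ x : S2, rotDeriv i j F x ∂sphereArea = 0 := by
  by_cases hij : i = j
  · subst hij; simp [rotDeriv_self]
  have h := hasDerivAt_integral_rot hij (k := fun _ => 1) (integrable_const 1) hF
  simp only [one_mul] at h
  have hconst (t : ℝ) : ∫ x : S2, F (rot hij t x) ∂sphereArea = ∫ x : S2, F x ∂sphereArea :=
    integral_sphereMap (rot hij t) fun x : S2 => F x
  simp only [hconst] at h
  exact h.unique (hasDerivAt_const _ _)

/-- Half the sum of the squares of all the rotation fields: the Laplacian of the sphere. -/
def rotLaplacian (F : E3 → ℝ) (y : E3) : ℝ :=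
  1 / 2 * ∑ i, ∑ j, rotDeriv i j (rotDeriv i j F) y

lemma rotDeriv_mul {F G : E3 → ℝ} {y : E3} (hF : DifferentiableAt ℝ F y)
    (hG : DifferentiableAt ℝ G y) (i j : Fin 3) :
    rotDeriv i j (fun z => F z * G z) y = F y * rotDeriv i j G y + rotDeriv i j F y * G y := by
  simp only [rotDeriv]
  rw [fderiv_fun_mul hF hG]
  simp; ring

/-- For a rotation field `X`, `F X²G - G X²F = X (F XG - G XF)`, which integrates to zero. -/
lemma integral_mul_rotDeriv_rotDeriv {F G : E3 → ℝ} (hF : ∀ x : S2, ContDiffAt ℝ 2 F x)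
    (hG : ∀ x : S2, ContDiffAt ℝ 2 G x) (i j : Fin 3) :
    ∫ x : S2, F x * rotDeriv i j (rotDeriv i j G) x ∂sphereArea =
      ∫ x : S2, G x * rotDeriv i j (rotDeriv i j F) x ∂sphereArea := by
  have h2 : (1 : WithTop ℕ∞) + 1 ≤ 2 := by norm_num
  have hF1 (x : S2) := (hF x).rotDeriv h2 i j
  have hG1 (x : S2) := (hG x).rotDeriv h2 i j
  have hF0 := continuous_sphere_of_contDiffAt hF
  have hG0 := continuous_sphere_of_contDiffAt hG
  have hF2 := continuous_sphere_of_contDiffAt fun x => (hF1 x).rotDeriv (m := 0) (by simp) i j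
  have hG2 := continuous_sphere_of_contDiffAt fun x => (hG1 x).rotDeriv (m := 0) (by simp) i j
  have hd {n : WithTop ℕ∞} (hn : n ≠ 0) {H : E3 → ℝ} (h : ∀ x : S2, ContDiffAt ℝ n H x) (x : S2) :
      DifferentiableAt ℝ H x := (h x).differentiableAt hn
  have key := integral_rotDeriv
    (F := fun z => F z * rotDeriv i j G z - G z * rotDeriv i j F z)
    (fun x => (((hF x).of_le (by norm_num)).mul (hG1 x)).sub
      (((hG x).of_le (by norm_num)).mul (hF1 x))) i j
  rw [← sub_eq_zero, ← integral_sub (integrable_sphere (hF0.fun_mul hG2))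
    (integrable_sphere (hG0.fun_mul hF2)), ← key]
  refine integral_congr_ae (.of_forall fun x => ?_)
  have e1 := rotDeriv_mul (hd (by norm_num) hF x) (hd (by norm_num) hG1 x) i j
  have e2 := rotDeriv_mul (hd (by norm_num) hG x) (hd (by norm_num) hF1 x) i j
  have e3 : rotDeriv i j (fun z => F z * rotDeriv i j G z - G z * rotDeriv i j F z) x =
      rotDeriv i j (fun z => F z * rotDeriv i j G z) x -
      rotDeriv i j (fun z => G z * rotDeriv i j F z) x := by
    simp only [rotDeriv]
    rw [fderiv_fun_sub]
    · simp
    · exact (hd (by norm_num) hF x).mul (hd (by norm_num) hG1 x)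
    · exact (hd (by norm_num) hG x).mul (hd (by norm_num) hF1 x)
  simp only [e3, e1, e2]; ring

lemma continuous_rotDeriv_rotDeriv {F : E3 → ℝ} (hF : ∀ x : S2, ContDiffAt ℝ 2 F x)
    (i j : Fin 3) : Continuous fun x : S2 => rotDeriv i j (rotDeriv i j F) x :=
  continuous_sphere_of_contDiffAt fun x =>
    ((hF x).rotDeriv (m := 1) (by norm_num) i j).rotDeriv (m := 0) (by simp) i j

lemma continuous_rotLaplacian {F : E3 → ℝ} (hF : ∀ x : S2, ContDiffAt ℝ 2 F x) :
    Continuous fun x : S2 => rotLaplacian F x := by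
  unfold rotLaplacian
  exact continuous_const.mul (continuous_finsetSum _ fun i _ =>
    continuous_finsetSum _ fun j _ => continuous_rotDeriv_rotDeriv hF i j)

/-- Green's second identity on the sphere. -/
lemma integral_mul_rotLaplacian {F G : E3 → ℝ} (hF : ∀ x : S2, ContDiffAt ℝ 2 F x)
    (hG : ∀ x : S2, ContDiffAt ℝ 2 G x) :
    ∫ x : S2, F x * rotLaplacian G x ∂sphereArea =
      ∫ x : S2, G x * rotLaplacian F x ∂sphereArea := by
  have expand {F G : E3 → ℝ} (hF : ∀ x : S2, ContDiffAt ℝ 2 F x)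
      (hG : ∀ x : S2, ContDiffAt ℝ 2 G x) : ∫ x : S2, F x * rotLaplacian G x ∂sphereArea =
      1 / 2 * ∑ i, ∑ j, ∫ x : S2, F x * rotDeriv i j (rotDeriv i j G) x ∂sphereArea := by
    have hi (i j : Fin 3) := integrable_sphere
      ((continuous_sphere_of_contDiffAt hF).fun_mul (continuous_rotDeriv_rotDeriv hG i j))
    simp only [rotLaplacian, mul_left_comm _ (1 / 2 : ℝ), Finset.mul_sum]
    rw [integral_finsetSum _ fun i _ => integrable_finsetSum _ fun j _ => (hi i j).const_mul _]
    refine Finset.sum_congr rfl fun i _ => ?_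
    rw [integral_finsetSum _ fun j _ => (hi i j).const_mul _]
    exact Finset.sum_congr rfl fun j _ => integral_const_mul _ _
  rw [expand hF hG, expand hG hF]
  simp only [integral_mul_rotDeriv_rotDeriv hF hG]

lemma integral_rotLaplacian {F : E3 → ℝ} (hF : ∀ x : S2, ContDiffAt ℝ 2 F x) :
    ∫ x : S2, rotLaplacian F x ∂sphereArea = 0 := by
  have := integral_mul_rotLaplacian (F := fun _ => (1 : ℝ)) (fun _ => contDiffAt_const) hF
  have h1 (i j : Fin 3) : rotDeriv i j (fun _ => (1 : ℝ)) = fun _ => 0 := by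
    ext; simp [rotDeriv]
  have h0 (i j : Fin 3) : rotDeriv i j (fun _ => (0 : ℝ)) = fun _ => 0 := by
    ext; simp [rotDeriv]
  have h2 (y : E3) : rotLaplacian (fun _ => (1 : ℝ)) y = 0 := by
    simp [rotLaplacian, h1, h0]
  simpa [h2] using this

end

noncomputable section

open Filter Topology

/-! ### The Laplacian of functions that are constant along rays -/

/-- `F` is constant along open rays from the origin. -/
def RayConst (F : E3 → ℝ) : Prop := ∀ c : ℝ, 0 < c → ∀ y, F (c • y) = F y

lemma RayConst.fderiv_self {F : E3 → ℝ} (hF : RayConst F) {y : E3}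
    (hd : DifferentiableAt ℝ F y) : fderiv ℝ F y y = 0 := by
  have h1 : HasDerivAt (fun c : ℝ => c • y) y 1 := by
    simpa using (hasDerivAt_id (1 : ℝ)).smul_const y
  have h2 : HasDerivAt (fun c : ℝ => F (c • y)) (fderiv ℝ F y y) 1 := by
    have : HasFDerivAt F (fderiv ℝ F y) ((1 : ℝ) • y) := by simpa using hd.hasFDerivAt
    exact this.comp_hasDerivAt 1 h1
  have h3 : HasDerivAt (fun c : ℝ => F (c • y)) 0 1 := by
    refine (hasDerivAt_const (1 : ℝ) (F y)).congr_of_eventuallyEq ?_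
    filter_upwards [lt_mem_nhds (zero_lt_one' ℝ)] with c hc using hF c hc y
  exact h2.unique h3

lemma hasFDerivAt_fderiv {F : E3 → ℝ} {y : E3} (h : ContDiffAt ℝ 2 F y) :
    HasFDerivAt (fderiv ℝ F) (fderiv ℝ (fderiv ℝ F) y) y :=
  ((h.fderiv_right (m := 1) (by norm_num)).differentiableAt one_ne_zero).hasFDerivAt

lemma rotDeriv_rotDeriv {F : E3 → ℝ} {y : E3} (h : ContDiffAt ℝ 2 F y) (i j : Fin 3) :
    rotDeriv i j (rotDeriv i j F) y =
      fderiv ℝ (fderiv ℝ F) y (rotGen i j y) (rotGen i j y) +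
        fderiv ℝ F y (rotGen i j (rotGen i j y)) := by
  have := (hasFDerivAt_fderiv h).clm_apply (rotGen i j).hasFDerivAt
  have e : rotDeriv i j F = fun z => fderiv ℝ F z (rotGen i j z) := rfl
  rw [rotDeriv, e, this.fderiv]
  simp [add_comm]

lemma laplacian_eq_sum_fderiv {F : E3 → ℝ} {y : E3} :
    Laplacian.laplacian F y = ∑ i, fderiv ℝ (fderiv ℝ F) y (stdVec i) (stdVec i) := by
  rw [InnerProductSpace.laplacian_eq_iteratedFDeriv_orthonormalBasis F (EuclideanSpace.basisFun (Fin 3) ℝ)]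
  refine Finset.sum_congr rfl fun i _ => ?_
  rw [iteratedFDeriv_two_apply]
  simp [stdVec]

lemma S2.sum_sq (x : S2) : (x : E3) 0 ^ 2 + (x : E3) 1 ^ 2 + (x : E3) 2 ^ 2 = 1 := by
  have := EuclideanSpace.norm_sq_eq (x : E3)
  rw [S2.norm_coe] at this
  simpa [Fin.sum_univ_three] using this.symm

lemma map_eq_sum_stdVec {M : Type*} [AddCommGroup M] [Module ℝ M] [TopologicalSpace M]
    (l : E3 →L[ℝ] M) (x : E3) :
    l x = x 0 • l (stdVec 0) + x 1 • l (stdVec 1) + x 2 • l (stdVec 2) := by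
  conv_lhs => rw [← sum_smul_stdVec x]
  simp [Fin.sum_univ_three]

/-- At a unit vector `x`, the rotational Laplacian is `ΔF - D²F(x, x) - 2 DF(x)`. The radial terms
vanish: `DF(y) y = 0` along rays, and differentiating this at `x` in the direction `x` gives `D²F(x,
x) = 0`. -/
lemma RayConst.laplacian_eq {F : E3 → ℝ} (hF : RayConst F) (x : S2)
    (h : ContDiffAt ℝ 2 F x) : Laplacian.laplacian F (x : E3) = rotLaplacian F x := by
  have h1 : fderiv ℝ F x x = 0 := hF.fderiv_self (h.differentiableAt (by norm_num))
  have h2 : fderiv ℝ (fderiv ℝ F) x x x = 0 := by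
    have e := (hasFDerivAt_fderiv h).clm_apply (hasFDerivAt_id (x : E3))
    have e0 : HasFDerivAt (fun y => fderiv ℝ F y (id y)) (0 : E3 →L[ℝ] ℝ) x := by
      refine (hasFDerivAt_const (0 : ℝ) (x : E3)).congr_of_eventuallyEq ?_
      filter_upwards [h.eventually (by simp)] with y hy
      exact hF.fderiv_self (hy.differentiableAt (by norm_num))
    have := congrArg (fun l => l (x : E3)) (e.unique e0)
    simpa [h1] using this
  rw [laplacian_eq_sum_fderiv, rotLaplacian]
  simp only [rotDeriv_rotDeriv h]
  set B := fderiv ℝ (fderiv ℝ F) (x : E3)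
  set l := fderiv ℝ F (x : E3)
  rw [map_eq_sum_stdVec B (x : E3)] at h2
  simp only [add_apply, smul_apply,
    map_eq_sum_stdVec (B _) (x : E3)] at h2
  rw [map_eq_sum_stdVec l (x : E3)] at h1
  have hx := S2.sum_sq x
  simp only [smul_eq_mul] at h1 h2
  simp [rotGen_apply, Fin.sum_univ_three, map_sub, map_smul, stdVec_apply]
  linear_combination (-(B (stdVec 0) (stdVec 0) + B (stdVec 1) (stdVec 1) +
    B (stdVec 2) (stdVec 2))) * hx + h2 + 2 * h1

lemma rotDeriv_zonal {g : ℝ → ℝ} {g' : ℝ} {p y : E3} (h : HasDerivAt g g' (inner ℝ p y))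
    (i j : Fin 3) : rotDeriv i j (fun z => g (inner ℝ p z)) y = g' * inner ℝ p (rotGen i j y) := by
  have h1 : HasFDerivAt (fun z : E3 => inner ℝ p z) (innerSL ℝ p) y := (innerSL ℝ p).hasFDerivAt
  have h2 : HasFDerivAt (fun z => g (inner ℝ p z)) (g' • innerSL ℝ p) y := h.comp_hasFDerivAt y h1
  rw [rotDeriv, h2.fderiv]
  simp

/-- In the variable `t = ⟨p, x⟩` the Laplacian acts on zonal functions as the Legendre operator `((1
- t²) g')'`. -/
lemma rotLaplacian_zonal {g g' : ℝ → ℝ} {g'' : ℝ} {U : Set ℝ} (hU : IsOpen U) (p x : S2)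
    (hx : inner ℝ (p : E3) (x : E3) ∈ U) (h : ∀ t ∈ U, HasDerivAt g (g' t) t)
    (h' : HasDerivAt g' g'' (inner ℝ (p : E3) (x : E3))) :
    rotLaplacian (fun z => g (inner ℝ (p : E3) z)) x =
      (1 - inner ℝ (p : E3) (x : E3) ^ 2) * g'' -
        2 * inner ℝ (p : E3) (x : E3) * g' (inner ℝ (p : E3) (x : E3)) := by
  have h1 : HasFDerivAt (fun z : E3 => inner ℝ (p : E3) z) (innerSL ℝ (p : E3)) (x : E3) :=
    (innerSL ℝ (p : E3)).hasFDerivAt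
  have key (i j : Fin 3) : rotDeriv i j (rotDeriv i j (fun z => g (inner ℝ (p : E3) z))) x =
      g'' * inner ℝ (p : E3) (rotGen i j x) ^ 2 +
        g' (inner ℝ (p : E3) (x : E3)) * inner ℝ (p : E3) (rotGen i j (rotGen i j x)) := by
    have e : rotDeriv i j (fun z => g (inner ℝ (p : E3) z)) =ᶠ[𝓝 (x : E3)]
        fun y => g' (inner ℝ (p : E3) y) * inner ℝ (p : E3) (rotGen i j y) := by
      filter_upwards [h1.continuousAt.preimage_mem_nhds (hU.mem_nhds hx)] with y hy
      exact rotDeriv_zonal (h _ hy) i j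
    rw [rotDeriv, e.fderiv_eq]
    have h2 : HasFDerivAt (fun y => inner ℝ (p : E3) (rotGen i j y))
        ((innerSL ℝ (p : E3)).comp (rotGen i j)) (x : E3) :=
      ((innerSL ℝ (p : E3)).comp (rotGen i j)).hasFDerivAt
    have h3 : HasFDerivAt (fun y => g' (inner ℝ (p : E3) y))
        (g'' • innerSL ℝ (p : E3)) (x : E3) := h'.comp_hasFDerivAt (x : E3) h1
    rw [(h3.fun_mul h2).fderiv]
    simp; ring
  simp only [rotLaplacian, key]
  have hx := S2.sum_sq x
  have hp := S2.sum_sq p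
  have hi : inner ℝ (p : E3) (x : E3) =
      (p : E3) 0 * (x : E3) 0 + (p : E3) 1 * (x : E3) 1 + (p : E3) 2 * (x : E3) 2 := by
    simp [PiLp.inner_apply, Fin.sum_univ_three, mul_comm]
  simp only [rotGen_apply, Fin.sum_univ_three, inner_sub_right, inner_smul_right,
    inner_stdVec_right, PiLp.sub_apply, PiLp.smul_apply, stdVec_apply, smul_eq_mul]
  simp
  set G := g' (inner ℝ (p : E3) (x : E3))
  rw [hi]
  linear_combination (g'' * ((x : E3) 0 ^ 2 + (x : E3) 1 ^ 2 + (x : E3) 2 ^ 2)) * hp + g'' * hx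

end

noncomputable section

open Filter Topology

/-! ### Zonal kernels -/

lemma S2.sub_inner_pos {a : ℝ} (ha : 1 < a) (p x : S2) : 0 < a - inner ℝ (p : E3) (x : E3) := by
  linarith [S2.inner_le_one p x]

lemma contDiffAt_log_zonal {a : ℝ} (ha : 1 < a) (p x : S2) {n : WithTop ℕ∞} :
    ContDiffAt ℝ n (fun z : E3 => -Real.log (a - inner ℝ (p : E3) z)) x :=
  ((contDiffAt_const.sub (contDiffAt_const.inner ℝ contDiffAt_id)).log
    (S2.sub_inner_pos ha p x).ne').neg

/-- For `a > 1` this is a smooth regularization of the logarithmic kernel. Its Laplacian is `1`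
minus a positive kernel that concentrates at `p` as `a` decreases to `1`. -/
lemma rotLaplacian_log_zonal {a : ℝ} (ha : 1 < a) (p x : S2) :
    rotLaplacian (fun z : E3 => -Real.log (a - inner ℝ (p : E3) z)) x =
      1 - (a ^ 2 - 1) / (a - inner ℝ (p : E3) (x : E3)) ^ 2 := by
  have hpos := S2.sub_inner_pos ha p x
  have hsub (t : ℝ) : HasDerivAt (fun t => a - t) (-1) t := by
    simpa using (hasDerivAt_id t).const_sub a
  rw [rotLaplacian_zonal (g := fun t => -Real.log (a - t)) (g' := fun t => (a - t)⁻¹)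
    (g'' := ((a - inner ℝ (p : E3) (x : E3)) ^ 2)⁻¹) (U := Iio a) isOpen_Iio p x
    (by simpa using hpos)]
  · generalize inner ℝ (p : E3) (x : E3) = t at *
    field_simp
    ring
  · intro t ht
    have : a - t ≠ 0 := by have : t < a := ht; linarith
    convert! ((hsub t).log this).neg using 1
    field_simp
  · convert! (hsub _).inv hpos.ne' using 1
    field_simp

/-- The Poisson kernel of the sphere, up to a factor `4π`. -/
def zonalPoisson (a : ℝ) (p x : S2) : ℝ := (a ^ 2 - 1) / (a - inner ℝ (p : E3) (x : E3)) ^ 2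

lemma zonalPoisson_nonneg {a : ℝ} (ha : 1 < a) (p x : S2) : 0 ≤ zonalPoisson a p x :=
  div_nonneg (by nlinarith) (sq_nonneg _)

lemma continuous_zonalPoisson_uncurry {a : ℝ} (ha : 1 < a) :
    Continuous fun q : S2 × S2 => zonalPoisson a q.1 q.2 := by
  unfold zonalPoisson
  refine Continuous.div (by fun_prop) (by fun_prop) fun q => ?_
  exact pow_ne_zero _ (S2.sub_inner_pos ha q.1 q.2).ne'

lemma continuous_zonalPoisson {a : ℝ} (ha : 1 < a) (p : S2) : Continuous (zonalPoisson a p) := by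
  unfold zonalPoisson
  refine Continuous.div (by fun_prop) (by fun_prop) fun x => ?_
  exact pow_ne_zero _ (S2.sub_inner_pos ha p x).ne'

lemma zonalPoisson_sphereMap (a : ℝ) (L : E3 ≃ₗᵢ[ℝ] E3) (p x : S2) :
    zonalPoisson a (sphereMap L p) (sphereMap L x) = zonalPoisson a p x := by
  simp [zonalPoisson, L.inner_map_map]

lemma integral_zonalPoisson {a : ℝ} (ha : 1 < a) (p : S2) :
    ∫ x, zonalPoisson a p x ∂sphereArea = 4 * Real.pi := by
  have h := integral_rotLaplacian fun x => contDiffAt_log_zonal ha p x (n := 2)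
  simp only [rotLaplacian_log_zonal ha] at h
  have h' : ∫ x, (1 - zonalPoisson a p x) ∂sphereArea = 0 := h
  rw [integral_sub (integrable_const 1) (integrable_sphere (continuous_zonalPoisson ha p))] at h'
  simp only [integral_const, sphereArea_real_univ, smul_eq_mul, mul_one] at h'
  linarith

/-- An approximate identity: the kernel is nonnegative with mass `4π`, and away from `p` its
denominator stays bounded below while the factor `a² - 1` tends to zero. -/
lemma tendsto_integral_zonalPoisson (p : S2) {f : S2 → ℝ} (hf : Continuous f) :
    Tendsto (fun a => ∫ x, zonalPoisson a p x * f x ∂sphereArea) (𝓝[>] 1)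
      (𝓝 (4 * Real.pi * f p)) := by
  have hpi : (4 * Real.pi) ≠ 0 := by positivity
  have hev : ∀ᶠ a : ℝ in 𝓝[>] 1, 1 < a := self_mem_nhdsWithin
  have := tendsto_setIntegral_peak_smul_of_integrableOn_of_tendsto (μ := sphereArea) (l := 𝓝[>] 1)
    (φ := fun a x => (4 * Real.pi)⁻¹ * zonalPoisson a p x) (g := f) (x₀ := p) (a := f p)
    (s := univ) (t := univ) MeasurableSet.univ MeasurableSet.univ Subset.rfl univ_mem
    (measure_ne_top _ _) ?_ ?_ ?_ ?_ (integrable_sphere hf).integrableOn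
    (hf.continuousAt.tendsto.mono_left nhdsWithin_le_nhds)
  · simp only [Measure.restrict_univ, smul_eq_mul, mul_assoc, integral_const_mul] at this
    simpa [← mul_assoc, mul_inv_cancel₀ hpi, inv_mul_cancel_left₀ hpi, hpi,
      Real.pi_ne_zero] using this.const_mul (4 * Real.pi)
  · filter_upwards [hev] with a ha x _
    exact mul_nonneg (by positivity) (zonalPoisson_nonneg ha p x)
  · intro u hu hpu
    rw [← compl_eq_univ_sdiff]
    obtain ⟨δ, hδ, hδu⟩ : ∃ δ > 0, ∀ x ∈ uᶜ, δ ≤ 1 - inner ℝ (p : E3) (x : E3) := by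
      rcases (uᶜ).eq_empty_or_nonempty with h0 | h0
      · exact ⟨1, one_pos, by simp [h0]⟩
      obtain ⟨x₀, hx₀, hmin⟩ := (hu.isClosed_compl.isCompact).exists_isMinOn h0
        (f := fun x : S2 => 1 - inner ℝ (p : E3) (x : E3)) (by fun_prop)
      refine ⟨_, ?_, hmin⟩
      have : p ≠ x₀ := by rintro rfl; exact hx₀ hpu
      linarith [S2.inner_lt_one this]
    rw [Metric.tendstoUniformlyOn_iff]
    intro ε hε
    have hlim : Tendsto (fun a : ℝ => (4 * Real.pi)⁻¹ * ((a ^ 2 - 1) / δ ^ 2)) (𝓝[>] 1) (𝓝 0) := by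
      have : Continuous fun a : ℝ => (4 * Real.pi)⁻¹ * ((a ^ 2 - 1) / δ ^ 2) := by fun_prop
      simpa using (this.tendsto 1).mono_left nhdsWithin_le_nhds
    filter_upwards [hev, hlim.eventually (gt_mem_nhds hε)] with a ha hlt x hx
    have h1 := hδu x hx
    have hnn := mul_nonneg (by positivity : 0 ≤ (4 * Real.pi)⁻¹) (zonalPoisson_nonneg ha p x)
    rw [Pi.zero_apply, dist_comm, Real.dist_0_eq_abs, abs_of_nonneg hnn]
    refine lt_of_le_of_lt ?_ hlt
    unfold zonalPoisson
    gcongr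
    · nlinarith
    · linarith
  · refine tendsto_const_nhds.congr' ?_
    filter_upwards [hev] with a ha
    rw [Measure.restrict_univ, integral_const_mul, integral_zonalPoisson ha p, inv_mul_cancel₀ hpi]
  · filter_upwards [hev] with a ha
    exact (continuous_const.mul (continuous_zonalPoisson ha p)).aestronglyMeasurable

/-- A finite Borel measure on the sphere that is invariant under all linear isometries is a
multiple of the area. -/
lemma eq_smul_sphereArea_of_invariant (ν : Measure S2) [IsFiniteMeasure ν]
    (hν : ∀ L : E3 ≃ₗᵢ[ℝ] E3, ν.map (sphereMap L) = ν) :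
    ν = (ν univ / ENNReal.ofReal (4 * Real.pi)) • sphereArea := by
  have hpi : (4 * Real.pi) ≠ 0 := by positivity
  have hne : ν univ / ENNReal.ofReal (4 * Real.pi) ≠ ∞ :=
    ENNReal.div_ne_top (measure_ne_top _ _) (by simp [Real.pi_pos])
  have : IsFiniteMeasure ((ν univ / ENNReal.ofReal (4 * Real.pi)) • sphereArea) :=
    Measure.smul_finite _ hne
  refine ext_of_forall_integral_eq_of_IsFiniteMeasure fun f => ?_
  obtain ⟨C, hC⟩ := exists_bound_sphere f.continuous
  -- Smooth `f` by the kernel and integrate against `ν`. As `a` tends to `1` this gives `4π ∫ f dν`;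
  -- after exchanging the integrals, invariance makes the mass of the kernel against `ν` constant,
  -- leaving a multiple of the area integral of `f`.
  have hswap {a : ℝ} (ha : 1 < a) (f : S2 → ℝ) (hf : Continuous f) :
      ∫ y, ∫ x, zonalPoisson a y x * f x ∂sphereArea ∂ν =
        ∫ x, (∫ y, zonalPoisson a y x ∂ν) * f x ∂sphereArea := by
    rw [integral_integral_swap]
    · simp only [integral_mul_const]
    · exact (((continuous_zonalPoisson_uncurry ha).fun_mul
        (hf.comp continuous_snd)).integrable_of_hasCompactSupport
        (HasCompactSupport.of_compactSpace _))
  have hconst (a : ℝ) (x x' : S2) :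
      ∫ y, zonalPoisson a y x ∂ν = ∫ y, zonalPoisson a y x' ∂ν := by
    obtain ⟨L, hL⟩ := exists_sphereMap_eq x x'
    rw [← hL]
    conv_rhs => rw [← hν L]
    rw [integral_map (measurable_sphereMap L).aemeasurable]
    · simp only [zonalPoisson_sphereMap]
    · refine Measurable.aestronglyMeasurable ?_
      unfold zonalPoisson
      exact Measurable.div (by fun_prop) (Continuous.measurable (by fun_prop))
  have hmass {a : ℝ} (ha : 1 < a) (x : S2) : ∫ y, zonalPoisson a y x ∂ν = ν.real univ := by
    have h := hswap ha (fun _ => 1) continuous_const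
    simp only [mul_one, integral_zonalPoisson ha, fun x' => hconst a x' x, integral_const,
      sphereArea_real_univ, smul_eq_mul] at h
    exact mul_left_cancel₀ hpi (by linarith)
  have hlim : Tendsto (fun a => ∫ y, ∫ x, zonalPoisson a y x * f x ∂sphereArea ∂ν) (𝓝[>] 1)
      (𝓝 (∫ y, 4 * Real.pi * f y ∂ν)) := by
    refine tendsto_integral_filter_of_dominated_convergence (fun _ => 4 * Real.pi * C) ?_ ?_
      (integrable_const _) (.of_forall fun y => tendsto_integral_zonalPoisson y f.continuous)
    · filter_upwards [self_mem_nhdsWithin] with a ha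
      have := (((continuous_zonalPoisson_uncurry ha).fun_mul
        (f.continuous.comp continuous_snd)).integrable_of_hasCompactSupport
        (μ := ν.prod sphereArea) (HasCompactSupport.of_compactSpace _))
      exact this.integral_prod_left.aestronglyMeasurable
    · filter_upwards [self_mem_nhdsWithin] with a ha
      refine .of_forall fun y => ?_
      rw [← integral_zonalPoisson ha y, ← integral_mul_const]
      refine norm_integral_le_of_norm_le
        ((integrable_sphere (continuous_zonalPoisson ha y)).mul_const C) (.of_forall fun x => ?_)
      rw [norm_mul, Real.norm_of_nonneg (zonalPoisson_nonneg ha y x)]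
      exact mul_le_mul_of_nonneg_left (hC x) (zonalPoisson_nonneg ha y x)
  have hlim' : Tendsto (fun a => ∫ y, ∫ x, zonalPoisson a y x * f x ∂sphereArea ∂ν) (𝓝[>] 1)
      (𝓝 (ν.real univ * ∫ x, f x ∂sphereArea)) := by
    refine tendsto_const_nhds.congr' ?_
    filter_upwards [self_mem_nhdsWithin] with a ha
    rw [hswap ha f f.continuous]
    simp only [hmass ha, integral_const_mul]
  have heq := tendsto_nhds_unique hlim hlim'
  rw [integral_const_mul] at heq
  rw [integral_smul_measure, ENNReal.toReal_div, ENNReal.toReal_ofReal (by positivity), smul_eq_mul]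
  rw [← measureReal_def, div_mul_eq_mul_div, eq_div_iff hpi, mul_comm, heq]

end

noncomputable section

open Filter Topology

/-! ### The logarithmic kernel of the sphere -/

open scoped Pointwise in
lemma sphereArea_singleton (p : S2) : sphereArea {p} = 0 := by
  rw [sphereArea, Measure.toSphere_apply' _ (measurableSet_singleton p)]
  have hsub : (Ioo (0 : ℝ) 1 • (Subtype.val '' ({p} : Set S2)) : Set E3) ⊆ (ℝ ∙ (p : E3)) := by
    rintro _ ⟨r, _, _, ⟨q, hq, rfl⟩, rfl⟩
    rw [mem_singleton_iff.1 hq]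
    exact Submodule.smul_mem _ _ (Submodule.mem_span_singleton_self _)
  have htop : (ℝ ∙ (p : E3)) ≠ ⊤ := by
    intro h
    have h1 := finrank_span_singleton (K := ℝ) (S2.coe_ne_zero p)
    rw [h, finrank_top] at h1
    simp at h1
  rw [measure_mono_null hsub (Measure.addHaar_submodule _ _ htop), mul_zero]

/-- The kernel `(1 - ⟨x, y⟩)^{-1/2}`, a multiple of `1 / |x - y|`. -/
def invSqrtKernel (x y : S2) : ℝ := (√(1 - inner ℝ (x : E3) (y : E3)))⁻¹

lemma invSqrtKernel_nonneg (x y : S2) : 0 ≤ invSqrtKernel x y := by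
  unfold invSqrtKernel; positivity

lemma measurable_invSqrtKernel_uncurry :
    Measurable fun q : S2 × S2 => invSqrtKernel q.1 q.2 := by
  unfold invSqrtKernel
  exact (Continuous.measurable (by fun_prop)).inv

lemma measurable_invSqrtKernel (p : S2) : Measurable (invSqrtKernel p) := by
  unfold invSqrtKernel
  exact (Continuous.measurable (by fun_prop)).inv

/-- The zonal function `√(a - t)` has Laplacian at least `(a - t)^{-1/2} / 2 - 2`, and its Laplacian
integrates to zero. The bound is uniform in `a`, so Fatou's lemma carries it to the singular kernel
at `a = 1`. -/
lemma integral_inv_sqrt_zonal_le {a : ℝ} (ha : 1 < a) (ha2 : a ≤ 2) (p : S2) :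
    ∫ x : S2, (√(a - inner ℝ (p : E3) (x : E3)))⁻¹ ∂sphereArea ≤ 16 * Real.pi := by
  have hsub (t : ℝ) : HasDerivAt (fun t => a - t) (-1) t := by
    simpa using (hasDerivAt_id t).const_sub a
  have hC2 (x : S2) : ContDiffAt ℝ 2 (fun z : E3 => √(a - inner ℝ (p : E3) z)) x :=
    (contDiffAt_const.sub (contDiffAt_const.inner ℝ contDiffAt_id)).sqrt
      (S2.sub_inner_pos ha p x).ne'
  have hint := integral_rotLaplacian hC2
  have hcont : Continuous fun x : S2 => (√(a - inner ℝ (p : E3) (x : E3)))⁻¹ :=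
    Continuous.inv₀ (by fun_prop) fun x => (Real.sqrt_pos.2 (S2.sub_inner_pos ha p x)).ne'
  have hle (x : S2) : 1 / 2 * (√(a - inner ℝ (p : E3) (x : E3)))⁻¹ - 2 ≤
      rotLaplacian (fun z : E3 => √(a - inner ℝ (p : E3) z)) x := by
    have hpos := S2.sub_inner_pos ha p x
    have hs := Real.sqrt_pos.2 hpos
    rw [rotLaplacian_zonal (g := fun t => √(a - t)) (g' := fun t => -(2 * √(a - t))⁻¹)
      (g'' := -(4 * √(a - inner ℝ (p : E3) (x : E3)) ^ 3)⁻¹) (U := Iio a) isOpen_Iio p x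
      (by simpa using hpos)]
    · have h1 := S2.inner_le_one p x
      have h2 := S2.neg_one_le_inner p x
      have hsq := Real.sq_sqrt hpos.le
      generalize inner ℝ (p : E3) (x : E3) = t at *
      generalize √(a - t) = s at *
      obtain rfl : t = a - s ^ 2 := by linarith
      have hs2 : s ≤ 2 := by nlinarith
      have e : (1 - (a - s ^ 2) ^ 2) * -(4 * s ^ 3)⁻¹ - 2 * (a - s ^ 2) * -(2 * s)⁻¹ -
          (1 / 2 * s⁻¹ - 2) =
          ((a - 1) * s ^ 2 + (s ^ 2 / 2 - (1 - (a - s ^ 2) ^ 2) / 4) + (2 - s) * s ^ 3) / s ^ 3 := by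
        field_simp; ring
      have : 0 ≤ ((a - 1) * s ^ 2 + (s ^ 2 / 2 - (1 - (a - s ^ 2) ^ 2) / 4) +
          (2 - s) * s ^ 3) / s ^ 3 := by
        refine div_nonneg ?_ (by positivity)
        have i1 : 0 ≤ (a - 1) * s ^ 2 := by nlinarith
        have i2 : 0 ≤ (2 - s) * s ^ 3 := mul_nonneg (by linarith) (by positivity)
        -- The middle term is nonnegative because `1 - t² ≤ 2 (1 - t) ≤ 2 s²`.
        nlinarith
      linarith
    · intro t ht
      have : 0 < a - t := by have : t < a := ht; linarith
      convert! (hsub t).sqrt this.ne' using 1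
      rw [neg_div, one_div]
    · convert! (((hsub _).sqrt hpos.ne').const_mul 2).inv (by positivity) |>.neg using 1
      field_simp
      norm_num
  have hmono := integral_mono (integrable_sphere (by fun_prop))
    (integrable_sphere (continuous_rotLaplacian hC2)) hle
  rw [hint, integral_sub ((integrable_sphere hcont).const_mul _) (integrable_const _),
    integral_const_mul, integral_const, sphereArea_real_univ, smul_eq_mul] at hmono
  linarith

lemma lintegral_invSqrtKernel_le (p : S2) :
    ∫⁻ x, ENNReal.ofReal (invSqrtKernel p x) ∂sphereArea ≤ ENNReal.ofReal (16 * Real.pi) := by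
  let a : ℕ → ℝ := fun n => 1 + 1 / (n + 1)
  have ha1 (n : ℕ) : 1 < a n := by simp only [a]; linarith [Nat.one_div_pos_of_nat (α := ℝ) (n := n)]
  have ha2 (n : ℕ) : a n ≤ 2 := by
    have : 1 / ((n : ℝ) + 1) ≤ 1 := by rw [div_le_one (by positivity)]; linarith [n.cast_nonneg (α := ℝ)]
    simp only [a]; linarith
  have hlim : Tendsto a atTop (𝓝 1) := by
    simpa [a] using (tendsto_one_div_add_atTop_nhds_zero_nat (𝕜 := ℝ)).const_add 1
  let f : ℕ → S2 → ℝ≥0∞ := fun n x => ENNReal.ofReal (√(a n - inner ℝ (p : E3) (x : E3)))⁻¹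
  have hcont (n : ℕ) : Continuous fun x : S2 => (√(a n - inner ℝ (p : E3) (x : E3)))⁻¹ :=
    Continuous.inv₀ (by fun_prop) fun x => (Real.sqrt_pos.2 (S2.sub_inner_pos (ha1 n) p x)).ne'
  calc ∫⁻ x, ENNReal.ofReal (invSqrtKernel p x) ∂sphereArea
      ≤ ∫⁻ x, liminf (fun n => f n x) atTop ∂sphereArea := by
        refine lintegral_mono fun x => ?_
        rcases eq_or_ne p x with rfl | hne
        · simp [invSqrtKernel]
        · have hpos : 0 < 1 - inner ℝ (p : E3) (x : E3) := by linarith [S2.inner_lt_one hne]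
          refine le_of_eq (Tendsto.liminf_eq ?_).symm
          refine ENNReal.tendsto_ofReal (Tendsto.inv₀ ?_ (Real.sqrt_pos.2 hpos).ne')
          exact (hlim.sub_const _).sqrt
    _ ≤ liminf (fun n => ∫⁻ x, f n x ∂sphereArea) atTop :=
        lintegral_liminf_le fun n => (hcont n).measurable.ennreal_ofReal
    _ ≤ ENNReal.ofReal (16 * Real.pi) := by
        refine (liminf_le_liminf (.of_forall fun n => ?_)).trans_eq (liminf_const _)
        rw [← ofReal_integral_eq_lintegral_ofReal (integrable_sphere (hcont n))
          (.of_forall fun x => by positivity)]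
        exact ENNReal.ofReal_le_ofReal (integral_inv_sqrt_zonal_le (ha1 n) (ha2 n) p)

lemma integrable_invSqrtKernel (p : S2) : Integrable (invSqrtKernel p) sphereArea := by
  refine ⟨(measurable_invSqrtKernel p).aestronglyMeasurable, ?_⟩
  rw [hasFiniteIntegral_iff_ofReal (.of_forall (invSqrtKernel_nonneg p))]
  exact (lintegral_invSqrtKernel_le p).trans_lt ENNReal.ofReal_lt_top

lemma integral_invSqrtKernel_le (p : S2) :
    ∫ x, invSqrtKernel p x ∂sphereArea ≤ 16 * Real.pi := by
  rw [integral_eq_lintegral_of_nonneg_ae (.of_forall (invSqrtKernel_nonneg p))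
    (measurable_invSqrtKernel p).aestronglyMeasurable]
  exact ENNReal.toReal_le_of_le_ofReal (by positivity) (lintegral_invSqrtKernel_le p)

/-- The logarithmic kernel `-log (1 - ⟨x, y⟩)` (with the value `0` on the diagonal). -/
def logKernel (x y : S2) : ℝ := -Real.log (1 - inner ℝ (x : E3) (y : E3))

lemma logKernel_comm (x y : S2) : logKernel x y = logKernel y x := by
  rw [logKernel, logKernel, real_inner_comm]

lemma logKernel_sphereMap (L : E3 ≃ₗᵢ[ℝ] E3) (x y : S2) :
    logKernel (sphereMap L x) (sphereMap L y) = logKernel x y := by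
  simp [logKernel, L.inner_map_map]

lemma measurable_logKernel_uncurry : Measurable fun q : S2 × S2 => logKernel q.1 q.2 := by
  unfold logKernel
  exact (Real.measurable_log.comp (Continuous.measurable (by fun_prop))).neg

lemma measurable_logKernel (p : S2) : Measurable (logKernel p) := by
  unfold logKernel
  exact (Real.measurable_log.comp (Continuous.measurable (by fun_prop))).neg

lemma neg_one_le_logKernel (x y : S2) : -1 ≤ logKernel x y := by
  have h1 := S2.neg_one_le_inner x y
  have h2 := S2.inner_le_one x y
  rcases h2.eq_or_lt with h | h
  · simp [logKernel, h]
  · have := Real.log_le_sub_one_of_pos (sub_pos.2 h)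
    unfold logKernel; linarith

/-- For small `s`, write `log s = 4 log r` with `r = s^{1/4}` and use `|log r| ≤ 1 / r`. The square
root singularity thus dominates the logarithm and its square. -/
lemma sq_log_le {s : ℝ} (h0 : 0 ≤ s) (h2 : s ≤ 2) : Real.log s ^ 2 ≤ 16 * (√s)⁻¹ + 1 := by
  rcases h0.eq_or_lt with rfl | h0
  · simp
  have hr : 0 < √√s := Real.sqrt_pos.2 (Real.sqrt_pos.2 h0)
  have hlog : Real.log s = 4 * Real.log √√s := by
    rw [Real.log_sqrt (Real.sqrt_nonneg _), Real.log_sqrt h0.le]; ring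
  have hsq : √√s ^ 2 = √s := Real.sq_sqrt (Real.sqrt_nonneg _)
  rcases le_or_gt 1 s with h1 | h1
  · have hl := Real.log_nonneg h1
    have hl' := Real.log_le_sub_one_of_pos h0
    have : 0 ≤ 16 * (√s)⁻¹ := by positivity
    nlinarith
  · have hl := Real.log_neg h0 h1
    have hl' := Real.one_sub_inv_le_log_of_pos hr
    have hi : 0 < (√√s)⁻¹ := inv_pos.2 hr
    have h3 : -Real.log √√s ≤ (√√s)⁻¹ := by linarith
    have h4 : 0 ≤ -Real.log √√s := by linarith
    have : Real.log √√s ^ 2 ≤ (√√s)⁻¹ ^ 2 := by nlinarith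
    rw [inv_pow, hsq] at this
    rw [hlog]; nlinarith

lemma sq_logKernel_le (x y : S2) : logKernel x y ^ 2 ≤ 16 * invSqrtKernel x y + 1 := by
  rw [logKernel, neg_sq]
  exact sq_log_le (by linarith [S2.inner_le_one x y]) (by linarith [S2.neg_one_le_inner x y])

lemma abs_logKernel_le (x y : S2) : |logKernel x y| ≤ 8 * invSqrtKernel x y + 1 := by
  have h := sq_logKernel_le x y
  have := sq_abs (logKernel x y)
  nlinarith [sq_nonneg (|logKernel x y| - 1), abs_nonneg (logKernel x y)]

lemma integrable_logKernel (p : S2) : Integrable (logKernel p) sphereArea :=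
  (((integrable_invSqrtKernel p).const_mul 8).add (integrable_const 1)).mono'
    (measurable_logKernel p).aestronglyMeasurable (.of_forall (abs_logKernel_le p))

lemma integrable_logKernel_sq (p : S2) : Integrable (fun x => logKernel p x ^ 2) sphereArea :=
  (((integrable_invSqrtKernel p).const_mul 16).add (integrable_const 1)).mono'
    ((measurable_logKernel p).pow_const 2).aestronglyMeasurable (.of_forall fun x => by
      rw [Real.norm_of_nonneg (sq_nonneg _)]; exact sq_logKernel_le p x)

/-- The value of `∫ -log (1 - ⟨p, x⟩) dx` does not depend on `p`. -/
lemma integral_logKernel_eq (p q : S2) :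
    ∫ x, logKernel p x ∂sphereArea = ∫ x, logKernel q x ∂sphereArea := by
  obtain ⟨L, rfl⟩ := exists_sphereMap_eq p q
  rw [← integral_sphereMap L (logKernel (sphereMap L p))]
  simp only [logKernel_sphereMap]

/-- Green's representation formula on the sphere. -/
lemma abs_log_sub_le {a t : ℝ} (ha1 : 1 < a) (ha2 : a < 2) (ht1 : -1 ≤ t) (ht2 : t < 1) :
    |Real.log (a - t)| ≤ |Real.log (1 - t)| + 2 := by
  rcases le_or_gt 1 (a - t) with h | h
  · have i1 := Real.log_nonneg h
    have i2 := Real.log_le_sub_one_of_pos (by linarith : 0 < a - t)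
    rw [abs_of_nonneg i1]
    linarith [abs_nonneg (Real.log (1 - t))]
  · have i1 := Real.log_neg (by linarith) h
    have i2 : Real.log (1 - t) ≤ Real.log (a - t) :=
      Real.log_le_log (by linarith) (by linarith)
    rw [abs_of_neg i1, abs_of_neg (by linarith)]
    linarith

/-- Green's second identity for the kernel `-log (a - ⟨p, x⟩)` moves the Laplacian onto it. As `a`
tends to `1`, `abs_log_sub_le` dominates one side and the approximate identity evaluates the other.
-/
lemma integral_logKernel_mul_rotLaplacian (p : S2) {F : E3 → ℝ}
    (hF : ∀ x : S2, ContDiffAt ℝ 2 F x) :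
    ∫ x, logKernel p x * rotLaplacian F x ∂sphereArea =
      (∫ x : S2, F x ∂sphereArea) - 4 * Real.pi * F p := by
  have hFc := continuous_sphere_of_contDiffAt hF
  have hLc := continuous_rotLaplacian hF
  obtain ⟨C, hC⟩ := exists_bound_sphere hLc
  have h1 : Tendsto (fun a : ℝ => ∫ x : S2,
      -Real.log (a - inner ℝ (p : E3) (x : E3)) * rotLaplacian F x ∂sphereArea) (𝓝[>] 1)
      (𝓝 (∫ x, logKernel p x * rotLaplacian F x ∂sphereArea)) := by
    have hae : ∀ᵐ x ∂sphereArea, p ≠ x := by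
      rw [ae_iff]; simpa using sphereArea_singleton p
    have hev : ∀ᶠ a : ℝ in 𝓝[>] 1, 1 < a ∧ a < 2 := by
      filter_upwards [Ioo_mem_nhdsGT (by norm_num : (1 : ℝ) < 2)] with a ha using ha
    refine tendsto_integral_filter_of_dominated_convergence
      (fun x => (|logKernel p x| + 2) * C) ?_ ?_ ?_ ?_
    · filter_upwards [hev] with a ha
      exact (((continuous_sphere_of_contDiffAt fun x => contDiffAt_log_zonal ha.1 p x (n := 0))).mul
        hLc).aestronglyMeasurable
    · filter_upwards [hev] with a ha
      filter_upwards [hae] with x hx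
      have hx1 := S2.inner_lt_one hx
      have hx2 := S2.neg_one_le_inner p x
      rw [norm_mul]
      refine mul_le_mul ?_ (hC x) (norm_nonneg _) (by positivity)
      rw [logKernel, abs_neg, norm_neg, Real.norm_eq_abs]
      exact abs_log_sub_le ha.1 ha.2 hx2 hx1
    · exact ((integrable_logKernel p).abs.add (integrable_const 2)).mul_const C
    · filter_upwards [hae] with x hx
      have hx1 := S2.inner_lt_one hx
      refine Tendsto.mul_const _ (Tendsto.neg (Tendsto.log ?_ (by linarith)))
      exact (tendsto_id.sub_const _).mono_left nhdsWithin_le_nhds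
  have h2 : Tendsto (fun a : ℝ => ∫ x : S2,
      -Real.log (a - inner ℝ (p : E3) (x : E3)) * rotLaplacian F x ∂sphereArea) (𝓝[>] 1)
      (𝓝 ((∫ x : S2, F x ∂sphereArea) - 4 * Real.pi * F p)) := by
    refine Tendsto.congr' ?_ ((tendsto_integral_zonalPoisson p hFc).const_sub _)
    filter_upwards [self_mem_nhdsWithin] with a ha
    rw [integral_mul_rotLaplacian (F := fun z : E3 => -Real.log (a - inner ℝ (p : E3) z))
      (fun x => contDiffAt_log_zonal ha p x) hF]
    rw [← integral_sub (integrable_sphere hFc)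
      (integrable_sphere ((continuous_zonalPoisson ha p).fun_mul hFc))]
    refine integral_congr_ae (.of_forall fun x => ?_)
    simp only [rotLaplacian_log_zonal ha, zonalPoisson]
    ring
  exact tendsto_nhds_unique h1 h2

end

noncomputable section

open Filter Topology

/-! ### The projective plane and its noncontractible loops -/

lemma toRP2_eq_iff {x y : S2} : toRP2 x = toRP2 y ↔ x = y ∨ x = -y := Quotient.eq

lemma toRP2_neg (x : S2) : toRP2 (-x) = toRP2 x := toRP2_eq_iff.2 (Or.inr rfl)

lemma continuous_toRP2 : Continuous toRP2 := continuous_quotient_mk'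

lemma S2.dist_neg (x : S2) : dist x (-x) = 2 := by
  rw [Subtype.dist_eq, dist_eq_norm]
  simp only [Metric.sphere, coe_neg_sphere, sub_neg_eq_add, ← two_smul ℝ (x : E3), norm_smul]
  simp

lemma S2.ne_neg (x : S2) : x ≠ -x := fun h => by
  have := S2.dist_neg x; rw [← h, dist_self] at this; norm_num at this

lemma unitSphere_real_eq (g : Metric.sphere (0 : ℝ) 1) : (g : ℝ) = 1 ∨ (g : ℝ) = -1 := by
  have := g.2
  rw [mem_sphere_zero_iff_norm, Real.norm_eq_abs] at this
  exact eq_or_eq_neg_of_abs_eq this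

/-- The projective plane is the quotient of the sphere by the group `{1, -1}`, realized as the unit
sphere of `ℝ`. -/
lemma isCoveringMap_toRP2 : IsCoveringMap toRP2 := by
  have hsm (g : Metric.sphere (0 : ℝ) 1) (y : S2) : ((g • y : S2) : E3) = (g : ℝ) • (y : E3) := rfl
  have hq : IsQuotientCoveringMap toRP2 (Metric.sphere (0 : ℝ) 1) := by
    refine ⟨isQuotientMap_quotient_mk', inferInstance, fun {x y} => ?_, fun x => ?_⟩
    · rw [toRP2_eq_iff, MulAction.mem_orbit_iff]
      constructor
      · rintro (h | h)
        · exact ⟨1, by rw [h, one_smul]⟩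
        · refine ⟨⟨-1, by simp⟩, ?_⟩
          rw [h]; ext1; rw [hsm]; simp
      · rintro ⟨g, rfl⟩
        rcases unitSphere_real_eq g with h | h
        · left; ext1; rw [hsm]; simp [h]
        · right; ext1; rw [hsm]; simp [h]
    -- Antipodal points have chordal distance `2`, so a ball of radius `1` is disjoint from its
    -- antipodal image.
    · refine ⟨Metric.ball x 1, Metric.ball_mem_nhds x one_pos, fun g => ?_⟩
      rintro ⟨_, ⟨y, hy, rfl⟩, hz⟩
      rcases unitSphere_real_eq g with h | h
      · exact Subtype.ext h
      · exfalso
        have e : g • y = -y := by ext1; rw [hsm]; simp [h]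
        simp only [e, Metric.mem_ball] at hy hz
        have := dist_triangle_right y (-y) x
        rw [S2.dist_neg] at this
        linarith
  exact hq.isCoveringMap

/-- Homotopic paths have lifts with the same starting point and the same end point, and the lift of
the constant path is constant. -/
lemma not_homotopic_refl_of_lift {x : RP2} (c : Path x x) (Γ : C(unitInterval, S2))
    (hΓ : ∀ t, toRP2 (Γ t) = c t) (h : Γ 1 ≠ Γ 0) : ¬ c.Homotopic (Path.refl x) := by
  intro hc
  have cov := isCoveringMap_toRP2
  have h0 : x = toRP2 (Γ 0) := by rw [hΓ, c.source]
  have e1 : Γ = cov.liftPath c.toContinuousMap (Γ 0) (by rw [hΓ]; rfl) :=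
    (cov.eq_liftPath_iff' _).2 ⟨funext hΓ, rfl⟩
  have e2 : ContinuousMap.const unitInterval (Γ 0) =
      cov.liftPath (Path.refl x).toContinuousMap (Γ 0) (by rw [← h0]; rfl) :=
    (cov.eq_liftPath_iff' _).2 ⟨funext fun _ => h0.symm, rfl⟩
  have key := cov.liftPath_apply_one_eq_of_homotopicRel hc (Γ 0) (by rw [hΓ]; rfl)
    (by rw [← h0]; rfl)
  rw [← e1, ← e2] at key
  exact h key

lemma systole_le_of_antipodal (u : RP2 → EReal) {γ : ℝ → S2}
    (hγ : ContDiffOn ℝ 1 (fun s => (γ s : EuclideanSpace ℝ (Fin 3))) (Icc 0 1))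
    (h : γ 1 = -γ 0) : systole u ≤ curveLength u γ := by
  have hcont : Continuous fun t : unitInterval => γ t :=
    Continuous.subtype_mk (continuousOn_iff_continuous_domRestrict.1 hγ.continuousOn) _
  let c : Path (toRP2 (γ 0)) (toRP2 (γ 0)) :=
    { toFun := fun t => toRP2 (γ t)
      continuous_toFun := continuous_toRP2.comp hcont
      source' := by simp
      target' := by simp [h, toRP2_neg] }
  have hc : ¬ c.Homotopic (Path.refl _) := by
    refine not_homotopic_refl_of_lift c ⟨_, hcont⟩ (fun _ => rfl) ?_
    simpa [h] using (S2.ne_neg (γ 0)).symm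
  exact iInf_le_of_le _ (iInf_le_of_le c (iInf_le_of_le hc
    (iInf_le_of_le γ (iInf_le_of_le ⟨hγ, fun _ => rfl⟩ le_rfl))))

/-- A `C¹` curve misses a point of the sphere. -/
lemma exists_notMem_image_of_contDiffOn {γ : ℝ → S2}
    (hγ : ContDiffOn ℝ 1 (fun s => (γ s : EuclideanSpace ℝ (Fin 3))) (Icc 0 1)) :
    ∃ p : S2, ∀ t ∈ Icc (0 : ℝ) 1, γ t ≠ p := by
  -- The cone over the curve is a `C¹` image of a planar set, so its complement is dense in 3-space;
  -- the direction of any nonzero point of the complement is missed by the curve.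
  have hf : ContDiffOn ℝ 1 (fun q : ℝ × ℝ => q.2 • (γ q.1 : E3)) (Icc 0 1 ×ˢ univ) :=
    contDiff_snd.contDiffOn.smul (hγ.comp contDiff_fst.contDiffOn fun q hq => hq.1)
  have hdim : dimH (Icc (0 : ℝ) 1 ×ˢ (univ : Set ℝ)) < Module.finrank ℝ E3 := by
    refine (dimH_mono (subset_univ _)).trans_lt ?_
    rw [Real.dimH_univ_eq_finrank]
    simp only [Module.finrank_prod, Module.finrank_self, finrank_euclideanSpace, Fintype.card_fin]
    norm_num
  have hd := hf.dense_compl_image_of_dimH_lt_finrank ((convex_Icc 0 1).prod convex_univ)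
    Subset.rfl hdim
  obtain ⟨y, hy, hy1⟩ := hd.exists_dist_lt (stdVec 0) one_pos
  have hy0 : y ≠ 0 := by rintro rfl; simp [dist_zero_right] at hy1
  refine ⟨⟨‖y‖⁻¹ • y, by simp [norm_smul, hy0]⟩, fun t ht he => hy ⟨(t, ‖y‖), ⟨ht, mem_univ _⟩, ?_⟩⟩
  simp [he, smul_smul, hy0]

/-- Since the lift misses a point, stereographic projection places it in a plane, where it
contracts. The contraction is pushed down to the projective plane. -/
lemma homotopic_refl_of_closed_lift {x : RP2} (c : Path x x) {γ : ℝ → S2} (hγ : IsC1Lift c γ)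
    (h : γ 1 = γ 0) : c.Homotopic (Path.refl x) := by
  obtain ⟨p, hp⟩ := exists_notMem_image_of_contDiffOn hγ.1
  have hcont : Continuous fun t : unitInterval => γ t :=
    Continuous.subtype_mk (continuousOn_iff_continuous_domRestrict.1 hγ.1.continuousOn) _
  let e := stereographic (S2.norm_coe p)
  let f : (ℝ ∙ (p : E3))ᗮ → RP2 := fun z => toRP2 (e.symm z)
  have hf : Continuous f := continuous_toRP2.comp
    (isOpenEmbedding_stereographic_symm (S2.norm_coe p)).continuous
  have hsrc (t : unitInterval) : γ t ∈ e.source := hp t t.2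
  have hinv (t : unitInterval) : f (e (γ t)) = toRP2 (γ t) := by
    simp only [f]; rw [e.left_inv (hsrc t)]
  let δ : Path (e (γ 0)) (e (γ 0)) :=
    { toFun := fun t => e (γ t)
      continuous_toFun := e.continuousOn.comp_continuous hcont hsrc
      source' := by simp
      target' := by simp [h] }
  have h0 : f (e (γ 0)) = x := by
    have := hinv 0
    rw [hγ.2 0, c.source] at this
    simpa using this
  have h1 : c = (δ.map hf).cast h0.symm h0.symm := by
    ext t
    simp only [Path.cast_coe, Path.map_coe, Function.comp_apply]
    exact (hγ.2 t).symm.trans (hinv t).symm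
  have h2 : Path.refl x = ((Path.refl (e (γ 0))).map hf).cast h0.symm h0.symm := by
    ext t
    simp [h0]
  rw [h1, h2]
  exact (SimplyConnectedSpace.paths_homotopic δ (Path.refl _)).map ⟨f, hf⟩

lemma antipodal_of_not_homotopic_refl {x : RP2} {c : Path x x} (hc : ¬ c.Homotopic (Path.refl x))
    {γ : ℝ → S2} (hγ : IsC1Lift c γ) : γ 1 = -γ 0 := by
  have h0 := hγ.2 0
  have h1 := hγ.2 1
  rw [c.source] at h0
  rw [c.target, ← h0] at h1
  rcases toRP2_eq_iff.1 h1 with h | h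
  · exact absurd (homotopic_refl_of_closed_lift c hγ (by simpa using h)) hc
  · simpa using h

/-- A `C¹` curve on the sphere that joins antipodal points has length at least `π`. -/
lemma pi_le_length_of_antipodal {γ : ℝ → S2}
    (hγ : ContDiffOn ℝ 1 (fun s => (γ s : EuclideanSpace ℝ (Fin 3))) (Icc 0 1))
    (h : γ 1 = -γ 0) :
    ENNReal.ofReal Real.pi ≤ ∫⁻ t in Icc (0 : ℝ) 1,
      ‖derivWithin (fun s => (γ s : EuclideanSpace ℝ (Fin 3))) (Icc 0 1) t‖ₑ := by
  set D : ℝ → E3 := derivWithin (fun s => (γ s : E3)) (Icc 0 1) with hD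
  have hDc : ContinuousOn D (Icc 0 1) :=
    hγ.continuousOn_derivWithin (uniqueDiffOn_Icc one_pos) le_rfl
  have hder {t : ℝ} (ht : t ∈ Ioo (0 : ℝ) 1) : HasDerivAt (fun s => (γ s : E3)) (D t) t := by
    have hn := Icc_mem_nhds ht.1 ht.2
    exact ((hγ.differentiableOn one_ne_zero) t (Ioo_subset_Icc_self ht)).hasDerivWithinAt.hasDerivAt
      hn
  obtain ⟨v, hv⟩ : ∃ v : E3, v = (γ 0 : E3) := ⟨_, rfl⟩
  have hnorm : IntegrableOn (fun t => ‖D t‖) (Icc 0 1) := hDc.norm.integrableOn_Icc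
  have horth {t : ℝ} (ht : t ∈ Ioo (0 : ℝ) 1) : inner ℝ (D t) (γ t : E3) = 0 := by
    have h1 := (hder ht).inner ℝ (hder ht)
    have h2 : (fun s => inner ℝ (γ s : E3) (γ s : E3)) = fun _ => (1 : ℝ) :=
      funext fun s => S2.inner_self _
    rw [h2] at h1
    have := h1.unique (hasDerivAt_const t (1 : ℝ))
    rw [real_inner_comm] at this
    linarith
  have hsq (t : ℝ) : inner ℝ (γ t : E3) v ^ 2 ≤ 1 := by
    have h1 := S2.inner_le_one (γ t) (γ 0)
    have h2 := S2.neg_one_le_inner (γ t) (γ 0)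
    rw [hv]; nlinarith
  have hbound {t : ℝ} (ht : t ∈ Ioo (0 : ℝ) 1) :
      |inner ℝ (D t) v| ≤ √(1 - inner ℝ (γ t : E3) v ^ 2) * ‖D t‖ := by
    have e1 : inner ℝ (D t) v = inner ℝ (D t) (v - inner ℝ (γ t : E3) v • (γ t : E3)) := by
      rw [inner_sub_right, inner_smul_right, horth ht]; ring
    have e2 : ‖v - inner ℝ (γ t : E3) v • (γ t : E3)‖ ^ 2 = 1 - inner ℝ (γ t : E3) v ^ 2 := by
      rw [norm_sub_sq_real, inner_smul_right, norm_smul, S2.norm_coe, hv, S2.norm_coe,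
        real_inner_comm (γ t : E3), Real.norm_eq_abs, mul_one, sq_abs, real_inner_comm]
      ring
    rw [e1, mul_comm, ← e2, Real.sqrt_sq (norm_nonneg _)]
    exact abs_real_inner_le_norm _ _
  -- The function `arcsin ⟨γ, γ 0⟩` is 1-Lipschitz on the sphere and changes by `π`, but is not
  -- differentiable at the ends. The factor `k < 1` keeps the argument inside the open interval and
  -- is sent to `1` afterwards.
  have key (k : ℝ) (hk0 : 0 < k) (hk1 : k < 1) :
      2 * Real.arcsin k ≤ ∫ t in (0 : ℝ)..1, ‖D t‖ := by
    have hlt (t : ℝ) : (k * inner ℝ (γ t : E3) v) ^ 2 < 1 := by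
      rw [mul_pow]
      nlinarith [mul_le_mul_of_nonneg_left (hsq t) (sq_nonneg k)]
    have hφ : ContinuousOn (fun t => k * inner ℝ (γ t : E3) v) (Icc 0 1) :=
      continuousOn_const.mul (hγ.continuousOn.inner continuousOn_const)
    have hF : ContinuousOn (fun t => -Real.arcsin (k * inner ℝ (γ t : E3) v)) (Icc 0 1) :=
      (Real.continuous_arcsin.comp_continuousOn hφ).neg
    have hdF : ∀ t ∈ Ioo (0 : ℝ) 1, HasDerivWithinAt
        (fun t => -Real.arcsin (k * inner ℝ (γ t : E3) v))
        (-(1 / √(1 - (k * inner ℝ (γ t : E3) v) ^ 2) * (k * inner ℝ (D t) v))) (Ioi t) t := by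
      intro t ht
      have h1 : HasDerivAt (fun t => k * inner ℝ (γ t : E3) v) (k * inner ℝ (D t) v) t := by
        have := ((hder ht).inner ℝ (hasDerivAt_const t v)).const_mul k
        simpa using this
      have hne := hlt t
      exact ((Real.hasDerivAt_arcsin (by rintro h; rw [h] at hne; norm_num at hne)
        (by rintro h; rw [h] at hne; norm_num at hne)).comp t h1).neg.hasDerivWithinAt
    have hle : ∀ t ∈ Ioo (0 : ℝ) 1,
        -(1 / √(1 - (k * inner ℝ (γ t : E3) v) ^ 2) * (k * inner ℝ (D t) v)) ≤ ‖D t‖ := by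
      intro t ht
      have hpos : 0 < √(1 - (k * inner ℝ (γ t : E3) v) ^ 2) := Real.sqrt_pos.2 (by linarith [hlt t])
      have h1 : k * √(1 - inner ℝ (γ t : E3) v ^ 2) ≤ √(1 - (k * inner ℝ (γ t : E3) v) ^ 2) := by
        apply Real.le_sqrt_of_sq_le
        rw [mul_pow, Real.sq_sqrt (by linarith [hsq t])]
        nlinarith
      have h2 : -(k * inner ℝ (D t) v) ≤ √(1 - (k * inner ℝ (γ t : E3) v) ^ 2) * ‖D t‖ := by
        have i1 := neg_abs_le (inner ℝ (D t) v)
        have i2 := hbound ht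
        have i3 := mul_le_mul_of_nonneg_right h1 (norm_nonneg (D t))
        nlinarith
      rw [one_div_mul_eq_div, ← neg_div, div_le_iff₀ hpos]
      linarith
    have hint := intervalIntegral.sub_le_integral_of_hasDeriv_right_of_le zero_le_one hF hdF hnorm
      hle
    have e0 : inner ℝ (γ 0 : E3) v = 1 := by rw [hv, S2.inner_self]
    have e1 : inner ℝ (γ 1 : E3) v = -1 := by rw [h, hv]; simp
    rw [e0, e1] at hint
    simp only [mul_neg, mul_one, Real.arcsin_neg, neg_neg] at hint
    linarith
  have hpi : Real.pi ≤ ∫ t in (0 : ℝ)..1, ‖D t‖ := by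
    have ht : Tendsto (fun k : ℝ => 2 * Real.arcsin k) (𝓝[<] 1) (𝓝 Real.pi) := by
      have := (Real.continuous_arcsin.const_mul 2).tendsto 1
      rw [Real.arcsin_one, mul_div_cancel₀ _ two_ne_zero] at this
      exact this.mono_left nhdsWithin_le_nhds
    refine le_of_tendsto ht ?_
    filter_upwards [Ioo_mem_nhdsLT (zero_lt_one' ℝ)] with k hk using key k hk.1 hk.2
  rw [intervalIntegral.integral_of_le zero_le_one, ← integral_Icc_eq_integral_Ioc] at hpi
  refine (ENNReal.ofReal_le_ofReal hpi).trans ?_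
  rw [ofReal_integral_norm_eq_lintegral_enorm hDc.integrableOn_Icc]

end

noncomputable section

open Filter Topology

/-! ### Averaging over great circles -/

/-- The component of `y` orthogonal to `x`. -/
def orthPart (x y : S2) : E3 := (y : E3) - inner ℝ (x : E3) (y : E3) • (x : E3)

/-- The point at the signed distance `t` from `x` on the great circle from `x` towards `y`. -/
def circlePoint (t : ℝ) (x y : S2) : S2 :=
  open Classical in
  if h : orthPart x y = 0 then x
  else ⟨Real.cos t • (x : E3) + Real.sin t • (‖orthPart x y‖⁻¹ • orthPart x y), by
    have ho : inner ℝ (x : E3) (orthPart x y) = 0 := by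
      rw [orthPart, inner_sub_right, inner_smul_right, S2.inner_self]; ring
    rw [mem_sphere_zero_iff_norm, ← sq_eq_sq₀ (norm_nonneg _) zero_le_one, norm_add_sq_real]
    simp only [norm_smul, inner_smul_left, inner_smul_right, ho, S2.norm_coe, norm_inv, norm_norm]
    rw [inv_mul_cancel₀ (norm_ne_zero_iff.2 h)]
    simp [Real.cos_sq_add_sin_sq]⟩

lemma coe_circlePoint {t : ℝ} {x y : S2} (h : orthPart x y ≠ 0) :
    (circlePoint t x y : E3) =
      Real.cos t • (x : E3) + Real.sin t • (‖orthPart x y‖⁻¹ • orthPart x y) := by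
  simp [circlePoint, h]

lemma inner_orthPart (x y : S2) : inner ℝ (x : E3) (orthPart x y) = 0 := by
  rw [orthPart, inner_sub_right, inner_smul_right, S2.inner_self]; ring

lemma orthPart_sphereMap (L : E3 ≃ₗᵢ[ℝ] E3) (x y : S2) :
    orthPart (sphereMap L x) (sphereMap L y) = L (orthPart x y) := by
  simp [orthPart, L.inner_map_map]

lemma circlePoint_sphereMap (L : E3 ≃ₗᵢ[ℝ] E3) (t : ℝ) (x y : S2) :
    circlePoint t (sphereMap L x) (sphereMap L y) = sphereMap L (circlePoint t x y) := by
  by_cases h : orthPart x y = 0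
  · have h' : orthPart (sphereMap L x) (sphereMap L y) = 0 := by rw [orthPart_sphereMap, h, map_zero]
    simp [circlePoint, h, h']
  · have h' : orthPart (sphereMap L x) (sphereMap L y) ≠ 0 := by
      rw [orthPart_sphereMap]; simpa using h
    ext1
    rw [coe_circlePoint h', coe_sphereMap, coe_sphereMap, coe_circlePoint h, orthPart_sphereMap]
    simp

lemma continuous_orthPart : Continuous fun q : S2 × S2 => orthPart q.1 q.2 := by
  unfold orthPart; fun_prop

lemma measurable_circlePoint_uncurry :
    Measurable fun q : ℝ × S2 × S2 => circlePoint q.1 q.2.1 q.2.2 := by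
  have ho : Continuous fun q : ℝ × S2 × S2 => orthPart q.2.1 q.2.2 := by
    unfold orthPart; fun_prop
  have hval : Measurable fun q : ℝ × S2 × S2 => (circlePoint q.1 q.2.1 q.2.2 : E3) := by
    classical
    have : (fun q : ℝ × S2 × S2 => (circlePoint q.1 q.2.1 q.2.2 : E3)) = fun q =>
        if orthPart q.2.1 q.2.2 = 0 then (q.2.1 : E3) else Real.cos q.1 • (q.2.1 : E3) +
          Real.sin q.1 • (‖orthPart q.2.1 q.2.2‖⁻¹ • orthPart q.2.1 q.2.2) := by
      ext1 q
      split_ifs with h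
      · simp [circlePoint, h]
      · exact coe_circlePoint h
    rw [this]
    refine Measurable.ite (ho.measurable (measurableSet_singleton 0)) (by fun_prop) ?_
    have h1 : Continuous fun q : ℝ × S2 × S2 => Real.cos q.1 • (q.2.1 : E3) := by fun_prop
    have h2 : Continuous fun q : ℝ × S2 × S2 => Real.sin q.1 := by fun_prop
    exact h1.measurable.add (h2.measurable.smul
      ((ho.norm.measurable.inv).smul ho.measurable))
  exact hval.subtype_mk

lemma measurable_circlePoint (t : ℝ) : Measurable fun q : S2 × S2 => circlePoint t q.1 q.2 := by
  have h := measurable_circlePoint_uncurry.comp (measurable_prodMk_left (x := t) (β := S2 × S2))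
  exact h

/-- The point at distance `t` on a random great circle is uniformly distributed. -/
lemma map_circlePoint (t : ℝ) :
    (sphereArea.prod sphereArea).map (fun q : S2 × S2 => circlePoint t q.1 q.2) =
      ENNReal.ofReal (4 * Real.pi) • sphereArea := by
  set ν := (sphereArea.prod sphereArea).map (fun q : S2 × S2 => circlePoint t q.1 q.2) with hν
  have huniv : ν univ = ENNReal.ofReal (4 * Real.pi) * ENNReal.ofReal (4 * Real.pi) := by
    rw [hν, Measure.map_apply (measurable_circlePoint t) MeasurableSet.univ, preimage_univ,
      ← univ_prod_univ, Measure.prod_prod, sphereArea_univ]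
  have h := eq_smul_sphereArea_of_invariant ν fun L => ?_
  · rw [huniv, mul_div_assoc, ENNReal.div_self (by simp [Real.pi_pos]) ENNReal.ofReal_ne_top,
      mul_one] at h
    exact h
  · rw [hν, Measure.map_map (measurable_sphereMap L) (measurable_circlePoint t)]
    have hpp := ((measurePreserving_sphereMap L).prod (measurePreserving_sphereMap L)).map_eq
    conv_rhs => rw [← hpp]
    rw [Measure.map_map (measurable_circlePoint t)
      ((measurable_sphereMap L).prodMap (measurable_sphereMap L))]
    congr 1
    ext1 q
    simp [circlePoint_sphereMap]

lemma lintegral_circlePoint (t : ℝ) {f : S2 → ℝ≥0∞} (hf : Measurable f) :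
    ∫⁻ q : S2 × S2, f (circlePoint t q.1 q.2) ∂sphereArea.prod sphereArea =
      ENNReal.ofReal (4 * Real.pi) * ∫⁻ x, f x ∂sphereArea := by
  rw [← lintegral_map hf (measurable_circlePoint t), map_circlePoint, lintegral_smul_measure,
    smul_eq_mul]

lemma orthPart_ne_zero_of {x y : S2} (h1 : y ≠ x) (h2 : y ≠ -x) : orthPart x y ≠ 0 := by
  intro h
  have h' : (y : E3) = inner ℝ (x : E3) (y : E3) • (x : E3) := sub_eq_zero.1 h
  have hn := congrArg norm h'
  rw [norm_smul, S2.norm_coe, S2.norm_coe, mul_one, Real.norm_eq_abs] at hn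
  rcases eq_or_eq_neg_of_abs_eq hn.symm with h3 | h3
  · apply h1; ext1; rw [h', h3, one_smul]
  · apply h2; ext1; rw [h', h3]; simp

lemma ae_orthPart_ne_zero (x : S2) : ∀ᵐ y ∂sphereArea, orthPart x y ≠ 0 := by
  have h1 : ∀ᵐ y ∂sphereArea, y ≠ x := by rw [ae_iff]; simpa using sphereArea_singleton x
  have h2 : ∀ᵐ y ∂sphereArea, y ≠ -x := by rw [ae_iff]; simpa using sphereArea_singleton (-x)
  filter_upwards [h1, h2] with y hy1 hy2 using orthPart_ne_zero_of hy1 hy2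

/-- The half great circle from `x` towards `y`. -/
lemma contDiff_circlePoint {x y : S2} (h : orthPart x y ≠ 0) :
    ContDiff ℝ 1 fun s : ℝ => (circlePoint (Real.pi * s) x y : E3) := by
  simp only [coe_circlePoint h]
  fun_prop

lemma norm_deriv_circlePoint {x y : S2} (h : orthPart x y ≠ 0) (t : ℝ) :
    ‖deriv (fun s : ℝ => (circlePoint (Real.pi * s) x y : E3)) t‖ = Real.pi := by
  have hlin : HasDerivAt (fun s : ℝ => Real.pi * s) Real.pi t := by
    simpa using (hasDerivAt_id t).const_mul Real.pi
  have hd : HasDerivAt (fun s : ℝ => (circlePoint (Real.pi * s) x y : E3))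
      ((-Real.sin (Real.pi * t) * Real.pi) • (x : E3) +
        (Real.cos (Real.pi * t) * Real.pi) • (‖orthPart x y‖⁻¹ • orthPart x y)) t := by
    simp only [coe_circlePoint h]
    exact (hlin.cos.smul_const _).add (hlin.sin.smul_const _)
  rw [hd.deriv, ← sq_eq_sq₀ (norm_nonneg _) Real.pi_pos.le, norm_add_sq_real]
  simp only [norm_smul, inner_smul_left, inner_smul_right, inner_orthPart, S2.norm_coe, norm_inv,
    norm_norm]
  rw [inv_mul_cancel₀ (norm_ne_zero_iff.2 h)]
  simp only [mul_zero, add_zero, mul_one, Real.norm_eq_abs, sq_abs]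
  linear_combination Real.pi ^ 2 * Real.sin_sq_add_cos_sq (Real.pi * t)

lemma circlePoint_one {x y : S2} (h : orthPart x y ≠ 0) :
    circlePoint (Real.pi * 1) x y = -circlePoint (Real.pi * 0) x y := by
  ext1
  rw [coe_neg_sphere, coe_circlePoint h, coe_circlePoint h]
  simp

lemma curveLength_circlePoint (u : RP2 → EReal) {x y : S2} (h : orthPart x y ≠ 0) :
    curveLength u (fun s => circlePoint (Real.pi * s) x y) =
      ∫⁻ t in Icc (0 : ℝ) 1, (u (toRP2 (circlePoint (Real.pi * t) x y))).exp ^ (1 / 2 : ℝ) *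
        ENNReal.ofReal Real.pi := by
  unfold curveLength
  refine setLIntegral_congr_fun measurableSet_Icc fun t ht => ?_
  have hd : DifferentiableAt ℝ (fun s : ℝ => (circlePoint (Real.pi * s) x y : E3)) t :=
    (contDiff_circlePoint h).differentiable one_ne_zero t
  simp only
  rw [hd.derivWithin (uniqueDiffOn_Icc one_pos t ht), ← ofReal_norm,
    norm_deriv_circlePoint h]

lemma systole_le_curveLength_circlePoint (u : RP2 → EReal) {x y : S2} (h : orthPart x y ≠ 0) :
    systole u ≤ curveLength u (fun s => circlePoint (Real.pi * s) x y) :=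
  systole_le_of_antipodal u (contDiff_circlePoint h).contDiffOn (circlePoint_one h)

/-! ### Crofton averaging, Pu's inequality and its equality case. -/

lemma measurable_exp_half {u : RP2 → EReal} (hu : Measurable fun x : S2 => u (toRP2 x)) :
    Measurable fun x : S2 => (u (toRP2 x)).exp ^ (1 / 2 : ℝ) :=
  (EReal.measurable_exp.comp hu).pow_const _

/-- Integrate the lengths of the half great circles over all pairs `(x, y)`. The lower bound is
`(4π)² sys`. For each parameter the point is uniform, so the total is `4π · π ∫ e^{u/2}`. -/
lemma four_mul_systole_le {u : RP2 → EReal} (hu : Measurable fun x : S2 => u (toRP2 x)) :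
    4 * systole u ≤ ∫⁻ x, (u (toRP2 x)).exp ^ (1 / 2 : ℝ) ∂sphereArea := by
  set f : S2 → ℝ≥0∞ := fun x => (u (toRP2 x)).exp ^ (1 / 2 : ℝ) with hf
  have hfm : Measurable f := measurable_exp_half hu
  have hmeas : Measurable fun q : (S2 × S2) × ℝ => f (circlePoint (Real.pi * q.2) q.1.1 q.1.2) *
      ENNReal.ofReal Real.pi := by
    refine (hfm.comp ?_).mul_const _
    exact measurable_circlePoint_uncurry.comp
      (f := fun q : (S2 × S2) × ℝ => (Real.pi * q.2, q.1.1, q.1.2)) (by fun_prop)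
  have hlow : ENNReal.ofReal (4 * Real.pi) * ENNReal.ofReal (4 * Real.pi) * systole u ≤
      ∫⁻ q : S2 × S2, (∫⁻ t in Icc (0 : ℝ) 1, f (circlePoint (Real.pi * t) q.1 q.2) *
        ENNReal.ofReal Real.pi) ∂sphereArea.prod sphereArea := by
    have hm : Measurable fun q : S2 × S2 => ∫⁻ t in Icc (0 : ℝ) 1,
        f (circlePoint (Real.pi * t) q.1 q.2) * ENNReal.ofReal Real.pi := hmeas.lintegral_prod_right'
    rw [lintegral_prod _ hm.aemeasurable]
    calc ENNReal.ofReal (4 * Real.pi) * ENNReal.ofReal (4 * Real.pi) * systole u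
        = ∫⁻ _ : S2, ∫⁻ _ : S2, systole u ∂sphereArea ∂sphereArea := by
          simp only [lintegral_const, sphereArea_univ]; ring
      _ ≤ _ := by
          refine lintegral_mono fun x => lintegral_mono_ae ?_
          filter_upwards [ae_orthPart_ne_zero x] with y hy
          rw [← curveLength_circlePoint u hy]
          exact systole_le_curveLength_circlePoint u hy
  rw [lintegral_lintegral_swap hmeas.aemeasurable] at hlow
  have hinner (t : ℝ) : ∫⁻ q : S2 × S2, f (circlePoint (Real.pi * t) q.1 q.2) *
      ENNReal.ofReal Real.pi ∂sphereArea.prod sphereArea =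
      ENNReal.ofReal (4 * Real.pi) * (∫⁻ x, f x ∂sphereArea) * ENNReal.ofReal Real.pi := by
    have hm : Measurable fun q : S2 × S2 => f (circlePoint (Real.pi * t) q.1 q.2) :=
      hfm.comp (measurable_circlePoint _)
    rw [lintegral_mul_const _ hm, lintegral_circlePoint _ hfm]
  simp only [hinner, lintegral_const, Measure.restrict_apply MeasurableSet.univ, univ_inter,
    Real.volume_Icc, sub_zero, ENNReal.ofReal_one, mul_one] at hlow
  have hP0 : ENNReal.ofReal Real.pi ≠ 0 := by simp [Real.pi_pos]
  have hP1 : ENNReal.ofReal Real.pi ≠ ∞ := ENNReal.ofReal_ne_top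
  have h4 : ENNReal.ofReal (4 * Real.pi) = 4 * ENNReal.ofReal Real.pi := by
    rw [ENNReal.ofReal_mul (by norm_num)]; norm_num
  rw [h4] at hlow
  refine (ENNReal.mul_le_mul_iff_right (a := 4 * ENNReal.ofReal Real.pi * ENNReal.ofReal Real.pi)
    (by simp [hP0]) (by simp [ENNReal.mul_eq_top])).1 ?_
  calc _ = 4 * ENNReal.ofReal Real.pi * (4 * ENNReal.ofReal Real.pi) * systole u := by ring
    _ ≤ _ := hlow
    _ = _ := by ring

lemma rpow_half_sq (a : ℝ≥0∞) : (a ^ (1 / 2 : ℝ)) ^ 2 = a := by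
  rw [← ENNReal.rpow_natCast, ← ENNReal.rpow_mul]; norm_num

lemma area_eq {u : RP2 → EReal} (hu : Measurable fun x : S2 => u (toRP2 x)) :
    area u = 2⁻¹ * ∫⁻ x, (u (toRP2 x)).exp ∂sphereArea := by
  have hu' : Measurable u := measurable_from_quotient.2 hu
  have ht : Measurable toRP2 := measurable_from_quotient.1 measurable_id
  have he : Measurable fun x => (u x).exp := EReal.measurable_exp.comp hu'
  rw [area, roundArea, lintegral_smul_measure, lintegral_map he ht, smul_eq_mul]

lemma sq_lintegral_le {f : S2 → ℝ≥0∞} (hf : Measurable f) :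
    (∫⁻ x, f x ∂sphereArea) ^ 2 ≤
      ENNReal.ofReal (4 * Real.pi) * ∫⁻ x, f x ^ 2 ∂sphereArea := by
  have h := ENNReal.lintegral_mul_le_Lp_mul_Lq sphereArea Real.HolderConjugate.two_two
    hf.aemeasurable (aemeasurable_const (b := 1))
  simp only [Pi.mul_apply, mul_one, ENNReal.one_rpow, lintegral_const, one_mul, sphereArea_univ]
    at h
  calc _ ≤ _ := pow_le_pow_left' h 2
    _ = _ := by
      rw [mul_pow, rpow_half_sq, rpow_half_sq, mul_comm]
      norm_num

lemma sixteen_mul_systole_sq_le {u : RP2 → EReal} (hu : Measurable fun x : S2 => u (toRP2 x)) :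
    16 * systole u ^ 2 ≤ (∫⁻ x, (u (toRP2 x)).exp ^ (1 / 2 : ℝ) ∂sphereArea) ^ 2 := by
  refine le_trans (le_of_eq ?_) (pow_le_pow_left' (four_mul_systole_le hu) 2)
  ring

/-- Pu's inequality. -/
lemma systole_sq_le_area {u : RP2 → EReal} (hu : Measurable fun x : S2 => u (toRP2 x)) :
    ENNReal.ofReal (2 / Real.pi) * systole u ^ 2 ≤ area u := by
  have h2 := sq_lintegral_le (measurable_exp_half hu)
  simp only [rpow_half_sq] at h2
  have hpi := Real.pi_pos
  rw [area_eq hu]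
  calc ENNReal.ofReal (2 / Real.pi) * systole u ^ 2
      = ENNReal.ofReal (1 / (8 * Real.pi)) * (16 * systole u ^ 2) := by
        rw [← mul_assoc, show (16 : ℝ≥0∞) = ENNReal.ofReal 16 by norm_num,
          ← ENNReal.ofReal_mul (by positivity)]
        congr 2; field_simp; norm_num
    _ ≤ ENNReal.ofReal (1 / (8 * Real.pi)) *
        (ENNReal.ofReal (4 * Real.pi) * ∫⁻ x, (u (toRP2 x)).exp ∂sphereArea) :=
        mul_le_mul_right ((sixteen_mul_systole_sq_le hu).trans h2) _
    _ = _ := by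
        rw [← mul_assoc, ← ENNReal.ofReal_mul (by positivity),
          show 1 / (8 * Real.pi) * (4 * Real.pi) = 2⁻¹ by field_simp; norm_num,
          ENNReal.ofReal_inv_of_pos two_pos]
        norm_num

/-- The equality case of the Cauchy–Schwarz inequality on the sphere. -/
lemma ae_const_of_sq_lintegral_eq {f : S2 → ℝ≥0∞} (hf : Measurable f)
    (hfin : ∫⁻ x, f x ^ 2 ∂sphereArea ≠ ∞)
    (h : ENNReal.ofReal (4 * Real.pi) * ∫⁻ x, f x ^ 2 ∂sphereArea ≤
      (∫⁻ x, f x ∂sphereArea) ^ 2) :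
    ∃ c : ℝ, 0 ≤ c ∧ ∀ᵐ x ∂sphereArea, f x = ENNReal.ofReal c := by
  have hpi := Real.pi_pos
  set F : S2 → ℝ := fun x => (f x).toReal with hF
  have hFm : Measurable F := hf.ennreal_toReal
  have hae : ∀ᵐ x ∂sphereArea, f x < ∞ := by
    filter_upwards [ae_lt_top (hf.pow_const 2) hfin] with x hx
    exact (ENNReal.pow_lt_top_iff.1 hx).resolve_right (by norm_num)
  have hI2 : Integrable (fun x => F x ^ 2) sphereArea := by
    have := integrable_toReal_of_lintegral_ne_top (hf.pow_const 2).aemeasurable hfin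
    simpa [hF] using this
  have hI1 : Integrable F sphereArea := by
    refine ((integrable_const 1).add hI2).mono' hFm.aestronglyMeasurable (.of_forall fun x => ?_)
    rw [Real.norm_of_nonneg ENNReal.toReal_nonneg]
    simp only [Pi.add_apply]
    nlinarith [sq_nonneg (F x - 1)]
  have e1 : ∫⁻ x, f x ∂sphereArea = ENNReal.ofReal (∫ x, F x ∂sphereArea) := by
    rw [ofReal_integral_eq_lintegral_ofReal hI1 (.of_forall fun x => ENNReal.toReal_nonneg)]
    refine lintegral_congr_ae ?_
    filter_upwards [hae] with x hx using (ENNReal.ofReal_toReal hx.ne).symm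
  have e2 : ∫⁻ x, f x ^ 2 ∂sphereArea = ENNReal.ofReal (∫ x, F x ^ 2 ∂sphereArea) := by
    rw [ofReal_integral_eq_lintegral_ofReal hI2 (.of_forall fun x => sq_nonneg _)]
    refine lintegral_congr_ae ?_
    filter_upwards [hae] with x hx
    rw [ENNReal.ofReal_pow ENNReal.toReal_nonneg, ENNReal.ofReal_toReal hx.ne]
  have hF0 : 0 ≤ ∫ x, F x ∂sphereArea := integral_nonneg fun x => ENNReal.toReal_nonneg
  rw [e1, e2, ← ENNReal.ofReal_mul (by positivity), ← ENNReal.ofReal_pow hF0,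
    ENNReal.ofReal_le_ofReal_iff (by positivity)] at h
  set m := (∫ x, F x ∂sphereArea) / (4 * Real.pi) with hm
  have hmI : ∫ x, F x ∂sphereArea = 4 * Real.pi * m := by rw [hm]; field_simp
  have hvar : ∫ x, (F x - m) ^ 2 ∂sphereArea = 0 := by
    refine le_antisymm ?_ (integral_nonneg fun x => sq_nonneg _)
    have : ∫ x, (F x - m) ^ 2 ∂sphereArea =
        (∫ x, F x ^ 2 ∂sphereArea) - 2 * m * (∫ x, F x ∂sphereArea) + 4 * Real.pi * m ^ 2 := by
      have : (fun x => (F x - m) ^ 2) = fun x => F x ^ 2 - 2 * m * F x + m ^ 2 := by ext; ring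
      rw [this, integral_add (f := fun x => F x ^ 2 - 2 * m * F x) (hI2.sub (hI1.const_mul _))
        (integrable_const _),
        integral_sub hI2 (hI1.const_mul _), integral_const_mul, integral_const,
        sphereArea_real_univ, smul_eq_mul]
    rw [this, hmI]
    rw [hmI] at h
    have h' : ∫ x, F x ^ 2 ∂sphereArea ≤ 4 * Real.pi * m ^ 2 := by
      refine le_of_mul_le_mul_left ?_ (by positivity : 0 < 4 * Real.pi)
      linarith [h]
    linarith
  have hsq : Integrable (fun x => (F x - m) ^ 2) sphereArea := by
    have : (fun x => (F x - m) ^ 2) = fun x => F x ^ 2 - 2 * m * F x + m ^ 2 := by ext; ring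
    rw [this]
    exact (hI2.sub (hI1.const_mul _)).add (integrable_const _)
  rw [integral_eq_zero_iff_of_nonneg (fun x => sq_nonneg _) hsq] at hvar
  refine ⟨m, by positivity, ?_⟩
  filter_upwards [hvar, hae] with x hx hx'
  have : F x = m := by
    have : (F x - m) ^ 2 = 0 := hx
    linarith [pow_eq_zero_iff (two_ne_zero) |>.1 this]
  rw [← this, hF, ENNReal.ofReal_toReal hx'.ne]

/-- Equality in Pu's inequality forces equality in Cauchy–Schwarz for `e^{u/2}` and `1`. Finite area
is needed to rule out equality of infinite quantities. -/
lemma ae_const_of_area_eq {u : RP2 → EReal} (hu : Measurable fun x : S2 => u (toRP2 x))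
    (hfin : area u ≠ ∞) (h : area u = ENNReal.ofReal (2 / Real.pi) * systole u ^ 2) :
    ∃ c : ℝ, 0 ≤ c ∧ ∀ᵐ x ∂sphereArea, (u (toRP2 x)).exp = ENNReal.ofReal c := by
  have hpi := Real.pi_pos
  have hexp : ∫⁻ x, (u (toRP2 x)).exp ∂sphereArea ≠ ∞ := by
    intro h'; rw [area_eq hu, h'] at hfin
    exact hfin (ENNReal.mul_top (by norm_num))
  obtain ⟨c, hc, hae⟩ := ae_const_of_sq_lintegral_eq (measurable_exp_half hu)
    (by simpa only [rpow_half_sq] using hexp) (by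
      refine le_trans (le_of_eq ?_) (sixteen_mul_systole_sq_le hu)
      simp only [rpow_half_sq]
      have e : (∫⁻ x, (u (toRP2 x)).exp ∂sphereArea) = 2 * area u := by
        rw [area_eq hu, ← mul_assoc, ENNReal.mul_inv_cancel (by norm_num) (by norm_num), one_mul]
      rw [e, h, show (2 : ℝ≥0∞) = ENNReal.ofReal 2 by norm_num,
        show (16 : ℝ≥0∞) = ENNReal.ofReal 16 by norm_num, ← mul_assoc, ← mul_assoc,
        ← ENNReal.ofReal_mul (by positivity), ← ENNReal.ofReal_mul (by positivity)]
      congr 2; field_simp; norm_num)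
  refine ⟨c ^ 2, by positivity, ?_⟩
  filter_upwards [hae] with x hx
  rw [← rpow_half_sq (u (toRP2 x)).exp, hx, ENNReal.ofReal_pow hc]

end

noncomputable section

open Filter Topology

/-! ### Potentials of measures -/

/-- The Green function off the diagonal, in terms of the logarithmic kernel. -/
def greenReal (x y : S2) : ℝ := 1 / (4 * Real.pi) * (logKernel x y + (Real.log 2 - 1))

/-- This is the chordal identity `|x - y|² = 2 (1 - ⟨x, y⟩)` under the logarithm. -/
lemma greenFunction_of_ne {x y : S2} (h : x ≠ y) : greenFunction x y = (greenReal x y : EReal) := by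
  have hpos : 0 < 1 - inner ℝ (x : E3) (y : E3) := by linarith [S2.inner_lt_one h]
  have hd : 0 < dist x y := dist_pos.2 h
  have hlog : 2 * Real.log (dist x y) = Real.log 2 + Real.log (1 - inner ℝ (x : E3) (y : E3)) := by
    rw [← Real.log_mul two_ne_zero hpos.ne', ← S2.dist_sq, Real.log_pow]; norm_num
  simp only [greenFunction, h, if_false, greenReal, logKernel]
  congr 1
  rw [Real.log_div two_ne_zero hd.ne']
  field_simp
  linarith

lemma greenFunction_self (x : S2) : greenFunction x x = ⊤ := by simp [greenFunction]

lemma measurable_greenFunction_uncurry : Measurable fun q : S2 × S2 => greenFunction q.1 q.2 := by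
  classical
  have : (fun q : S2 × S2 => greenFunction q.1 q.2) =
      fun q => if q.1 = q.2 then ⊤ else (greenReal q.1 q.2 : EReal) := by
    ext1 q
    split_ifs with h
    · rw [h, greenFunction_self]
    · exact greenFunction_of_ne h
  rw [this]
  refine Measurable.ite (measurableSet_eq_fun measurable_fst measurable_snd) measurable_const ?_
  exact measurable_coe_real_ereal.comp ((measurable_logKernel_uncurry.add_const _).const_mul _)

lemma measurable_neg_greenFunction_uncurry :
    Measurable fun q : S2 × S2 => -greenFunction q.1 q.2 :=
  (continuous_neg (G := EReal)).measurable.comp measurable_greenFunction_uncurry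

lemma measurable_lintegral_green (ν : Measure S2) [SFinite ν] :
    Measurable fun x => ∫⁻ y, (greenFunction x y).toENNReal ∂ν :=
  (measurable_greenFunction_uncurry.ereal_toENNReal).lintegral_prod_right'

lemma measurable_lintegral_neg_green (ν : Measure S2) [SFinite ν] :
    Measurable fun x => ∫⁻ y, (-greenFunction x y).toENNReal ∂ν :=
  (measurable_neg_greenFunction_uncurry.ereal_toENNReal).lintegral_prod_right'

lemma measurable_greenPotential (μ : SignedMeasure S2) : Measurable (greenPotential μ) := by
  unfold greenPotential signedIntegral
  simp only [sub_eq_add_neg]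
  refine Measurable.add (measurable_coe_ennreal_ereal.comp
    ((measurable_lintegral_green _).add (measurable_lintegral_neg_green _))) ?_
  exact (continuous_neg (G := EReal)).measurable.comp (measurable_coe_ennreal_ereal.comp
    ((measurable_lintegral_neg_green _).add (measurable_lintegral_green _)))

/-- The area integral of `|logKernel x y|` over `x` is bounded uniformly in `y`, so any finite
measure may be used in the second variable. -/
lemma integrable_logKernel_prod (ν : Measure S2) [IsFiniteMeasure ν] :
    Integrable (fun q : S2 × S2 => logKernel q.1 q.2) (sphereArea.prod ν) := by
  rw [integrable_prod_iff' measurable_logKernel_uncurry.aestronglyMeasurable]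
  have hbd (y : S2) : ∫ x, ‖logKernel x y‖ ∂sphereArea ≤ 8 * (16 * Real.pi) + 4 * Real.pi := by
    calc ∫ x, ‖logKernel x y‖ ∂sphereArea
        ≤ ∫ x, (8 * invSqrtKernel y x + 1) ∂sphereArea := by
          refine integral_mono ?_ (((integrable_invSqrtKernel y).const_mul 8).add
            (integrable_const 1)) fun x => ?_
          · simpa only [logKernel_comm _ y] using (integrable_logKernel y).norm
          · rw [logKernel_comm x y]; exact abs_logKernel_le y x
      _ ≤ _ := by
          rw [integral_add ((integrable_invSqrtKernel y).const_mul 8) (integrable_const 1),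
            integral_const_mul, integral_const, sphereArea_real_univ, smul_eq_mul, mul_one]
          linarith [integral_invSqrtKernel_le y]
  refine ⟨.of_forall fun y => ?_, ?_⟩
  · simpa only [logKernel_comm _ y] using integrable_logKernel y
  · refine (integrable_const (8 * (16 * Real.pi) + 4 * Real.pi)).mono' ?_ (.of_forall fun y => ?_)
    · exact (measurable_logKernel_uncurry.norm.stronglyMeasurable.integral_prod_left').aestronglyMeasurable
    · rw [Real.norm_of_nonneg (integral_nonneg fun x => norm_nonneg _)]
      exact hbd y

lemma ae_integrable_logKernel (ν : Measure S2) [IsFiniteMeasure ν] :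
    ∀ᵐ x ∂sphereArea, Integrable (logKernel x) ν :=
  (integrable_logKernel_prod ν).prod_right_ae

/-- By Fubini the diagonal is null for the product measure, since points have zero area. Off the
atoms of `ν`, the conflicting diagonal values of `greenFunction` and `logKernel` do not matter. -/
lemma ae_measure_singleton_eq_zero (ν : Measure S2) [IsFiniteMeasure ν] :
    ∀ᵐ x ∂sphereArea, ν {x} = 0 := by
  have hdiag : MeasurableSet {q : S2 × S2 | q.1 = q.2} :=
    measurableSet_eq_fun measurable_fst measurable_snd
  have h : (sphereArea.prod ν) {q : S2 × S2 | q.1 = q.2} = 0 := by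
    rw [Measure.prod_apply_symm hdiag]
    have (y : S2) : (fun x => (x, y)) ⁻¹' {q : S2 × S2 | q.1 = q.2} = {y} := by ext; simp
    simp [this, sphereArea_singleton]
  filter_upwards [Measure.ae_ae_of_ae_prod (compl_mem_ae_iff.2 h)] with x hx
  have hx' : ν {y | ¬ (x, y) ∉ {q : S2 × S2 | q.1 = q.2}} = 0 := ae_iff.1 hx
  convert! hx' using 2
  ext y; simp [eq_comm]

lemma lintegral_green_eq {ν : Measure S2} [IsFiniteMeasure ν] {x : S2}
    (hx : Integrable (logKernel x) ν) (h0 : ν {x} = 0) :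
    ∃ a b : ℝ, 0 ≤ a ∧ 0 ≤ b ∧ ∫⁻ y, (greenFunction x y).toENNReal ∂ν = ENNReal.ofReal a ∧
      ∫⁻ y, (-greenFunction x y).toENNReal ∂ν = ENNReal.ofReal b ∧
      a - b = ∫ y, greenReal x y ∂ν := by
  have hint : Integrable (greenReal x) ν := (hx.add (integrable_const _)).const_mul _
  have hae : ∀ᵐ y ∂ν, greenFunction x y = (greenReal x y : EReal) := by
    have : ∀ᵐ y ∂ν, y ≠ x := by rw [ae_iff]; simpa using h0
    filter_upwards [this] with y hy using greenFunction_of_ne hy.symm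
  have e1 : ∫⁻ y, (greenFunction x y).toENNReal ∂ν = ∫⁻ y, ENNReal.ofReal (greenReal x y) ∂ν := by
    refine lintegral_congr_ae ?_
    filter_upwards [hae] with y hy
    rw [hy, EReal.real_coe_toENNReal]
  have e2 : ∫⁻ y, (-greenFunction x y).toENNReal ∂ν =
      ∫⁻ y, ENNReal.ofReal (-greenReal x y) ∂ν := by
    refine lintegral_congr_ae ?_
    filter_upwards [hae] with y hy
    rw [hy, ← EReal.coe_neg, EReal.real_coe_toENNReal]
  refine ⟨_, _, ENNReal.toReal_nonneg, ENNReal.toReal_nonneg, ?_, ?_,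
    (integral_eq_lintegral_pos_part_sub_lintegral_neg_part hint).symm⟩
  · rw [e1, ENNReal.ofReal_toReal]
    exact (hint.lintegral_lt_top).ne
  · rw [e2, ENNReal.ofReal_toReal]
    exact (hint.neg.lintegral_lt_top).ne

/-- The potential of the signed measure `μp - μn`, computed with the logarithmic kernel. -/
def logPotential (μ : SignedMeasure S2) (x : S2) : ℝ :=
  1 / (4 * Real.pi) * ((∫ y, logKernel x y ∂μ.toJordanDecomposition.posPart) -
    ∫ y, logKernel x y ∂μ.toJordanDecomposition.negPart)

lemma posPart_univ_eq {μ : SignedMeasure S2} (hμ : μ univ = 0) :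
    μ.toJordanDecomposition.posPart.real univ = μ.toJordanDecomposition.negPart.real univ := by
  have := μ.apply_eq_posPart_real_sub_negPart_real MeasurableSet.univ
  rw [hμ] at this
  linarith

/-- All four integrals in `signedIntegral` are finite here. The additive constant of the Green
function disappears because `μ` has total mass zero. -/
lemma greenPotential_eq_of_integrable {μ : SignedMeasure S2} (hμ : μ univ = 0) {x : S2}
    (hp : Integrable (logKernel x) μ.toJordanDecomposition.posPart)
    (hn : Integrable (logKernel x) μ.toJordanDecomposition.negPart)
    (hp0 : μ.toJordanDecomposition.posPart {x} = 0)
    (hn0 : μ.toJordanDecomposition.negPart {x} = 0) :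
    greenPotential μ x = (logPotential μ x : EReal) := by
  obtain ⟨a, b, ha, hb, ea, eb, hab⟩ := lintegral_green_eq hp hp0
  obtain ⟨c, d, hc, hd, ec, ed, hcd⟩ := lintegral_green_eq hn hn0
  rw [greenPotential, signedIntegral, ea, eb, ec, ed, ← ENNReal.ofReal_add ha hd,
    ← ENNReal.ofReal_add hb hc, EReal.coe_ennreal_ofReal, EReal.coe_ennreal_ofReal,
    max_eq_left (by positivity), max_eq_left (by positivity), ← EReal.coe_sub]
  congr 1
  have h1 : a + d - (b + c) = (a - b) - (c - d) := by ring
  rw [h1, hab, hcd, logPotential]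
  simp only [greenReal]
  rw [integral_const_mul, integral_const_mul, integral_add hp (integrable_const _),
    integral_add hn (integrable_const _), integral_const, integral_const, posPart_univ_eq hμ]
  ring

lemma ae_greenPotential_eq {μ : SignedMeasure S2} (hμ : μ univ = 0) :
    ∀ᵐ x ∂sphereArea, greenPotential μ x = (logPotential μ x : EReal) := by
  filter_upwards [ae_integrable_logKernel μ.toJordanDecomposition.posPart,
    ae_integrable_logKernel μ.toJordanDecomposition.negPart,
    ae_measure_singleton_eq_zero μ.toJordanDecomposition.posPart,
    ae_measure_singleton_eq_zero μ.toJordanDecomposition.negPart] with x h1 h2 h3 h4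
  exact greenPotential_eq_of_integrable hμ h1 h2 h3 h4

/-- Fubini reduces the claim to Green's representation formula at each point `y`. -/
lemma integral_integral_logKernel_mul_rotLaplacian (ν : Measure S2) [IsFiniteMeasure ν] {F : E3 → ℝ}
    (hF : ∀ x : S2, ContDiffAt ℝ 2 F x) :
    Integrable (fun x : S2 => (∫ y, logKernel x y ∂ν) * rotLaplacian F x) sphereArea ∧
    ∫ x : S2, (∫ y, logKernel x y ∂ν) * rotLaplacian F x ∂sphereArea =
      ν.real univ * (∫ x : S2, F x ∂sphereArea) - 4 * Real.pi * ∫ y : S2, F y ∂ν := by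
  have hL := continuous_rotLaplacian hF
  have hFc := continuous_sphere_of_contDiffAt hF
  obtain ⟨C, hC⟩ := exists_bound_sphere hL
  have hint : Integrable (fun q : S2 × S2 => logKernel q.1 q.2 * rotLaplacian F q.1)
      (sphereArea.prod ν) :=
    (integrable_logKernel_prod ν).mul_bdd (c := C)
      (hL.comp continuous_fst).aestronglyMeasurable (.of_forall fun q => hC q.1)
  have hFν : Integrable (fun y : S2 => F y) ν :=
    hFc.integrable_of_hasCompactSupport (HasCompactSupport.of_compactSpace _)
  refine ⟨by simpa only [integral_mul_const] using hint.integral_prod_left, ?_⟩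
  have hsw := integral_integral_swap (f := fun x y => logKernel x y * rotLaplacian F x)
    (μ := sphereArea) (ν := ν) hint
  simp only [integral_mul_const] at hsw
  rw [hsw]
  have hrep (y : S2) : ∫ x : S2, logKernel x y * rotLaplacian F x ∂sphereArea =
      (∫ x : S2, F x ∂sphereArea) - 4 * Real.pi * F y := by
    simp only [logKernel_comm _ y]
    exact integral_logKernel_mul_rotLaplacian y hF
  simp only [hrep]
  rw [integral_sub (integrable_const _) (hFν.const_mul _), integral_const, integral_const_mul,
    smul_eq_mul]

/-- The distributional Laplacian of the potential of `μ` is `-μ`. -/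
lemma integral_logPotential_mul_rotLaplacian {μ : SignedMeasure S2} (hμ : μ univ = 0) {F : E3 → ℝ}
    (hF : ∀ x : S2, ContDiffAt ℝ 2 F x) :
    ∫ x : S2, logPotential μ x * rotLaplacian F x ∂sphereArea =
      (∫ y : S2, F y ∂μ.toJordanDecomposition.negPart) -
        ∫ y : S2, F y ∂μ.toJordanDecomposition.posPart := by
  obtain ⟨i1, e1⟩ := integral_integral_logKernel_mul_rotLaplacian μ.toJordanDecomposition.posPart hF
  obtain ⟨i2, e2⟩ := integral_integral_logKernel_mul_rotLaplacian μ.toJordanDecomposition.negPart hF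
  have hpi := Real.pi_pos
  simp only [logPotential, mul_assoc, sub_mul]
  rw [integral_const_mul, integral_sub i1 i2, e1, e2, posPart_univ_eq hμ]
  field_simp
  ring

/-- Finite measures on the sphere are determined by the integrals of smooth functions. -/
lemma sphere_measure_ext {ν₁ ν₂ : Measure S2} [IsFiniteMeasure ν₁] [IsFiniteMeasure ν₂]
    (h : ∀ φ : E3 → ℝ, ContDiff ℝ (⊤ : ℕ∞) φ → ∫ x : S2, φ x ∂ν₁ = ∫ x : S2, φ x ∂ν₂) :
    ν₁ = ν₂ := by
  have hemb : MeasurableEmbedding (Subtype.val : S2 → E3) :=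
    MeasurableEmbedding.subtype_coe Metric.isClosed_sphere.measurableSet
  suffices ν₁.map Subtype.val = ν₂.map (Subtype.val : S2 → E3) by
    rw [← hemb.comap_map ν₁, ← hemb.comap_map ν₂, this]
  -- The real and imaginary parts of the characteristic function are integrals of the smooth
  -- functions `cos ⟨x, t⟩` and `sin ⟨x, t⟩`.
  have hchar (ν : Measure S2) [IsFiniteMeasure ν] (t : E3) :
      charFun (ν.map (Subtype.val : S2 → E3)) t =
        ((∫ x : S2, Real.cos (inner ℝ (x : E3) t) ∂ν : ℝ) : ℂ) +
        ((∫ x : S2, Real.sin (inner ℝ (x : E3) t) ∂ν : ℝ) : ℂ) * Complex.I := by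
    have hcI {f : S2 → ℝ} (hf : Continuous f) : Integrable f ν :=
      hf.integrable_of_hasCompactSupport (HasCompactSupport.of_compactSpace _)
    have hin : Continuous fun x : S2 => inner ℝ (x : E3) t := by fun_prop
    have hcos := Real.continuous_cos.comp hin
    have hsin := Real.continuous_sin.comp hin
    rw [charFun_apply, hemb.integral_map, ← integral_complex_ofReal,
      ← integral_complex_ofReal, ← integral_mul_const, ← integral_add]
    · refine integral_congr_ae (.of_forall fun x => ?_)
      simp only [Complex.exp_mul_I]
      push_cast
      rfl
    · exact (hcI hcos).ofReal
    · exact (hcI hsin).ofReal.mul_const _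
  refine Measure.ext_of_charFun (funext fun t => ?_)
  rw [hchar, hchar, h (fun x => Real.cos (inner ℝ x t))
    (Real.contDiff_cos.comp (contDiff_id.inner ℝ contDiff_const)),
    h (fun x => Real.sin (inner ℝ x t))
    (Real.contDiff_sin.comp (contDiff_id.inner ℝ contDiff_const))]

end

noncomputable section

open Filter Topology

/-! ### Metrics of constant curvature: the integral equation -/

/-- The extension of the restriction of `φ` to the sphere that is constant along rays. -/
def rayExt (φ : E3 → ℝ) (y : E3) : ℝ := φ (‖y‖⁻¹ • y)

lemma rayExt_coe (φ : E3 → ℝ) (x : S2) : rayExt φ x = φ x := by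
  simp [rayExt]

lemma rayConst_rayExt (φ : E3 → ℝ) : RayConst (rayExt φ) := by
  intro c hc y
  rw [rayExt, rayExt, norm_smul, Real.norm_of_nonneg hc.le, smul_smul, mul_inv, mul_comm c⁻¹,
    mul_assoc, inv_mul_cancel₀ hc.ne', mul_one]

lemma contDiffAt_inv_norm_smul {n : WithTop ℕ∞} {y : E3} (hy : y ≠ 0) :
    ContDiffAt ℝ n (fun z : E3 => ‖z‖⁻¹ • z) y :=
  ((contDiffAt_norm ℝ hy).inv (norm_ne_zero_iff.2 hy)).smul contDiffAt_id

lemma contDiffAt_rayExt {n : WithTop ℕ∞} {φ : E3 → ℝ} {y : E3} (hy : y ≠ 0)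
    (h : ContDiffAt ℝ n φ (‖y‖⁻¹ • y)) : ContDiffAt ℝ n (rayExt φ) y :=
  ContDiffAt.comp y h (contDiffAt_inv_norm_smul hy)

lemma ContDiff.of_smooth {φ : E3 → ℝ} (hφ : ContDiff ℝ (⊤ : ℕ∞) φ) : ContDiff ℝ 2 φ :=
  hφ.of_le (WithTop.coe_le_coe.2 le_top)

lemma sphereLaplacian_eq {φ : E3 → ℝ} (hφ : ContDiff ℝ (⊤ : ℕ∞) φ) (x : S2) :
    sphereLaplacian φ x = rotLaplacian (rayExt φ) x :=
  (rayConst_rayExt φ).laplacian_eq x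
    (contDiffAt_rayExt (S2.coe_ne_zero x) hφ.of_smooth.contDiffAt)

lemma integral_sphereLaplacian {φ : E3 → ℝ} (hφ : ContDiff ℝ (⊤ : ℕ∞) φ) :
    ∫ x, sphereLaplacian φ x ∂sphereArea = 0 := by
  simp only [sphereLaplacian_eq hφ]
  exact integral_rotLaplacian fun x => contDiffAt_rayExt (S2.coe_ne_zero x)
    hφ.of_smooth.contDiffAt

variable {μ : SignedMeasure S2} {u : RP2 → EReal}

lemma measurable_lift (hu : ∀ x : S2, u (toRP2 x) = greenPotential μ x) :
    Measurable fun x : S2 => u (toRP2 x) := by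
  simp only [hu]; exact measurable_greenPotential μ

lemma lintegral_exp_ne_top (hm : Measurable fun x : S2 => u (toRP2 x)) (h : area u ≠ ∞) :
    ∫⁻ x, (u (toRP2 x)).exp ∂sphereArea ≠ ∞ := by
  intro h'; rw [area_eq hm, h'] at h
  exact h (ENNReal.mul_top (by norm_num))

lemma integral_toReal_mul_sphereLaplacian (hμ : μ univ = 0)
    (hu : ∀ x : S2, u (toRP2 x) = greenPotential μ x) {φ : E3 → ℝ}
    (hφ : ContDiff ℝ (⊤ : ℕ∞) φ) :
    ∫ x, (u (toRP2 x)).toReal * sphereLaplacian φ x ∂sphereArea =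
      (∫ y : S2, φ y ∂μ.toJordanDecomposition.negPart) -
        ∫ y : S2, φ y ∂μ.toJordanDecomposition.posPart := by
  have h := integral_logPotential_mul_rotLaplacian hμ (F := rayExt φ) fun x =>
    contDiffAt_rayExt (S2.coe_ne_zero x) hφ.of_smooth.contDiffAt
  simp only [rayExt_coe] at h
  rw [← h]
  refine integral_congr_ae ?_
  filter_upwards [ae_greenPotential_eq hμ] with x hx
  rw [hu, hx, EReal.toReal_coe, sphereLaplacian_eq hφ]

/-- The area measure `e^u dg₀` on the sphere. -/
def areaMeasure (u : RP2 → EReal) : Measure S2 :=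
  sphereArea.withDensity fun x => (u (toRP2 x)).exp

lemma isFiniteMeasure_areaMeasure (hm : Measurable fun x : S2 => u (toRP2 x)) (h : area u ≠ ∞) :
    IsFiniteMeasure (areaMeasure u) :=
  isFiniteMeasure_withDensity (lintegral_exp_ne_top hm h)

lemma measurable_exp_lift (hm : Measurable fun x : S2 => u (toRP2 x)) :
    Measurable fun x : S2 => (u (toRP2 x)).exp := EReal.measurable_exp.comp hm

lemma ae_exp_lt_top (hm : Measurable fun x : S2 => u (toRP2 x)) (h : area u ≠ ∞) :
    ∀ᵐ x ∂sphereArea, (u (toRP2 x)).exp < ∞ :=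
  ae_lt_top (measurable_exp_lift hm) (lintegral_exp_ne_top hm h)

lemma integral_areaMeasure (hm : Measurable fun x : S2 => u (toRP2 x)) (h : area u ≠ ∞)
    (φ : S2 → ℝ) :
    ∫ x, φ x ∂areaMeasure u = ∫ x, φ x * (u (toRP2 x)).exp.toReal ∂sphereArea := by
  rw [areaMeasure, integral_withDensity_eq_integral_toReal_smul (measurable_exp_lift hm)
    (ae_exp_lt_top hm h)]
  simp only [smul_eq_mul, mul_comm]

lemma integrable_areaMeasure_iff (hm : Measurable fun x : S2 => u (toRP2 x)) (h : area u ≠ ∞)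
    (φ : S2 → ℝ) : Integrable φ (areaMeasure u) ↔
      Integrable (fun x => φ x * (u (toRP2 x)).exp.toReal) sphereArea := by
  rw [areaMeasure, integrable_withDensity_iff (measurable_exp_lift hm) (ae_exp_lt_top hm h)]

/-- The curvature equation as an equality of measures. -/
lemma HasConstantGaussianCurvature.exists_measure_eq (hμ : μ univ = 0)
    (hu : ∀ x : S2, u (toRP2 x) = greenPotential μ x) (h : HasConstantGaussianCurvature u) :
    ∃ K : ℝ, 0 < K ∧ K * (areaMeasure u).real univ = 4 * Real.pi ∧
      (2 : ℝ≥0∞) • sphereArea + μ.toJordanDecomposition.posPart =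
        ENNReal.ofReal (2 * K) • areaMeasure u + μ.toJordanDecomposition.negPart := by
  obtain ⟨hA, -, -, K, hK⟩ := h
  have hm := measurable_lift hu
  have hfin := isFiniteMeasure_areaMeasure hm hA
  have hK' (φ : E3 → ℝ) (hφ : ContDiff ℝ (⊤ : ℕ∞) φ) :
      (∫ x : S2, φ x ∂sphereArea) - 1 / 2 * ((∫ y : S2, φ y ∂μ.toJordanDecomposition.negPart) -
        ∫ y : S2, φ y ∂μ.toJordanDecomposition.posPart) = K * ∫ x : S2, φ x ∂areaMeasure u := by
    rw [← integral_toReal_mul_sphereLaplacian hμ hu hφ, hK φ hφ,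
      integral_areaMeasure hm hA fun x => φ x]
  -- Gauss–Bonnet: the test function `1` shows that the total curvature is `4π`, which forces `K >
  -- 0`.
  have hmass : K * (areaMeasure u).real univ = 4 * Real.pi := by
    have := hK' (fun _ => 1) contDiff_const
    simp only [integral_const, smul_eq_mul, mul_one, posPart_univ_eq hμ, sub_self, mul_zero,
      sub_zero, sphereArea_real_univ] at this
    exact this.symm
  have hKpos : 0 < K := by
    by_contra hneg
    have h1 : 0 ≤ (areaMeasure u).real univ := measureReal_nonneg
    have := Real.pi_pos
    nlinarith
  refine ⟨K, hKpos, hmass, ?_⟩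
  have : IsFiniteMeasure ((2 : ℝ≥0∞) • sphereArea) := Measure.smul_finite _ (by norm_num)
  have : IsFiniteMeasure (ENNReal.ofReal (2 * K) • areaMeasure u) :=
    Measure.smul_finite _ ENNReal.ofReal_ne_top
  -- The negative terms of twice the curvature equation have been moved across, so that both sides
  -- are finite positive measures, determined by smooth test functions.
  refine sphere_measure_ext fun φ hφ => ?_
  have hI (ν : Measure S2) [IsFiniteMeasure ν] : Integrable (fun x : S2 => φ x) ν :=
    (hφ.continuous.comp continuous_subtype_val).integrable_of_hasCompactSupport
      (HasCompactSupport.of_compactSpace _)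
  rw [integral_add_measure (hI _) (hI _), integral_add_measure (hI _) (hI _),
    integral_smul_measure, integral_smul_measure, ENNReal.toReal_ofReal (by positivity)]
  have := hK' φ hφ
  simp only [ENNReal.toReal_ofNat, smul_eq_mul]
  linarith

/-- The integral equation satisfied by the conformal factor of a metric of constant curvature. -/
lemma HasConstantGaussianCurvature.exists_integral_eq (hμ : μ univ = 0)
    (hu : ∀ x : S2, u (toRP2 x) = greenPotential μ x) (h : HasConstantGaussianCurvature u) :
    ∃ K κ : ℝ, 0 < K ∧ K * (∫ x, (u (toRP2 x)).exp.toReal ∂sphereArea) = 4 * Real.pi ∧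
      ∀ᵐ x ∂sphereArea,
        Integrable (fun y => logKernel x y * (u (toRP2 y)).exp.toReal) sphereArea ∧
        u (toRP2 x) = ((K / (2 * Real.pi) *
          (∫ y, logKernel x y * (u (toRP2 y)).exp.toReal ∂sphereArea) - κ : ℝ) : EReal) := by
  obtain ⟨K, hK, hmass, hmeas⟩ := h.exists_measure_eq hμ hu
  have hm := measurable_lift hu
  have hfin := isFiniteMeasure_areaMeasure hm h.1
  have hpi := Real.pi_pos
  refine ⟨K, 1 / (2 * Real.pi) * ∫ y, logKernel ⟨stdVec 0, by simp⟩ y ∂sphereArea, hK, ?_, ?_⟩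
  · rw [← hmass]
    have := integral_areaMeasure hm h.1 fun _ => 1
    simp only [integral_const, smul_eq_mul, mul_one, one_mul] at this
    rw [this]
  filter_upwards [ae_greenPotential_eq hμ, ae_integrable_logKernel μ.toJordanDecomposition.posPart,
    ae_integrable_logKernel μ.toJordanDecomposition.negPart,
    ae_integrable_logKernel (areaMeasure u)] with x hx hp hn ha
  refine ⟨(integrable_areaMeasure_iff hm h.1 _).1 ha, ?_⟩
  rw [hu, hx, logPotential]
  congr 1
  -- Taking the logarithmic potential of both measures expresses `u` through that of `e^u`; the
  -- potential of the round area is a constant, independent of `x`, and becomes `κ`.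
  have e := congrArg (fun ν => ∫ y, logKernel x y ∂ν) hmeas
  rw [integral_add_measure ((integrable_logKernel x).smul_measure (by norm_num)) hp,
    integral_add_measure (ha.smul_measure ENNReal.ofReal_ne_top) hn, integral_smul_measure,
    integral_smul_measure, ENNReal.toReal_ofReal (by positivity),
    integral_areaMeasure hm h.1, integral_logKernel_eq x ⟨stdVec 0, by simp⟩] at e
  simp only [ENNReal.toReal_ofNat, smul_eq_mul] at e
  field_simp
  linarith

/-- The Jordan parts are mutually singular, so if they are equal each is singular to itself and
hence zero. -/
lemma eq_zero_of_posPart_eq_negPart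
    (h : μ.toJordanDecomposition.posPart = μ.toJordanDecomposition.negPart) : μ = 0 := by
  have hs := μ.toJordanDecomposition.mutuallySingular
  rw [h, Measure.MutuallySingular.self_iff] at hs
  have hj : μ.toJordanDecomposition = 0 := by
    ext1
    · rw [h, hs]; rfl
    · rw [hs]; rfl
  rw [← μ.toSignedMeasure_toJordanDecomposition, hj, JordanDecomposition.toSignedMeasure_zero]

lemma greenPotential_zero (x : S2) : greenPotential 0 x = 0 := by
  simp [greenPotential, signedIntegral, SignedMeasure.toJordanDecomposition_zero]

/-- If the conformal factor is constant almost everywhere and the curvature is constant, then the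
measure vanishes. -/
lemma HasConstantGaussianCurvature.eq_zero_of_ae_const (hμ : μ univ = 0)
    (hu : ∀ x : S2, u (toRP2 x) = greenPotential μ x) (h : HasConstantGaussianCurvature u)
    {c : ℝ} (hc0 : 0 ≤ c) (hc : ∀ᵐ x ∂sphereArea, (u (toRP2 x)).exp = ENNReal.ofReal c) :
    μ = 0 := by
  obtain ⟨K, hK, hmass, hmeas⟩ := h.exists_measure_eq hμ hu
  have hpi := Real.pi_pos
  have hA : areaMeasure u = ENNReal.ofReal c • sphereArea := by
    rw [areaMeasure, withDensity_congr_ae hc, withDensity_const]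
  have hKc : 2 * K * c = 2 := by
    rw [hA, measureReal_ennreal_smul_apply, ENNReal.toReal_ofReal hc0, sphereArea_real_univ]
      at hmass
    have : (K * c) * (4 * Real.pi) = 1 * (4 * Real.pi) := by linarith
    have := mul_right_cancel₀ (by positivity) this
    linarith
  rw [hA, smul_smul, ← ENNReal.ofReal_mul (by positivity), hKc,
    show ENNReal.ofReal 2 = 2 by norm_num] at hmeas
  refine eq_zero_of_posPart_eq_negPart (Measure.ext fun s hs => ?_)
  have := congrArg (fun ν => ν s) hmeas
  simp only [Measure.add_apply] at this
  have hne : ((2 : ℝ≥0∞) • sphereArea) s ≠ ∞ := by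
    rw [Measure.smul_apply, smul_eq_mul]
    exact ENNReal.mul_ne_top (by norm_num) (measure_ne_top _ _)
  exact (ENNReal.add_right_inj hne).1 this

end

noncomputable section

open Filter Topology

/-! ### Boundedness of solutions of the integral equation -/

/-- A form of Jensen's inequality for weights of total mass at most one. -/
lemma exp_integral_le {α : Type*} [MeasurableSpace α] {ν : Measure α} {w g : α → ℝ}
    (hw : Integrable w ν) (hw0 : ∀ x, 0 ≤ w x) (hw1 : ∫ x, w x ∂ν ≤ 1)
    (hg : Integrable (fun x => w x * g x) ν)
    (he : Integrable (fun x => w x * Real.exp (g x)) ν) :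
    Real.exp (∫ x, w x * g x ∂ν) ≤ 1 + ∫ x, w x * Real.exp (g x) ∂ν := by
  set c := ∫ x, w x * g x ∂ν with hc
  set m := ∫ x, w x ∂ν with hm
  have hm0 : 0 ≤ m := integral_nonneg hw0
  -- This is the tangent line of the exponential at `c = ∫ w g`, weighted by `w`.
  have hpt (x : α) : Real.exp c * ((1 - c) * w x + w x * g x) ≤ w x * Real.exp (g x) := by
    have h1 := Real.add_one_le_exp (g x - c)
    rw [Real.exp_sub, le_div_iff₀ (Real.exp_pos c)] at h1
    have h2 := mul_le_mul_of_nonneg_left h1 (hw0 x)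
    nlinarith
  have hint : ∫ x, Real.exp c * ((1 - c) * w x + w x * g x) ∂ν = Real.exp c * ((1 - c) * m + c) := by
    rw [integral_const_mul, integral_add (hw.const_mul _) hg, integral_const_mul]
  have h1 := integral_mono (((hw.const_mul (1 - c)).add hg).const_mul (Real.exp c)) he hpt
  simp only [Pi.add_apply] at h1
  rw [hint] at h1
  -- This bounds the loss `(1 - m) (1 - c) e^c` caused by the missing mass `1 - m`.
  have h2 : (1 - c) * Real.exp c ≤ 1 := by
    have h := Real.add_one_le_exp (-c)
    have h' := mul_le_mul_of_nonneg_right h (Real.exp_pos c).le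
    rw [← Real.exp_add, neg_add_cancel, Real.exp_zero] at h'
    linarith
  have h3 : (1 - m) * ((1 - c) * Real.exp c) ≤ 1 := by
    rcases le_or_gt 0 ((1 - c) * Real.exp c) with h | h
    · nlinarith
    · nlinarith
  nlinarith

/-- Off the diagonal `exp (k / 2)` is exactly `(1 - ⟨x, y⟩)^{-1/2}`, the integrable kernel. The `1`
pays for the diagonal, where both kernels take the value `0`. -/
lemma exp_half_logKernel_le (x y : S2) :
    Real.exp (1 / 2 * logKernel x y) ≤ invSqrtKernel x y + 1 := by
  rcases eq_or_ne x y with rfl | h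
  · simp [logKernel, invSqrtKernel]
  · have hpos : 0 < 1 - inner ℝ (x : E3) (y : E3) := by linarith [S2.inner_lt_one h]
    have : 1 / 2 * logKernel x y = Real.log (invSqrtKernel x y) := by
      rw [logKernel, invSqrtKernel, Real.log_inv, Real.log_sqrt hpos.le]; ring
    rw [this, Real.exp_log (by unfold invSqrtKernel; positivity)]
    linarith

lemma invSqrtKernel_comm (x y : S2) : invSqrtKernel x y = invSqrtKernel y x := by
  rw [invSqrtKernel, invSqrtKernel, real_inner_comm]

lemma integrable_invSqrtKernel_mul {f : S2 → ℝ} (hf : Integrable f sphereArea) :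
    Integrable (fun q : S2 × S2 => f q.2 * invSqrtKernel q.1 q.2)
      (sphereArea.prod sphereArea) := by
  have hm : AEStronglyMeasurable (fun q : S2 × S2 => f q.2 * invSqrtKernel q.1 q.2)
      (sphereArea.prod sphereArea) :=
    hf.aestronglyMeasurable.comp_snd.mul measurable_invSqrtKernel_uncurry.aestronglyMeasurable
  rw [integrable_prod_iff' hm]
  have hi (y : S2) : Integrable (fun x => invSqrtKernel x y) sphereArea := by
    simpa only [invSqrtKernel_comm _ y] using integrable_invSqrtKernel y
  refine ⟨.of_forall fun y => by exact (hi y).const_mul (f y), ?_⟩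
  refine (hf.norm.mul_const (16 * Real.pi)).mono' ?_ (.of_forall fun y => ?_)
  · exact hm.norm.prod_swap.integral_prod_right'
  · simp only [norm_mul, Real.norm_of_nonneg (invSqrtKernel_nonneg _ _), integral_const_mul,
      invSqrtKernel_comm _ y, norm_norm]
    rw [Real.norm_of_nonneg (integral_nonneg fun x => invSqrtKernel_nonneg _ _)]
    exact mul_le_mul_of_nonneg_left (integral_invSqrtKernel_le y) (norm_nonneg _)

lemma exists_setIntegral_le {f : S2 → ℝ} (hf : Integrable f sphereArea) (hfm : Measurable f)
    {ε : ℝ} (hε : 0 < ε) :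
    ∃ M : ℝ, 0 ≤ M ∧ ∫ x, {x | M < f x}.indicator f x ∂sphereArea ≤ ε := by
  have h : Tendsto (fun n : ℕ => ∫ x, {x | (n : ℝ) < f x}.indicator f x ∂sphereArea) atTop
      (𝓝 (∫ _, (0 : ℝ) ∂sphereArea)) := by
    refine tendsto_integral_of_dominated_convergence (fun x => ‖f x‖) (fun n => ?_) hf.norm
      (fun n => .of_forall fun x => norm_indicator_le_norm_self _ _) (.of_forall fun x => ?_)
    · exact (hfm.indicator (measurableSet_lt measurable_const hfm)).aestronglyMeasurable
    · refine tendsto_const_nhds.congr' ?_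
      obtain ⟨N, hN⟩ := exists_nat_ge (f x)
      filter_upwards [eventually_ge_atTop N] with n hn
      have hNn : (N : ℝ) ≤ n := by exact_mod_cast hn
      rw [indicator_of_notMem]
      simp only [mem_ofPred_eq, not_lt]
      linarith
  rw [integral_zero] at h
  obtain ⟨n, hn⟩ := (h.eventually (gt_mem_nhds hε)).exists
  exact ⟨n, n.cast_nonneg, hn.le⟩

lemma integral_abs_logKernel_le (x : S2) :
    ∫ y, |logKernel x y| ∂sphereArea ≤ 8 * (16 * Real.pi) + 4 * Real.pi := by
  calc _ ≤ ∫ y, (8 * invSqrtKernel x y + 1) ∂sphereArea :=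
        integral_mono (integrable_logKernel x).abs (((integrable_invSqrtKernel x).const_mul 8).add
          (integrable_const 1)) (abs_logKernel_le x)
    _ ≤ _ := by
        rw [integral_add ((integrable_invSqrtKernel x).const_mul 8) (integrable_const 1),
          integral_const_mul, integral_const, sphereArea_real_univ, smul_eq_mul, mul_one]
        linarith [integral_invSqrtKernel_le x]

lemma integral_sq_logKernel_le (x : S2) :
    ∫ y, logKernel x y ^ 2 ∂sphereArea ≤ 16 * (16 * Real.pi) + 4 * Real.pi := by
  calc _ ≤ ∫ y, (16 * invSqrtKernel x y + 1) ∂sphereArea :=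
        integral_mono (integrable_logKernel_sq x) (((integrable_invSqrtKernel x).const_mul 16).add
          (integrable_const 1)) (sq_logKernel_le x)
    _ ≤ _ := by
        rw [integral_add ((integrable_invSqrtKernel x).const_mul 16) (integrable_const 1),
          integral_const_mul, integral_const, sphereArea_real_univ, smul_eq_mul, mul_one]
        linarith [integral_invSqrtKernel_le x]

/-- Solutions of the exponential integral equation are square integrable. -/
lemma integrable_sq_of_integral_eq {f : S2 → ℝ} (hfm : Measurable f) (hf0 : ∀ x, 0 ≤ f x)
    (hf : Integrable f sphereArea) {a b : ℝ} (ha : 0 < a)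
    (h : ∀ᵐ x ∂sphereArea, Integrable (fun y => logKernel x y * f y) sphereArea ∧
      f x = Real.exp (a * (∫ y, logKernel x y * f y ∂sphereArea) - b)) :
    Integrable (fun x => f x ^ 2) sphereArea := by
  -- The part of `f` above height `M` has mass at most `1 / (4 a)`. In `f² = exp (2 a ∫ k f - 2 b)`,
  -- that part contributes `∫ (4 a f₁) (k / 2)`, whose weight has mass at most one, so Jensen's
  -- inequality applies. The remainder of `f` is bounded by `M`.
  obtain ⟨M, hM0, hM⟩ := exists_setIntegral_le hf hfm (ε := 1 / (4 * a)) (by positivity)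
  have hset : MeasurableSet {x | M < f x} := measurableSet_lt measurable_const hfm
  set f₁ : S2 → ℝ := {x | M < f x}.indicator f with hf₁
  have hf₁i : Integrable f₁ sphereArea := hf.indicator hset
  have hf₁0 (x : S2) : 0 ≤ f₁ x := indicator_nonneg (fun x _ => hf0 x) x
  have hf₂ (x : S2) : |f x - f₁ x| ≤ M := by
    by_cases hx : M < f x
    · simp [hf₁, indicator_of_mem (show x ∈ {x | M < f x} from hx), hM0]
    · rw [hf₁, indicator_of_notMem (show x ∉ {x | M < f x} from hx), sub_zero,
        abs_of_nonneg (hf0 x)]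
      exact not_lt.1 hx
  set C := 8 * (16 * Real.pi) + 4 * Real.pi
  have hprod := integrable_invSqrtKernel_mul (hf₁i.const_mul (4 * a))
  have hI : Integrable (fun x => Real.exp (2 * a * (C * M) - 2 * b) *
      (1 + ((∫ y, 4 * a * f₁ y * invSqrtKernel x y ∂sphereArea) +
        ∫ y, 4 * a * f₁ y ∂sphereArea))) sphereArea :=
    ((integrable_const 1).add (hprod.integral_prod_left.add (integrable_const _))).const_mul _
  refine hI.mono' (hfm.pow_const 2).aestronglyMeasurable ?_
  filter_upwards [h, hprod.prod_right_ae] with x ⟨hx1, hx2⟩ hx3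
  have hk₁ : Integrable (fun y => logKernel x y * f₁ y) sphereArea := by
    have e : (fun y => logKernel x y * f₁ y) =
        {x | M < f x}.indicator fun y => logKernel x y * f y := by
      ext y; by_cases hy : M < f y <;> simp [hf₁, indicator, hy]
    rw [e]; exact hx1.indicator hset
  have hk₂ : Integrable (fun y => logKernel x y * (f y - f₁ y)) sphereArea := by
    refine (hx1.sub hk₁).congr (.of_forall fun y => ?_)
    simp only [Pi.sub_apply]
    ring
  have hsplit : ∫ y, logKernel x y * f y ∂sphereArea =
      (∫ y, logKernel x y * f₁ y ∂sphereArea) +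
        ∫ y, logKernel x y * (f y - f₁ y) ∂sphereArea := by
    rw [← integral_add hk₁ hk₂]; congr 1; ext y; ring
  have hb₂ : ∫ y, logKernel x y * (f y - f₁ y) ∂sphereArea ≤ C * M := by
    calc _ ≤ ∫ y, |logKernel x y| * M ∂sphereArea := by
          refine integral_mono hk₂ ((integrable_logKernel x).abs.mul_const M) fun y => ?_
          refine (le_abs_self _).trans ?_
          rw [abs_mul]
          exact mul_le_mul_of_nonneg_left (hf₂ y) (abs_nonneg _)
      _ ≤ _ := by
          rw [integral_mul_const]
          exact mul_le_mul_of_nonneg_right (integral_abs_logKernel_le x) hM0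
  have hwe : Integrable (fun y => 4 * a * f₁ y * Real.exp (1 / 2 * logKernel x y)) sphereArea := by
    refine (hx3.add (hf₁i.const_mul (4 * a))).mono' ?_ (.of_forall fun y => ?_)
    · exact (hf₁i.const_mul (4 * a)).aestronglyMeasurable.mul (Real.measurable_exp.comp
        ((measurable_logKernel x).const_mul _)).aestronglyMeasurable
    · have h0 : 0 ≤ 4 * a * f₁ y := mul_nonneg (by positivity) (hf₁0 y)
      rw [Real.norm_of_nonneg (mul_nonneg h0 (Real.exp_pos _).le)]
      have := mul_le_mul_of_nonneg_left (exp_half_logKernel_le x y) h0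
      simp only [Pi.add_apply]
      linarith
  have hJ := exp_integral_le (w := fun y => 4 * a * f₁ y) (g := fun y => 1 / 2 * logKernel x y)
    (hf₁i.const_mul (4 * a)) (fun y => mul_nonneg (by positivity) (hf₁0 y)) (by
      rw [integral_const_mul]
      calc 4 * a * ∫ y, f₁ y ∂sphereArea ≤ 4 * a * (1 / (4 * a)) :=
            mul_le_mul_of_nonneg_left hM (by positivity)
        _ = 1 := by field_simp)
    (by
      have := hk₁.const_mul (2 * a)
      refine this.congr (.of_forall fun y => ?_)
      simp only; ring) hwe
  have e1 : ∫ y, 4 * a * f₁ y * (1 / 2 * logKernel x y) ∂sphereArea =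
      2 * a * ∫ y, logKernel x y * f₁ y ∂sphereArea := by
    rw [← integral_const_mul]; congr 1; ext y; ring
  rw [e1] at hJ
  have hmono : ∫ y, 4 * a * f₁ y * Real.exp (1 / 2 * logKernel x y) ∂sphereArea ≤
      (∫ y, 4 * a * f₁ y * invSqrtKernel x y ∂sphereArea) + ∫ y, 4 * a * f₁ y ∂sphereArea := by
    rw [← integral_add hx3 (hf₁i.const_mul (4 * a))]
    refine integral_mono hwe (hx3.add (hf₁i.const_mul (4 * a))) fun y => ?_
    have h0 : 0 ≤ 4 * a * f₁ y := mul_nonneg (by positivity) (hf₁0 y)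
    have := mul_le_mul_of_nonneg_left (exp_half_logKernel_le x y) h0
    simp only
    linarith
  rw [Real.norm_of_nonneg (sq_nonneg _)]
  calc f x ^ 2 = Real.exp (2 * a * (∫ y, logKernel x y * (f y - f₁ y) ∂sphereArea) - 2 * b) *
        Real.exp (2 * a * ∫ y, logKernel x y * f₁ y ∂sphereArea) := by
        rw [hx2, ← Real.exp_nat_mul, ← Real.exp_add, hsplit]
        congr 1; push_cast; ring
    _ ≤ _ := by
        refine mul_le_mul (Real.exp_le_exp.2 ?_) (hJ.trans (by linarith)) (Real.exp_pos _).le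
          (Real.exp_pos _).le
        have := mul_le_mul_of_nonneg_left hb₂ (by positivity : 0 ≤ 2 * a)
        linarith

/-- Solutions of the exponential integral equation are bounded. -/
lemma exists_bound_of_integral_eq {f : S2 → ℝ} (hfm : Measurable f) (hf0 : ∀ x, 0 ≤ f x)
    (hf : Integrable f sphereArea) {a b : ℝ} (ha : 0 < a)
    (h : ∀ᵐ x ∂sphereArea, Integrable (fun y => logKernel x y * f y) sphereArea ∧
      f x = Real.exp (a * (∫ y, logKernel x y * f y ∂sphereArea) - b)) :
    ∃ M : ℝ, ∀ᵐ x ∂sphereArea, f x ≤ M := by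
  have h2 := integrable_sq_of_integral_eq hfm hf0 hf ha h
  refine ⟨Real.exp (a * (1 / 2 * ((16 * (16 * Real.pi) + 4 * Real.pi) +
    ∫ y, f y ^ 2 ∂sphereArea)) - b), ?_⟩
  filter_upwards [h] with x ⟨hx1, hx2⟩
  rw [hx2]
  refine Real.exp_le_exp.2 (sub_le_sub_right (mul_le_mul_of_nonneg_left ?_ ha.le) b)
  -- Square integrability of the kernel and of `f` bounds the potential uniformly, through `k f ≤
  -- (k² + f²) / 2`.
  calc _ ≤ ∫ y, 1 / 2 * (logKernel x y ^ 2 + f y ^ 2) ∂sphereArea := by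
        refine integral_mono hx1 (((integrable_logKernel_sq x).add h2).const_mul _) fun y => ?_
        have := sq_nonneg (logKernel x y - f y)
        simp only
        nlinarith
    _ ≤ _ := by
        rw [integral_const_mul, integral_add (integrable_logKernel_sq x) h2]
        linarith [integral_sq_logKernel_le x]

end

noncomputable section

open Filter Topology

/-! ### The logarithmic potential of a density -/

/-- The point of the sphere on the ray through `y`. -/
def rayPoint (y : E3) (hy : y ≠ 0) : S2 :=
  ⟨‖y‖⁻¹ • y, by
    rw [mem_sphere_zero_iff_norm, norm_smul, norm_inv, norm_norm,
      inv_mul_cancel₀ (norm_ne_zero_iff.2 hy)]⟩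

lemma coe_rayPoint (y : E3) (hy : y ≠ 0) : (rayPoint y hy : E3) = ‖y‖⁻¹ • y := rfl

/-- The derivative of `y ↦ ⟪‖y‖⁻¹ • y, z⟫`. -/
def cosDeriv (y z : E3) : E3 →L[ℝ] ℝ :=
  innerSL ℝ (‖y‖⁻¹ • (z - inner ℝ (‖y‖⁻¹ • y) z • ‖y‖⁻¹ • y))

lemma hasFDerivAt_inner_ray {y : E3} (hy : y ≠ 0) (z : E3) :
    HasFDerivAt (fun w : E3 => inner ℝ (‖w‖⁻¹ • w) z) (cosDeriv y z) y := by
  have hn : 0 < ‖y‖ := norm_pos_iff.2 hy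
  have h1 : HasFDerivAt (fun w : E3 => ‖w‖) (‖y‖⁻¹ • innerSL ℝ y) y := by
    have h := ((hasStrictFDerivAt_norm_sq y).hasFDerivAt).sqrt (by positivity)
    simp only [Real.sqrt_sq (norm_nonneg _)] at h
    convert! h using 1
    ext v
    simp
    field_simp
  have h2 : HasFDerivAt (fun w : E3 => inner ℝ w z) (innerSL ℝ z) y := by
    have e : (fun w : E3 => inner ℝ w z) = innerSL ℝ z := by
      ext w; rw [innerSL_apply_apply, real_inner_comm]
    rw [e]
    exact (innerSL ℝ z).hasFDerivAt
  have h3 := ((hasDerivAt_inv hn.ne').comp_hasFDerivAt y h1).mul h2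
  have e : (fun w : E3 => inner ℝ (‖w‖⁻¹ • w) z) = fun w : E3 => ‖w‖⁻¹ * inner ℝ w z := by
    ext w; rw [real_inner_smul_left]
  rw [e]
  convert! h3 using 1
  ext v
  simp [cosDeriv, real_inner_smul_left]
  field_simp
  ring

lemma continuousAt_cosDeriv {y : E3} (hy : y ≠ 0) (z : E3) :
    ContinuousAt (fun w => cosDeriv w z) y := by
  have hn : ‖y‖ ≠ 0 := norm_ne_zero_iff.2 hy
  have h1 : ContinuousAt (fun w : E3 => ‖w‖⁻¹) y := continuous_norm.continuousAt.inv₀ hn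
  have h2 : ContinuousAt (fun w : E3 => ‖w‖⁻¹ • w) y := h1.smul continuousAt_id
  exact (innerSL ℝ).continuous.continuousAt.comp
    (h1.smul (continuousAt_const.sub
      (ContinuousAt.fun_smul (h2.inner (𝕜 := ℝ) (continuousAt_const (y := z))) h2)))

lemma continuous_cosDeriv (y : E3) : Continuous fun z : S2 => cosDeriv y z := by
  unfold cosDeriv
  fun_prop

/-- With `t = ⟨p, z⟩`, the component of `z` orthogonal to `p` has squared norm `1 - t²`, at most `2
(1 - t)`. This decay reduces the singularity of the differentiated kernel to `(1 - t)^{-1/2}`. -/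
lemma norm_cosDeriv_le {y : E3} (hy : y ≠ 0) (z : S2) :
    ‖cosDeriv y z‖ ≤ 2 * ‖y‖⁻¹ * √(1 - inner ℝ (rayPoint y hy : E3) (z : E3)) := by
  set p := rayPoint y hy
  have hp : ‖y‖⁻¹ • y = (p : E3) := rfl
  have h1 := S2.inner_le_one p z
  have h2 := S2.neg_one_le_inner p z
  rw [cosDeriv, innerSL_apply_norm, norm_smul, norm_inv, norm_norm, hp,
    mul_comm 2, mul_assoc]
  refine mul_le_mul_of_nonneg_left ?_ (by positivity)
  refine le_of_sq_le_sq ?_ (by positivity)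
  rw [mul_pow, Real.sq_sqrt (by linarith), norm_sub_sq_real, norm_smul, S2.norm_coe, S2.norm_coe,
    real_inner_smul_right, real_inner_comm (p : E3) (z : E3), Real.norm_eq_abs, mul_one, sq_abs]
  nlinarith

/-- A regularization of the logarithmic potential of the density `h`, extended to be constant
along rays; for `a = 1` it is the logarithmic potential. -/
def logPot (a : ℝ) (h : S2 → ℝ) (y : E3) : ℝ :=
  ∫ z : S2, -Real.log (a - inner ℝ (‖y‖⁻¹ • y) (z : E3)) * h z ∂sphereArea

/-- The derivative of `logPot a h`. -/
def logPotDeriv (a : ℝ) (h : S2 → ℝ) (y : E3) : E3 →L[ℝ] ℝ :=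
  ∫ z : S2, ((a - inner ℝ (‖y‖⁻¹ • y) (z : E3))⁻¹ * h z) • cosDeriv y z ∂sphereArea

lemma rayConst_logPot (a : ℝ) (h : S2 → ℝ) : RayConst (logPot a h) := by
  intro c hc y
  have : ‖c • y‖⁻¹ • c • y = ‖y‖⁻¹ • y := by
    rw [norm_smul, Real.norm_of_nonneg hc.le, smul_smul, mul_inv, mul_right_comm,
      inv_mul_cancel₀ hc.ne', one_mul]
  simp only [logPot, this]

lemma logPot_one_eq (h : S2 → ℝ) {y : E3} (hy : y ≠ 0) :
    logPot 1 h y = ∫ z, logKernel (rayPoint y hy) z * h z ∂sphereArea := rfl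

lemma logPot_coe (h : S2 → ℝ) (x : S2) :
    logPot 1 h x = ∫ z, logKernel x z * h z ∂sphereArea := by
  simp only [logPot, S2.norm_coe, inv_one, one_smul, logKernel]

lemma logPot_congr {h k : S2 → ℝ} (hk : h =ᵐ[sphereArea] k) (a : ℝ) :
    logPot a h = logPot a k := by
  ext y
  exact integral_congr_ae (hk.mono fun z hz => by simp only [hz])

section Bounded

variable {h : S2 → ℝ} {C : ℝ}

lemma measurable_sub_inner (a : ℝ) (v : E3) :
    Measurable fun z : S2 => a - inner ℝ v (z : E3) := by
  have : Continuous fun z : S2 => a - inner ℝ v (z : E3) := by fun_prop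
  exact this.measurable

lemma aestronglyMeasurable_logPotDeriv (hm : Measurable h) (a : ℝ) (y : E3) :
    AEStronglyMeasurable (fun z : S2 =>
      ((a - inner ℝ (‖y‖⁻¹ • y) (z : E3))⁻¹ * h z) • cosDeriv y z) sphereArea :=
  ((measurable_sub_inner a _).inv.mul hm).aestronglyMeasurable.smul
    (continuous_cosDeriv y).aestronglyMeasurable

lemma norm_logPotDeriv_integrand_le (hC : ∀ z, |h z| ≤ C) {a : ℝ} (ha : 1 < a) {y : E3}
    (hy : y ≠ 0) (z : S2) :
    ‖((a - inner ℝ (‖y‖⁻¹ • y) (z : E3))⁻¹ * h z) • cosDeriv y z‖ ≤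
      (a - 1)⁻¹ * C * (4 * ‖y‖⁻¹) := by
  have h1 := S2.inner_le_one (rayPoint y hy) z
  have h2 := S2.neg_one_le_inner (rayPoint y hy) z
  have h3 := norm_cosDeriv_le hy z
  rw [coe_rayPoint] at h1 h2 h3
  have h4 : √(1 - inner ℝ (‖y‖⁻¹ • y) (z : E3)) ≤ 2 := Real.sqrt_le_iff.2 ⟨by norm_num, by linarith⟩
  have hC0 : 0 ≤ C := (abs_nonneg _).trans (hC z)
  rw [norm_smul, norm_mul, norm_inv, Real.norm_of_nonneg (by linarith)]
  refine mul_le_mul (mul_le_mul ?_ (hC z) (norm_nonneg _) (by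
    rw [inv_nonneg]; linarith)) (h3.trans ?_) (norm_nonneg _) (mul_nonneg (by
    rw [inv_nonneg]; linarith) hC0)
  · exact inv_anti₀ (by linarith) (by linarith)
  · have : 0 ≤ ‖y‖⁻¹ := by positivity
    nlinarith

lemma abs_log_sub_inner_le {a : ℝ} (ha : 1 < a) (p z : S2) :
    |Real.log (a - inner ℝ (p : E3) (z : E3))| ≤ |Real.log (a - 1)| + (a + 1) := by
  have h1 := S2.inner_le_one p z
  have h2 := S2.neg_one_le_inner p z
  have h3 := Real.log_le_log (by linarith) (by linarith :
    a - 1 ≤ a - inner ℝ (p : E3) (z : E3))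
  have h4 := Real.log_le_sub_one_of_pos (by linarith : 0 < a - inner ℝ (p : E3) (z : E3))
  rw [abs_le]
  constructor
  · linarith [neg_abs_le (Real.log (a - 1))]
  · linarith [abs_nonneg (Real.log (a - 1))]

lemma hasFDerivAt_logPot_of_one_lt (hm : Measurable h) (hC : ∀ z, |h z| ≤ C) {a : ℝ} (ha : 1 < a)
    {y : E3} (hy : y ≠ 0) : HasFDerivAt (logPot a h) (logPotDeriv a h y) y := by
  have hn : 0 < ‖y‖ := norm_pos_iff.2 hy
  have hs : {w : E3 | ‖y‖ / 2 < ‖w‖} ∈ 𝓝 y :=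
    (isOpen_lt continuous_const continuous_norm).mem_nhds (by simp [hn])
  have hpos {w : E3} (hw : w ∈ {w : E3 | ‖y‖ / 2 < ‖w‖}) : w ≠ 0 :=
    norm_pos_iff.1 (lt_trans (by positivity) hw)
  have hmeas (w : E3) : Measurable fun z : S2 =>
      -Real.log (a - inner ℝ (‖w‖⁻¹ • w) (z : E3)) * h z :=
    (measurable_sub_inner a _).log.neg.mul hm
  refine hasFDerivAt_integral_of_dominated_of_fderiv_le (μ := sphereArea) (𝕜 := ℝ)
    (F := fun w (z : S2) => -Real.log (a - inner ℝ (‖w‖⁻¹ • w) (z : E3)) * h z)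
    (F' := fun w z => ((a - inner ℝ (‖w‖⁻¹ • w) (z : E3))⁻¹ * h z) • cosDeriv w z)
    (bound := fun _ => (a - 1)⁻¹ * C * (4 * (‖y‖ / 2)⁻¹)) hs
    (.of_forall fun w => (hmeas w).aestronglyMeasurable) ?_
    (aestronglyMeasurable_logPotDeriv hm a y) ?_ (integrable_const _) ?_
  · refine Integrable.of_bound (hmeas y).aestronglyMeasurable ((|Real.log (a - 1)| + (a + 1)) * C)
      (.of_forall fun z => ?_)
    rw [norm_mul, norm_neg]
    exact mul_le_mul (abs_log_sub_inner_le ha (rayPoint y hy) z) (hC z) (norm_nonneg _)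
      (by positivity)
  · refine .of_forall fun z w hw => (norm_logPotDeriv_integrand_le hC ha (hpos hw) z).trans ?_
    have hC0 : 0 ≤ C := (abs_nonneg _).trans (hC z)
    have : 0 ≤ (a - 1)⁻¹ * C := mul_nonneg (by rw [inv_nonneg]; linarith) hC0
    refine mul_le_mul_of_nonneg_left (mul_le_mul_of_nonneg_left ?_ (by norm_num)) this
    exact inv_anti₀ (by positivity) (le_of_lt hw)
  · refine .of_forall fun z w hw => ?_
    have h1 := S2.inner_le_one (rayPoint w (hpos hw)) z
    rw [coe_rayPoint] at h1
    have := ((((hasFDerivAt_inner_ray (hpos hw) (z : E3)).const_sub a).log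
      (by linarith)).neg.mul_const (h z))
    refine this.congr_fderiv ?_
    ext v
    simp
    ring

lemma continuousOn_logPotDeriv (hm : Measurable h) (hC : ∀ z, |h z| ≤ C) {a : ℝ} (ha : 1 < a)
    {r : ℝ} (hr : 0 < r) : ContinuousOn (logPotDeriv a h) {y : E3 | r < ‖y‖} := by
  have hpos {w : E3} (hw : w ∈ {w : E3 | r < ‖w‖}) : w ≠ 0 :=
    norm_pos_iff.1 (lt_trans (by positivity) hw)
  refine continuousOn_of_dominated (bound := fun _ => (a - 1)⁻¹ * C * (4 * r⁻¹))
    (fun y _ => aestronglyMeasurable_logPotDeriv hm a y) (fun y hy => .of_forall fun z => ?_)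
    (integrable_const _) (.of_forall fun z y hy => ContinuousAt.continuousWithinAt ?_)
  · refine (norm_logPotDeriv_integrand_le hC ha (hpos hy) z).trans ?_
    have hC0 : 0 ≤ C := (abs_nonneg _).trans (hC z)
    have : 0 ≤ (a - 1)⁻¹ * C := mul_nonneg (by rw [inv_nonneg]; linarith) hC0
    refine mul_le_mul_of_nonneg_left (mul_le_mul_of_nonneg_left ?_ (by norm_num)) this
    exact inv_anti₀ (by positivity) (le_of_lt hy)
  · have h1 := S2.inner_le_one (rayPoint y (hpos hy)) z
    rw [coe_rayPoint] at h1
    exact (((continuousAt_const.sub (hasFDerivAt_inner_ray (hpos hy) (z : E3)).continuousAt).inv₀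
      (by simp only [Pi.sub_apply]; linarith)).mul continuousAt_const).smul (continuousAt_cosDeriv (hpos hy) z)

/-- The error made in the derivative of the logarithmic potential by regularizing the kernel. -/
def regError (a : ℝ) (p : S2) : ℝ :=
  ∫ z, (a - 1) * (a - inner ℝ (p : E3) (z : E3))⁻¹ * invSqrtKernel p z ∂sphereArea

/-- Rotation invariance makes the error the same at all points, which turns pointwise convergence of
derivatives into uniform convergence. -/
lemma regError_eq (a : ℝ) (p q : S2) : regError a p = regError a q := by
  obtain ⟨L, rfl⟩ := exists_sphereMap_eq q p
  unfold regError
  rw [← integral_sphereMap L]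
  simp only [invSqrtKernel, coe_sphereMap, LinearIsometryEquiv.inner_map_map]

lemma regError_integrand_le {a : ℝ} (ha : 1 < a) (p z : S2) :
    ‖(a - 1) * (a - inner ℝ (p : E3) (z : E3))⁻¹ * invSqrtKernel p z‖ ≤ invSqrtKernel p z := by
  have h1 := S2.inner_le_one p z
  have h2 : 0 < a - inner ℝ (p : E3) (z : E3) := by linarith
  rw [norm_mul, Real.norm_of_nonneg (invSqrtKernel_nonneg p z), Real.norm_of_nonneg
    (mul_nonneg (by linarith) (inv_nonneg.2 h2.le))]
  refine mul_le_of_le_one_left (invSqrtKernel_nonneg p z) ?_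
  rw [← div_eq_mul_inv, div_le_one h2]
  linarith

lemma measurable_regError_integrand (a : ℝ) (p : S2) : Measurable fun z : S2 =>
    (a - 1) * (a - inner ℝ (p : E3) (z : E3))⁻¹ * invSqrtKernel p z :=
  ((measurable_sub_inner a _).inv.const_mul _).mul (measurable_invSqrtKernel p)

lemma ae_ne (p : S2) : ∀ᵐ x ∂sphereArea, p ≠ x := by
  rw [ae_iff]; simpa using sphereArea_singleton p

lemma tendsto_regError (p : S2) : Tendsto (fun a => regError a p) (𝓝[>] 1) (𝓝 0) := by
  rw [← integral_zero S2 ℝ (μ := sphereArea)]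
  refine tendsto_integral_filter_of_dominated_convergence (fun z => invSqrtKernel p z)
    (.of_forall fun a => (measurable_regError_integrand a p).aestronglyMeasurable) ?_
    (integrable_invSqrtKernel p) ?_
  · filter_upwards [self_mem_nhdsWithin] with a ha
    exact .of_forall fun z => regError_integrand_le ha p z
  · filter_upwards [ae_ne p] with z hz
    have h1 := S2.inner_lt_one hz
    have : ContinuousAt (fun a : ℝ => (a - 1) * (a - inner ℝ (p : E3) (z : E3))⁻¹ *
        invSqrtKernel p z) 1 :=
      ((continuousAt_id.sub continuousAt_const).mul
        ((continuousAt_id.sub continuousAt_const).inv₀ (by simp; linarith))).mul continuousAt_const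
    have h := this.tendsto.mono_left (nhdsWithin_le_nhds (s := Ioi 1))
    simpa using h

lemma norm_logPotDeriv_integrand_one_le (hC : ∀ z, |h z| ≤ C) {y : E3}
    (hy : y ≠ 0) (z : S2) :
    ‖((1 - inner ℝ (‖y‖⁻¹ • y) (z : E3))⁻¹ * h z) • cosDeriv y z‖ ≤
      2 * C * ‖y‖⁻¹ * invSqrtKernel (rayPoint y hy) z := by
  have h3 := norm_cosDeriv_le hy z
  have hC0 : 0 ≤ C := (abs_nonneg _).trans (hC z)
  rw [invSqrtKernel]
  rw [coe_rayPoint] at h3 ⊢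
  set t := inner ℝ (‖y‖⁻¹ • y) (z : E3) with ht
  have h1 : t ≤ 1 := S2.inner_le_one (rayPoint y hy) z
  rw [norm_smul, norm_mul, norm_inv, Real.norm_of_nonneg (by linarith)]
  rcases h1.eq_or_lt with h1 | h1
  · simp [h1]
  · have hs : 0 < √(1 - t) := Real.sqrt_pos.2 (by linarith)
    have e : (1 - t)⁻¹ = (√(1 - t))⁻¹ * (√(1 - t))⁻¹ := by
      rw [← mul_inv, Real.mul_self_sqrt (by linarith)]
    calc _ ≤ (1 - t)⁻¹ * C * (2 * ‖y‖⁻¹ * √(1 - t)) := by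
          refine mul_le_mul (mul_le_mul_of_nonneg_left (hC z) ?_) h3 (norm_nonneg _) ?_
          · rw [inv_nonneg]; linarith
          · refine mul_nonneg ?_ hC0; rw [inv_nonneg]; linarith
      _ = _ := by rw [e]; field_simp

/-- The two integrands differ by the factor `(a - 1) / (a - t)` applied to the singular one, because
`1/(1 - t) - 1/(a - t) = (a - 1) / ((a - t) (1 - t))`. -/
lemma norm_logPotDeriv_sub_le (hm : Measurable h) (hC : ∀ z, |h z| ≤ C) {a : ℝ} (ha : 1 < a)
    {y : E3} (hy : y ≠ 0) :
    ‖logPotDeriv 1 h y - logPotDeriv a h y‖ ≤ 2 * C * ‖y‖⁻¹ * regError a (rayPoint y hy) := by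
  set p := rayPoint y hy with hp
  have i1 : Integrable (fun z : S2 =>
      ((1 - inner ℝ (‖y‖⁻¹ • y) (z : E3))⁻¹ * h z) • cosDeriv y z) sphereArea :=
    ((integrable_invSqrtKernel p).const_mul _).mono' (aestronglyMeasurable_logPotDeriv hm 1 y)
      (.of_forall fun z => norm_logPotDeriv_integrand_one_le hC hy z)
  have i2 : Integrable (fun z : S2 =>
      ((a - inner ℝ (‖y‖⁻¹ • y) (z : E3))⁻¹ * h z) • cosDeriv y z) sphereArea :=
    Integrable.of_bound (aestronglyMeasurable_logPotDeriv hm a y) _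
      (.of_forall fun z => norm_logPotDeriv_integrand_le hC ha hy z)
  have i3 : Integrable (fun z : S2 => (a - 1) * (a - inner ℝ (p : E3) (z : E3))⁻¹ *
      invSqrtKernel p z) sphereArea :=
    (integrable_invSqrtKernel p).mono' (measurable_regError_integrand a p).aestronglyMeasurable
      (.of_forall fun z => regError_integrand_le ha p z)
  rw [logPotDeriv, logPotDeriv, ← integral_sub i1 i2, regError, ← integral_const_mul]
  refine norm_integral_le_of_norm_le (i3.const_mul _) ?_
  filter_upwards [ae_ne p] with z hz
  have h1 := S2.inner_lt_one hz
  have hb := norm_logPotDeriv_integrand_one_le hC hy z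
  rw [← hp] at hb
  have e : ((1 - inner ℝ (‖y‖⁻¹ • y) (z : E3))⁻¹ * h z) • cosDeriv y z -
      ((a - inner ℝ (‖y‖⁻¹ • y) (z : E3))⁻¹ * h z) • cosDeriv y z =
      ((a - 1) * (a - inner ℝ (p : E3) (z : E3))⁻¹) •
        ((1 - inner ℝ (‖y‖⁻¹ • y) (z : E3))⁻¹ * h z) • cosDeriv y z := by
    rw [hp, coe_rayPoint] at h1 ⊢
    ext v
    simp only [sub_apply, smul_apply, smul_eq_mul]
    generalize inner ℝ (‖y‖⁻¹ • y) (z : E3) = t at h1 ⊢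
    generalize cosDeriv y z v = w
    have e1 : 1 - t ≠ 0 := by linarith
    have e2 : a - t ≠ 0 := by linarith
    field_simp
    ring
  have h0 : 0 ≤ (a - 1) * (a - inner ℝ (p : E3) (z : E3))⁻¹ :=
    mul_nonneg (by linarith) (by rw [inv_nonneg]; linarith)
  rw [e, norm_smul, Real.norm_of_nonneg h0]
  calc _ ≤ _ := mul_le_mul_of_nonneg_left hb h0
    _ = _ := by ring

lemma tendsto_logPot (hm : Measurable h) (hC : ∀ z, |h z| ≤ C) {y : E3} (hy : y ≠ 0) :
    Tendsto (fun a => logPot a h y) (𝓝[>] 1) (𝓝 (logPot 1 h y)) := by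
  have hev : ∀ᶠ a : ℝ in 𝓝[>] 1, 1 < a ∧ a < 2 := by
    filter_upwards [Ioo_mem_nhdsGT (by norm_num : (1 : ℝ) < 2)] with a ha using ha
  refine tendsto_integral_filter_of_dominated_convergence
    (fun z => (|logKernel (rayPoint y hy) z| + 2) * C) (.of_forall fun a =>
      ((measurable_sub_inner a _).log.neg.mul hm).aestronglyMeasurable) ?_
    (((integrable_logKernel _).abs.add (integrable_const 2)).mul_const C) ?_
  · filter_upwards [hev] with a ha
    filter_upwards [ae_ne (rayPoint y hy)] with z hz
    have h1 := S2.inner_lt_one hz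
    have h2 := S2.neg_one_le_inner (rayPoint y hy) z
    rw [norm_mul, norm_neg, logKernel, abs_neg]
    exact mul_le_mul (abs_log_sub_le ha.1 ha.2 h2 h1) (hC z) (norm_nonneg _) (by positivity)
  · filter_upwards [ae_ne (rayPoint y hy)] with z hz
    have h1 := S2.inner_lt_one hz
    rw [coe_rayPoint] at h1
    refine Tendsto.mul_const _ (Tendsto.neg (Tendsto.log ?_ (by linarith)))
    exact (tendsto_id.sub_const _).mono_left nhdsWithin_le_nhds

/-- The logarithmic potential of a bounded density is continuously differentiable. -/
lemma contDiffOn_logPot_of_bounded (hm : Measurable h) (hC : ∀ z, |h z| ≤ C) :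
    ContDiffOn ℝ 1 (logPot 1 h) {0}ᶜ := by
  intro y hy
  have hy : y ≠ 0 := hy
  have hn : 0 < ‖y‖ := norm_pos_iff.2 hy
  refine ContDiffAt.contDiffWithinAt ?_
  set s : Set E3 := {w | ‖y‖ / 2 < ‖w‖}
  have hso : IsOpen s := isOpen_lt continuous_const continuous_norm
  have hys : y ∈ s := by simp [s, hn]
  have hpos {w : E3} (hw : w ∈ s) : w ≠ 0 :=
    norm_pos_iff.1 (lt_trans (by positivity) hw)
  set a : ℕ → ℝ := fun n => 1 + 1 / ((n : ℝ) + 1)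
  have ha (n : ℕ) : 1 < a n := by simp only [a]; linarith [Nat.one_div_pos_of_nat (α := ℝ) (n := n)]
  have hat : Tendsto a atTop (𝓝[>] 1) := by
    refine tendsto_nhdsWithin_iff.2 ⟨?_, .of_forall ha⟩
    simpa [a] using tendsto_one_div_add_atTop_nhds_zero_nat.const_add (1 : ℝ)
  have hC0 : 0 ≤ C := (abs_nonneg _).trans (hC (rayPoint y hy))
  -- Away from the origin the factor `‖y‖⁻¹` is bounded and `regError` may be evaluated at one fixed
  -- point.
  have hu : TendstoUniformlyOn (fun n => logPotDeriv (a n) h) (logPotDeriv 1 h) atTop s := by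
    rw [Metric.tendstoUniformlyOn_iff]
    intro ε hε
    have ht := ((tendsto_regError (rayPoint y hy)).comp hat).const_mul (2 * C * (‖y‖ / 2)⁻¹)
    rw [mul_zero] at ht
    filter_upwards [ht.eventually (gt_mem_nhds hε)] with n hn w hw
    rw [dist_eq_norm]
    refine (norm_logPotDeriv_sub_le hm hC (ha n) (hpos hw)).trans_lt (lt_of_le_of_lt ?_ hn)
    rw [regError_eq _ _ (rayPoint y hy)]
    refine mul_le_mul_of_nonneg_right (mul_le_mul_of_nonneg_left ?_ (by positivity)) ?_
    · exact inv_anti₀ (by positivity) (le_of_lt hw)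
    · refine integral_nonneg fun z => mul_nonneg (mul_nonneg (by linarith [ha n]) ?_)
        (invSqrtKernel_nonneg _ _)
      rw [inv_nonneg]
      linarith [S2.inner_le_one (rayPoint y hy) z, ha n]
  have hd {w : E3} (hw : w ∈ s) : HasFDerivAt (logPot 1 h) (logPotDeriv 1 h w) w :=
    hasFDerivAt_of_tendstoUniformlyOn hso hu
      (fun n w hw => hasFDerivAt_logPot_of_one_lt hm hC (ha n) (hpos hw))
      (fun w hw => (tendsto_logPot hm hC (hpos hw)).comp hat) hw
  have hc : ContinuousOn (logPotDeriv 1 h) s := hu.continuousOn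
    (Frequently.of_forall fun n => continuousOn_logPotDeriv hm hC (ha n) (by positivity))
  exact contDiffAt_one_iff.2 ⟨logPotDeriv 1 h, s, hso.mem_nhds hys, hc, fun w hw => hd hw⟩

end Bounded

end

noncomputable section

open Filter Topology

/-! ### Smoothness of the logarithmic potential -/

/-- The rotation fields span the plane orthogonal to `y`, and the radial derivative vanishes, so
rotation derivatives determine the full derivative. -/
lemma RayConst.fderiv_eq_sum {F : E3 → ℝ} (hF : RayConst F) {y : E3} (hy : y ≠ 0)
    (hd : DifferentiableAt ℝ F y) :
    fderiv ℝ F y = ∑ i, ∑ j, ((‖y‖ ^ 2)⁻¹ * y j * rotDeriv i j F y) • innerSL ℝ (stdVec i) := by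
  have hn : ‖y‖ ≠ 0 := norm_ne_zero_iff.2 hy
  have h0 := hF.fderiv_self hd
  ext v
  have e : v = (‖y‖ ^ 2)⁻¹ • ((∑ i, ∑ j, (y j * v i) • rotGen i j y) + (inner ℝ y v : ℝ) • y) := by
    ext k
    simp only [rotGen_apply, EuclideanSpace.norm_sq_eq, Real.norm_eq_abs, sq_abs]
    have hs : y 0 ^ 2 + y 1 ^ 2 + y 2 ^ 2 ≠ 0 := by
      have := EuclideanSpace.norm_sq_eq y
      simp only [Real.norm_eq_abs, sq_abs, Fin.sum_univ_three] at this
      rw [← this]; positivity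
    fin_cases k <;>
    · simp [Fin.sum_univ_three, stdVec_apply, PiLp.inner_apply]
      field_simp
      ring
  conv_lhs => rw [e]
  simp only [map_smul, map_add, h0, mul_zero, add_zero, rotDeriv, smul_eq_mul, add_apply,
    smul_apply, innerSL_apply_apply, inner_stdVec, Fin.sum_univ_three]
  ring

lemma logPot_rot {i j : Fin 3} (hij : i ≠ j) (t : ℝ) (H : E3 → ℝ) {y : E3} (hy : y ≠ 0) :
    logPot 1 (fun z => H z) (rot hij t y) =
      ∫ z : S2, logKernel (rayPoint y hy) z * H (rot hij t z) ∂sphereArea := by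
  rw [logPot, ← integral_sphereMap (rot hij t)]
  simp only [coe_sphereMap, LinearIsometryEquiv.norm_map, ← map_smul,
    LinearIsometryEquiv.inner_map_map, logKernel, coe_rayPoint]

/-- The kernel is invariant under simultaneous rotation of both variables, so a rotation of the
argument can be transferred to the density and differentiated there. -/
lemma rotDeriv_logPot {H : E3 → ℝ} (hH : ContDiffOn ℝ 1 H {0}ᶜ) (i j : Fin 3) {y : E3}
    (hy : y ≠ 0) :
    rotDeriv i j (logPot 1 fun z => H z) y = logPot 1 (fun z => rotDeriv i j H z) y := by
  rcases eq_or_ne i j with rfl | hij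
  · simp [rotDeriv_self, logPot]
  have hHx (x : S2) : ContDiffAt ℝ 1 H x :=
    hH.contDiffAt (isOpen_compl_singleton.mem_nhds x.coe_ne_zero)
  have hc := continuous_sphere_of_contDiffAt hHx
  obtain ⟨C, hC⟩ := exists_bound_sphere hc
  have hF := (contDiffOn_logPot_of_bounded hc.measurable hC).contDiffAt
    (isOpen_compl_singleton.mem_nhds (show y ∈ ({0}ᶜ : Set E3) from hy))
  have h1 := hasDerivAt_comp_rot hij (x := y) (t := 0) (F := logPot 1 fun z => H z)
    (by rw [rot_zero]; exact hF.differentiableAt one_ne_zero)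
  have h2 := hasDerivAt_integral_rot hij (integrable_logKernel (rayPoint y hy)) hHx
  simp only [logPot_rot hij _ H hy, rot_zero] at h1
  rw [h1.unique h2, logPot_one_eq _ hy]

lemma continuousOn_sphere {H : E3 → ℝ} (hH : ContinuousOn H {0}ᶜ) :
    Continuous fun x : S2 => H x :=
  hH.comp_continuous continuous_subtype_val fun x => x.coe_ne_zero

/-- The logarithmic potential gains one derivative. -/
lemma contDiffOn_logPot (n : ℕ) {H : E3 → ℝ} (hH : ContDiffOn ℝ n H {0}ᶜ) :
    ContDiffOn ℝ (n + 1) (logPot 1 fun z => H z) {0}ᶜ := by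
  induction n generalizing H with
  | zero =>
    have hc := continuousOn_sphere hH.continuousOn
    obtain ⟨C, hC⟩ := exists_bound_sphere hc
    simpa using contDiffOn_logPot_of_bounded hc.measurable hC
  | succ n ih =>
    have hH1 : ContDiffOn ℝ 1 H {0}ᶜ := hH.of_le (by norm_cast; omega)
    have hc := continuousOn_sphere hH.continuousOn
    obtain ⟨C, hC⟩ := exists_bound_sphere hc
    have hF := contDiffOn_logPot_of_bounded hc.measurable hC
    have hop : IsOpen ({0}ᶜ : Set E3) := isOpen_compl_singleton
    rw [contDiffOn_succ_iff_fderiv_of_isOpen hop]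
    refine ⟨hF.differentiableOn one_ne_zero, by simp, ?_⟩
    -- The first derivative is a smooth combination of potentials of the rotation derivatives of
    -- `H`, to which the induction hypothesis applies.
    have hd {y : E3} (hy : y ∈ ({0}ᶜ : Set E3)) :
        fderiv ℝ (logPot 1 fun z => H z) y =
        ∑ i, ∑ j, ((‖y‖ ^ 2)⁻¹ * y j * logPot 1 (fun z => rotDeriv i j H z) y) •
          innerSL ℝ (stdVec i) := by
      rw [(rayConst_logPot 1 _).fderiv_eq_sum hy ((hF.contDiffAt
        (hop.mem_nhds hy)).differentiableAt one_ne_zero)]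
      simp only [rotDeriv_logPot hH1 _ _ hy]
    refine ContDiffOn.congr ?_ fun y hy => hd hy
    have hr (i j : Fin 3) : ContDiffOn ℝ n (rotDeriv i j H) {0}ᶜ := fun y hy =>
      ((hH.contDiffAt (hop.mem_nhds hy)).rotDeriv (by norm_cast) i j).contDiffWithinAt
    refine ContDiffOn.sum fun i _ => ContDiffOn.sum fun j _ => ContDiffOn.fun_smul ?_ contDiffOn_const
    refine ContDiffOn.mul (ContDiffOn.mul ?_ ?_) (by exact_mod_cast ih (hr i j))
    · refine ContDiffOn.inv (contDiff_norm_sq ℝ).contDiffOn fun y hy => ?_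
      have := norm_ne_zero_iff.2 (show y ≠ 0 from hy)
      positivity
    · have e : (fun y : E3 => y j) = innerSL ℝ (stdVec j) := by
        ext y; simp
      rw [e]
      exact (innerSL ℝ (stdVec j)).contDiff.contDiffOn

lemma rotDeriv_congr {F G : E3 → ℝ} {y : E3} (h : F =ᶠ[𝓝 y] G) (i j : Fin 3) :
    rotDeriv i j F y = rotDeriv i j G y := by
  rw [rotDeriv, rotDeriv, h.fderiv_eq]

/-- Both rotation derivatives pass onto the density, and Green's representation formula evaluates
the result. -/
lemma rotLaplacian_logPot {H : E3 → ℝ} (hH : ContDiffOn ℝ 2 H {0}ᶜ) (x : S2) :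
    rotLaplacian (logPot 1 fun z => H z) x =
      (∫ z : S2, H z ∂sphereArea) - 4 * Real.pi * H x := by
  have hop : IsOpen ({0}ᶜ : Set E3) := isOpen_compl_singleton
  have hHx (x : S2) : ContDiffAt ℝ 2 H x :=
    hH.contDiffAt (hop.mem_nhds x.coe_ne_zero)
  have hr (i j : Fin 3) : ContDiffOn ℝ 1 (rotDeriv i j H) {0}ᶜ := fun y hy =>
    ((hH.contDiffAt (hop.mem_nhds hy)).rotDeriv (by norm_num) i j).contDiffWithinAt
  have e (i j : Fin 3) : rotDeriv i j (rotDeriv i j (logPot 1 fun z => H z)) x =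
      ∫ z : S2, logKernel x z * rotDeriv i j (rotDeriv i j H) z ∂sphereArea := by
    have : rotDeriv i j (logPot 1 fun z => H z) =ᶠ[𝓝 (x : E3)]
        logPot 1 fun z => rotDeriv i j H z := by
      filter_upwards [hop.mem_nhds x.coe_ne_zero] with y hy
      exact rotDeriv_logPot (hH.of_le (by norm_num)) i j hy
    rw [rotDeriv_congr this, rotDeriv_logPot (hr i j) i j x.coe_ne_zero, logPot_coe]
  rw [← integral_logKernel_mul_rotLaplacian x hHx, rotLaplacian]
  simp only [e, rotLaplacian]
  have hi (i j : Fin 3) : Integrable (fun z : S2 => logKernel x z *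
      rotDeriv i j (rotDeriv i j H) z) sphereArea :=
    (integrable_logKernel x).mul_continuous_sphere (continuous_rotDeriv_rotDeriv hHx i j)
  simp only [← integral_finsetSum _ fun j _ => hi _ j]
  rw [← integral_finsetSum _ fun i _ => integrable_finsetSum _ fun j _ => hi i j,
    ← integral_const_mul]
  congr 1
  ext z
  simp only [Finset.mul_sum]
  refine Finset.sum_congr rfl fun i _ => Finset.sum_congr rfl fun j _ => ?_
  ring

/-- Solutions of the exponential integral equation agree almost everywhere with a smooth one. -/
lemma exists_smooth_of_integral_eq {f : S2 → ℝ} (hfm : Measurable f) (hf0 : ∀ x, 0 ≤ f x)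
    (hf : Integrable f sphereArea) {a b : ℝ} (ha : 0 < a)
    (h : ∀ᵐ x ∂sphereArea, Integrable (fun y => logKernel x y * f y) sphereArea ∧
      f x = Real.exp (a * (∫ y, logKernel x y * f y ∂sphereArea) - b)) :
    ∃ W : E3 → ℝ, RayConst W ∧ (∀ n : ℕ, ContDiffOn ℝ n W {0}ᶜ) ∧
      (∀ x : S2, rotLaplacian W x = a * (∫ z, f z ∂sphereArea) - 4 * Real.pi * a * Real.exp (W x)) ∧
      ∀ᵐ x : S2 ∂sphereArea, f x = Real.exp (W x) := by
  obtain ⟨M, hM⟩ := exists_bound_of_integral_eq hfm hf0 hf ha h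
  set W : E3 → ℝ := fun y => a * logPot 1 f y - b with hW
  have hfW : ∀ᵐ x : S2 ∂sphereArea, f x = Real.exp (W x) := by
    filter_upwards [h] with x hx
    simp only [hW, logPot_coe]
    exact hx.2
  -- Truncation makes the bound hold everywhere without changing the potential.
  have hbd : (fun x => min (f x) M) =ᵐ[sphereArea] f := by
    filter_upwards [hM] with x hx using min_eq_left hx
  have hray : RayConst W := fun c hc y => by simp only [hW, rayConst_logPot 1 f c hc y]
  -- The fixed point equation drives the bootstrap: if `W` has `n` derivatives then so does `exp W`,
  -- and its potential has `n + 1`.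
  have hfix : W = fun y => a * logPot 1 (fun z => Real.exp (W z)) y - b := by
    rw [← logPot_congr hfW]
  have h1 : ContDiffOn ℝ 1 W {0}ᶜ := by
    have : ContDiffOn ℝ 1 (logPot 1 f) {0}ᶜ := by
      rw [← logPot_congr hbd]
      refine contDiffOn_logPot_of_bounded (C := |M|) (hfm.min measurable_const) fun z => ?_
      rcases le_total (f z) M with hz | hz
      · rw [min_eq_left hz, abs_of_nonneg (hf0 z)]
        exact hz.trans (le_abs_self M)
      · rw [min_eq_right hz]
    exact (contDiffOn_const.mul this).sub contDiffOn_const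
  have hn (n : ℕ) : ContDiffOn ℝ n W {0}ᶜ := by
    induction n with
    | zero => exact h1.of_le (by norm_num)
    | succ n ih =>
      rw [hfix]
      have := contDiffOn_logPot n ih.exp
      exact_mod_cast (contDiffOn_const.mul this).sub contDiffOn_const
  refine ⟨W, hray, hn, fun x => ?_, hfW⟩
  have h2 : ContDiffOn ℝ 2 (fun y => Real.exp (W y)) {0}ᶜ := (hn 2).exp
  have h3 : ContDiffAt ℝ 2 (logPot 1 fun z => Real.exp (W z)) x :=
    (contDiffOn_logPot 1 (h2.of_le (by norm_num))).contDiffAt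
      (isOpen_compl_singleton.mem_nhds x.coe_ne_zero) |>.of_le (by norm_num)
  have hev : ∀ᶠ y in 𝓝 (x : E3), DifferentiableAt ℝ (logPot 1 fun z => Real.exp (W z)) y := by
    filter_upwards [h3.eventually (by simp)] with y hy using hy.differentiableAt two_ne_zero
  have e1 (i j : Fin 3) : rotDeriv i j W =ᶠ[𝓝 (x : E3)] fun y =>
      a * rotDeriv i j (logPot 1 fun z => Real.exp (W z)) y := by
    filter_upwards [hev] with y hy
    conv_lhs => rw [hfix]
    rw [rotDeriv, fderiv_sub_const, fderiv_const_mul hy]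
    rfl
  have e2 (i j : Fin 3) : rotDeriv i j (rotDeriv i j W) x =
      a * rotDeriv i j (rotDeriv i j (logPot 1 fun z => Real.exp (W z))) x := by
    rw [rotDeriv_congr (e1 i j), rotDeriv, fderiv_const_mul
      ((h3.rotDeriv (m := 1) (by norm_num) i j).differentiableAt one_ne_zero)]
    rfl
  have e3 : rotLaplacian W x = a * rotLaplacian (logPot 1 fun z => Real.exp (W z)) x := by
    simp only [rotLaplacian, e2, ← Finset.mul_sum]
    ring
  rw [e3, rotLaplacian_logPot h2, integral_congr_ae hfW]
  ring

end

noncomputable section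

open Filter Topology
open scoped ContDiff

/-! ### Calculus on the punctured space -/

/-- Smoothness away from the origin. -/
abbrev SmoothOff (F : E3 → ℝ) : Prop := ContDiffOn ℝ ∞ F {0}ᶜ

/-- The partial derivative in the `i`-th coordinate direction. -/
def pd (i : Fin 3) (F : E3 → ℝ) (y : E3) : ℝ := fderiv ℝ F y (stdVec i)

/-- The sum of the pure second partial derivatives. -/
def lap (F : E3 → ℝ) (y : E3) : ℝ := ∑ i, pd i (pd i F) y

section Pd

variable {F G : E3 → ℝ} {y : E3}

lemma SmoothOff.contDiffAt (hF : SmoothOff F) (hy : y ≠ 0) : ContDiffAt ℝ ∞ F y :=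
  ContDiffOn.contDiffAt hF (isOpen_compl_singleton.mem_nhds hy)

lemma SmoothOff.differentiableAt (hF : SmoothOff F) (hy : y ≠ 0) : DifferentiableAt ℝ F y :=
  (SmoothOff.contDiffAt hF hy).differentiableAt (by simp)

lemma SmoothOff.pd (hF : SmoothOff F) (i : Fin 3) : SmoothOff (pd i F) :=
  (ContDiffOn.fderiv_of_isOpen hF isOpen_compl_singleton (m := ∞) (by simp)).clm_apply
    contDiffOn_const

lemma SmoothOff.lap (hF : SmoothOff F) : SmoothOff (lap F) :=
  ContDiffOn.sum fun i _ => (hF.pd i).pd i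

lemma smoothOff_coord (j : Fin 3) : SmoothOff fun y : E3 => y j := by
  have e : (fun y : E3 => y j) = innerSL ℝ (stdVec j) := by ext y; simp
  rw [e]
  exact (innerSL ℝ (stdVec j)).contDiff.contDiffOn

lemma pd_coord (i j : Fin 3) (y : E3) : pd i (fun y : E3 => y j) y = if i = j then 1 else 0 := by
  have e : (fun y : E3 => y j) = innerSL ℝ (stdVec j) := by ext y; simp
  rw [pd, e, ContinuousLinearMap.fderiv]
  simp [stdVec_apply]

lemma pd_congr (h : ∀ y ≠ 0, F y = G y) (i : Fin 3) (hy : y ≠ 0) : pd i F y = pd i G y := by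
  have : F =ᶠ[𝓝 y] G := by
    filter_upwards [isOpen_compl_singleton.mem_nhds hy] with z hz using h z hz
  rw [pd, pd, this.fderiv_eq]

lemma pd_mul (hF : SmoothOff F) (hG : SmoothOff G) (i : Fin 3) (hy : y ≠ 0) :
    pd i (fun y => F y * G y) y = pd i F y * G y + F y * pd i G y := by
  rw [pd, fderiv_fun_mul (SmoothOff.differentiableAt hF hy) (SmoothOff.differentiableAt hG hy)]
  simp [pd]
  ring

lemma pd_add (hF : SmoothOff F) (hG : SmoothOff G) (i : Fin 3) (hy : y ≠ 0) :
    pd i (fun y => F y + G y) y = pd i F y + pd i G y := by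
  rw [pd, fderiv_fun_add (SmoothOff.differentiableAt hF hy) (SmoothOff.differentiableAt hG hy)]
  simp [pd]

lemma pd_sub (hF : SmoothOff F) (hG : SmoothOff G) (i : Fin 3) (hy : y ≠ 0) :
    pd i (fun y => F y - G y) y = pd i F y - pd i G y := by
  rw [pd, fderiv_fun_sub (SmoothOff.differentiableAt hF hy) (SmoothOff.differentiableAt hG hy)]
  simp [pd]

lemma pd_const (i : Fin 3) (c : ℝ) (y : E3) : pd i (fun _ => c) y = 0 := by
  simp [pd]

lemma pd_const_mul (hF : SmoothOff F) (i : Fin 3) (c : ℝ) (hy : y ≠ 0) :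
    pd i (fun y => c * F y) y = c * pd i F y := by
  rw [pd_mul contDiffOn_const hF i hy, pd_const]
  ring

lemma pd_sum {F : Fin 3 → E3 → ℝ} (hF : ∀ j, SmoothOff (F j)) (i : Fin 3) (hy : y ≠ 0) :
    pd i (fun y => ∑ j, F j y) y = ∑ j, pd i (F j) y := by
  rw [pd, fderiv_fun_sum fun j _ => SmoothOff.differentiableAt (hF j) hy]
  simp [pd]

lemma pd_exp (hF : SmoothOff F) (i : Fin 3) (hy : y ≠ 0) :
    pd i (fun y => Real.exp (F y)) y = Real.exp (F y) * pd i F y := by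
  rw [pd, fderiv_exp (SmoothOff.differentiableAt hF hy)]
  simp [pd]

lemma pd_pd (hF : SmoothOff F) (i j : Fin 3) (hy : y ≠ 0) :
    pd i (pd j F) y = fderiv ℝ (fderiv ℝ F) y (stdVec i) (stdVec j) := by
  have h := (hasFDerivAt_fderiv ((SmoothOff.contDiffAt hF hy).of_le
    (by norm_cast))).clm_apply
    (hasFDerivAt_const (stdVec j) y)
  change fderiv ℝ (fun z => fderiv ℝ F z (stdVec j)) y (stdVec i) = _
  rw [h.fderiv]
  simp

lemma pd_comm (hF : SmoothOff F) (i j : Fin 3) (hy : y ≠ 0) :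
    pd i (pd j F) y = pd j (pd i F) y := by
  rw [pd_pd hF i j hy, pd_pd hF j i hy]
  have h : IsSymmSndFDerivAt ℝ F y := (SmoothOff.contDiffAt hF hy).isSymmSndFDerivAt
    (by simp only [minSmoothness_of_isRCLikeNormedField]; norm_cast)
  exact h _ _

lemma pd_lap (hF : SmoothOff F) (i : Fin 3) (hy : y ≠ 0) :
    pd i (lap F) y = ∑ j, pd j (pd j (pd i F)) y := by
  change pd i (fun y => ∑ j, pd j (pd j F) y) y = _
  rw [pd_sum (fun j => (hF.pd j).pd j) i hy]
  refine Finset.sum_congr rfl fun j _ => ?_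
  rw [pd_comm (hF.pd j) i j hy]
  exact pd_congr (fun z hz => pd_comm hF i j hz) j hy

lemma fderiv_eq_sum_pd (F : E3 → ℝ) (y v : E3) : fderiv ℝ F y v = ∑ i, v i * pd i F y := by
  rw [map_eq_sum_stdVec, Fin.sum_univ_three]
  rfl

lemma rotDeriv_eq_pd (F : E3 → ℝ) (i j : Fin 3) :
    rotDeriv i j F = fun y => y j * pd i F y - y i * pd j F y := by
  ext y
  simp [rotDeriv, rotGen_apply, pd]

lemma rotLaplacian_eq_pd (hF : SmoothOff F) (hy : y ≠ 0) :
    rotLaplacian F y = (∑ i, y i * y i) * lap F y - (∑ i, y i * ∑ j, y j * pd i (pd j F) y) -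
      2 * ∑ i, y i * pd i F y := by
  have h (i j : Fin 3) : rotDeriv i j (rotDeriv i j F) y =
      y j * (((if i = j then 1 else 0) * pd i F y + y j * pd i (pd i F) y) -
        (pd j F y + y i * pd i (pd j F) y)) -
      y i * ((pd i F y + y j * pd j (pd i F) y) -
        ((if j = i then 1 else 0) * pd j F y + y i * pd j (pd j F) y)) := by
    rw [rotDeriv_eq_pd (rotDeriv i j F), rotDeriv_eq_pd]
    have hc := smoothOff_coord
    beta_reduce
    rw [pd_sub ((hc j).mul (hF.pd i)) ((hc i).mul (hF.pd j)) i hy,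
      pd_sub ((hc j).mul (hF.pd i)) ((hc i).mul (hF.pd j)) j hy]
    simp only [pd_mul (hc _) (hF.pd _) _ hy, pd_coord, if_true]
    ring
  simp only [rotLaplacian, h, lap, Fin.sum_univ_three, pd_comm hF 1 0 hy, pd_comm hF 2 0 hy,
    pd_comm hF 2 1 hy]
  simp
  ring

/-- Partial derivatives of functions that are homogeneous with respect to one dilation. -/
lemma pd_smul {c k : ℝ} (h : ∀ y, F (c • y) = k * F y) (i : Fin 3) (y : E3) :
    c * pd i F (c • y) = k * pd i F y := by
  have e : (fun y => F (c • y)) = fun y => k * F y := funext h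
  have h1 := congr_arg (fun f => fderiv ℝ f y (stdVec i)) e
  simp only [fderiv_comp_smul] at h1
  rw [← smul_eq_mul k, ← smul_eq_mul c]
  change (c • fderiv ℝ F (c • y)) (stdVec i) = (k • fderiv ℝ F y) (stdVec i)
  rw [h1]
  change fderiv ℝ (k • F) y (stdVec i) = _
  rw [fderiv_const_smul_field]
  rfl

lemma pd_smul' {c k : ℝ} (hc : c ≠ 0) (h : ∀ y, F (c • y) = k * F y) (i : Fin 3) (y : E3) :
    pd i F (c • y) = k * c⁻¹ * pd i F y := by
  have := pd_smul h i y
  field_simp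
  linarith

lemma lap_smul {c k : ℝ} (hc : c ≠ 0) (h : ∀ y, F (c • y) = k * F y) (y : E3) :
    lap F (c • y) = k * c⁻¹ * c⁻¹ * lap F y := by
  simp only [lap, pd_smul' hc (pd_smul' hc h _), Finset.mul_sum]

lemma pd_inv (hF : SmoothOff F) (i : Fin 3) (hy : y ≠ 0) (h0 : F y ≠ 0) :
    pd i (fun y => (F y)⁻¹) y = -pd i F y * ((F y)⁻¹ * (F y)⁻¹) := by
  have h : HasFDerivAt (fun y => (F y)⁻¹) _ y :=
    (hasDerivAt_inv h0).comp_hasFDerivAt y (SmoothOff.differentiableAt hF hy).hasFDerivAt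
  rw [pd, h.fderiv]
  simp [pd]
  ring

lemma pd_log (hF : SmoothOff F) (i : Fin 3) (hy : y ≠ 0) (h0 : F y ≠ 0) :
    pd i (fun y => Real.log (F y)) y = pd i F y * (F y)⁻¹ := by
  rw [pd, ((SmoothOff.differentiableAt hF hy).hasFDerivAt.log h0).fderiv]
  simp [pd]
  ring

end Pd

end

noncomputable section

open Filter Topology
open scoped ContDiff

/-! ### Rigidity of homogeneous solutions -/

section Rigidity

variable {V : E3 → ℝ} {y : E3}

lemma pd_of_mul_lap_eq (hV : SmoothOff V)
    (heq : ∀ y ≠ 0, V y * lap V y = 1 + ∑ j, pd j V y * pd j V y) (i : Fin 3) (hy : y ≠ 0) :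
    pd i V y * lap V y + V y * pd i (lap V) y = ∑ j, 2 * (pd j V y * pd i (pd j V) y) := by
  have h := pd_congr heq i hy
  rw [pd_mul hV hV.lap i hy, pd_add contDiffOn_const
    (ContDiffOn.sum fun j _ => (hV.pd j).mul (hV.pd j)) i hy, pd_const,
    pd_sum (fun j => (hV.pd j).mul (hV.pd j)) i hy] at h
  rw [h, zero_add]
  refine Finset.sum_congr rfl fun j _ => ?_
  rw [pd_mul (hV.pd j) (hV.pd j) i hy]
  ring

/-- Take the divergence of the once differentiated equation. The terms `2 ∇V · ∇ΔV` on the two sides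
cancel, so no third derivatives remain. -/
lemma mul_lap_lap_eq (hV : SmoothOff V)
    (heq : ∀ y ≠ 0, V y * lap V y = 1 + ∑ j, pd j V y * pd j V y) (hy : y ≠ 0) :
    V y * lap (lap V) y = 2 * (∑ i, ∑ j, pd i (pd j V) y ^ 2) - lap V y ^ 2 := by
  have h (i : Fin 3) : pd i (pd i V) y * lap V y + pd i V y * pd i (lap V) y +
      (pd i V y * pd i (lap V) y + V y * pd i (pd i (lap V)) y) =
      ∑ j, 2 * (pd i (pd j V) y ^ 2 + pd j V y * pd i (pd i (pd j V)) y) := by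
    have h := pd_congr (fun z hz => pd_of_mul_lap_eq hV heq i hz) i hy
    rw [pd_add ((hV.pd i).mul hV.lap) (hV.mul (hV.lap.pd i)) i hy, pd_mul (hV.pd i) hV.lap i hy,
      pd_mul hV (hV.lap.pd i) i hy,
      pd_sum (fun j => contDiffOn_const.mul ((hV.pd j).mul ((hV.pd j).pd i))) i hy] at h
    rw [h]
    refine Finset.sum_congr rfl fun j _ => ?_
    rw [pd_const_mul ((hV.pd j).mul ((hV.pd j).pd i)) i 2 hy,
      pd_mul (hV.pd j) ((hV.pd j).pd i) i hy]
    ring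
  have hl (j : Fin 3) := pd_lap hV j hy
  have e1 : lap V y = ∑ i, pd i (pd i V) y := rfl
  have e2 : lap (lap V) y = ∑ i, pd i (pd i (lap V)) y := rfl
  have h0 := h 0
  have h1 := h 1
  have h2 := h 2
  have l0 := hl 0
  have l1 := hl 1
  have l2 := hl 2
  simp only [Fin.sum_univ_three] at h0 h1 h2 l0 l1 l2 e1 e2 ⊢
  rw [e2]
  linear_combination h0 + h1 + h2 + lap V y * e1 - 2 * pd 0 V y * l0 - 2 * pd 1 V y * l1 -
    2 * pd 2 V y * l2

lemma sum_mul_pd_of_homogeneous (hV : SmoothOff V) (hom : ∀ c : ℝ, 0 < c → ∀ y, V (c • y) = c * V y)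
    (hy : y ≠ 0) : ∑ j, y j * pd j V y = V y := by
  rw [← fderiv_eq_sum_pd]
  have h1 : HasDerivAt (fun c : ℝ => c • y) y 1 := by
    simpa using (hasDerivAt_id (1 : ℝ)).smul_const y
  have h2 : HasDerivAt (fun c : ℝ => V (c • y)) (fderiv ℝ V y y) 1 := by
    have : HasFDerivAt V (fderiv ℝ V y) ((1 : ℝ) • y) := by
      simpa using (SmoothOff.differentiableAt hV hy).hasFDerivAt
    exact this.comp_hasDerivAt 1 h1
  have h3 : HasDerivAt (fun c : ℝ => V (c • y)) (V y) 1 := by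
    have := (hasDerivAt_id (1 : ℝ)).mul_const (V y)
    rw [one_mul] at this
    refine this.congr_of_eventuallyEq ?_
    filter_upwards [lt_mem_nhds (zero_lt_one' ℝ)] with c hc using hom c hc y
  exact h2.unique h3

lemma sum_mul_pd_pd_of_homogeneous (hV : SmoothOff V)
    (hom : ∀ c : ℝ, 0 < c → ∀ y, V (c • y) = c * V y) (i : Fin 3) (hy : y ≠ 0) :
    ∑ j, y j * pd i (pd j V) y = 0 := by
  have h := pd_congr (fun z hz => sum_mul_pd_of_homogeneous hV hom hz) i hy
  rw [pd_sum (fun j => (smoothOff_coord j).mul (hV.pd j)) i hy] at h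
  simp only [pd_mul (smoothOff_coord _) (hV.pd _) i hy, pd_coord, Finset.sum_add_distrib] at h
  simpa using h

/-- Pair the differentiated equation with `y`. The right side vanishes because the Hessian
annihilates `y`, and Euler's identity leaves `V (ΔV + y · ∇ΔV) = 0`. -/
lemma sum_mul_pd_lap (hV : SmoothOff V) (hpos : ∀ y ≠ 0, 0 < V y)
    (heq : ∀ y ≠ 0, V y * lap V y = 1 + ∑ j, pd j V y * pd j V y)
    (hom : ∀ c : ℝ, 0 < c → ∀ y, V (c • y) = c * V y) (hy : y ≠ 0) :
    ∑ i, y i * pd i (lap V) y = -1 * lap V y := by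
  have h (i : Fin 3) := pd_of_mul_lap_eq hV heq i hy
  have e := sum_mul_pd_of_homogeneous hV hom hy
  have f (i : Fin 3) := sum_mul_pd_pd_of_homogeneous hV hom i hy
  have hs (i j : Fin 3) := pd_comm hV i j hy
  have h0 := h 0
  have h1 := h 1
  have h2 := h 2
  have f0 := f 0
  have f1 := f 1
  have f2 := f 2
  simp only [Fin.sum_univ_three, hs 1 0, hs 2 0, hs 2 1] at *
  refine mul_left_cancel₀ (hpos y hy).ne' ?_
  linear_combination y 0 * h0 + y 1 * h1 + y 2 * h2 - lap V y * e + 2 * pd 0 V y * f0 +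
    2 * pd 1 V y * f1 + 2 * pd 2 V y * f2

/-- For a function of degree `-1` the radial terms `y_i y_j F_ij + 2 y · ∇F` of the rotational
Laplacian cancel. -/
lemma rotLaplacian_lap (hV : SmoothOff V) (hpos : ∀ y ≠ 0, 0 < V y)
    (heq : ∀ y ≠ 0, V y * lap V y = 1 + ∑ j, pd j V y * pd j V y)
    (hom : ∀ c : ℝ, 0 < c → ∀ y, V (c • y) = c * V y) (hy : y ≠ 0) :
    rotLaplacian (lap V) y = (∑ i, y i * y i) * lap (lap V) y := by
  have h := sum_mul_pd_lap hV hpos heq hom hy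
  have h' (i : Fin 3) : ∑ j, y j * pd i (pd j (lap V)) y = -2 * pd i (lap V) y := by
    have := pd_congr (fun z hz => sum_mul_pd_lap hV hpos heq hom hz) i hy
    rw [pd_sum (fun j => (smoothOff_coord j).mul (hV.lap.pd j)) i hy,
      pd_const_mul hV.lap i _ hy] at this
    simp only [pd_mul (smoothOff_coord _) (hV.lap.pd _) i hy, pd_coord,
      Finset.sum_add_distrib] at this
    simp at this
    linarith
  rw [rotLaplacian_eq_pd hV.lap hy]
  simp only [h', Fin.sum_univ_three] at h ⊢
  linear_combination 0 * h

/-- The Hessian lives on the plane orthogonal to `y`. Subtracting half its trace times the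
projection to that plane removes `(ΔV)² / 2` from its squared norm; the powers of `|y|²` clear
denominators. -/
lemma sum_sq_traceless (hV : SmoothOff V)
    (hom : ∀ c : ℝ, 0 < c → ∀ y, V (c • y) = c * V y) (hy : y ≠ 0) :
    ∑ i, ∑ j, ((∑ k, y k * y k) * pd i (pd j V) y - 1 / 2 * lap V y *
      ((∑ k, y k * y k) * (if i = j then 1 else 0) - y i * y j)) ^ 2 =
    (∑ k, y k * y k) ^ 2 * ((∑ i, ∑ j, pd i (pd j V) y ^ 2) - 1 / 2 * lap V y ^ 2) := by
  have f (i : Fin 3) := sum_mul_pd_pd_of_homogeneous hV hom i hy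
  have hs (i j : Fin 3) := pd_comm hV i j hy
  have f0 := f 0
  have f1 := f 1
  have f2 := f 2
  simp only [lap, Fin.sum_univ_three, hs 1 0, hs 2 0, hs 2 1] at *
  simp
  linear_combination (y 0 * f0 + y 1 * f1 + y 2 * f2) * (y 0 * y 0 + y 1 * y 1 + y 2 * y 2) *
    (pd 0 (pd 0 V) y + pd 1 (pd 1 V) y + pd 2 (pd 2 V) y)

lemma sum_mul_self_pos (hy : y ≠ 0) : 0 < ∑ k, y k * y k := by
  have := EuclideanSpace.norm_sq_eq y
  simp only [Real.norm_eq_abs, sq_abs] at this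
  simp only [← sq, ← this]
  have := norm_pos_iff.2 hy
  positivity

lemma lap_lap_nonneg (hV : SmoothOff V) (hpos : ∀ y ≠ 0, 0 < V y)
    (heq : ∀ y ≠ 0, V y * lap V y = 1 + ∑ j, pd j V y * pd j V y)
    (hom : ∀ c : ℝ, 0 < c → ∀ y, V (c • y) = c * V y) (hy : y ≠ 0) : 0 ≤ lap (lap V) y := by
  have h1 := mul_lap_lap_eq hV heq hy
  have h2 := sum_sq_traceless hV hom hy
  have h3 : 0 ≤ (∑ k, y k * y k) ^ 2 *
      ((∑ i, ∑ j, pd i (pd j V) y ^ 2) - 1 / 2 * lap V y ^ 2) := by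
    rw [← h2]; positivity
  have h4 := nonneg_of_mul_nonneg_right h3 (pow_pos (sum_mul_self_pos hy) 2)
  exact nonneg_of_mul_nonneg_right (by linarith) (hpos y hy)

/-- On the unit sphere `ΔΔV` is the spherical Laplacian of `ΔV`, so it has integral zero; being
nonnegative and continuous, it vanishes there, and homogeneity extends this to all `y ≠ 0`. -/
lemma lap_lap_eq_zero (hV : SmoothOff V) (hpos : ∀ y ≠ 0, 0 < V y)
    (heq : ∀ y ≠ 0, V y * lap V y = 1 + ∑ j, pd j V y * pd j V y)
    (hom : ∀ c : ℝ, 0 < c → ∀ y, V (c • y) = c * V y) (hy : y ≠ 0) : lap (lap V) y = 0 := by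
  have hc : Continuous fun x : S2 => lap (lap V) x := continuousOn_sphere hV.lap.lap.continuousOn
  have h0 : ∫ x : S2, lap (lap V) x ∂sphereArea = 0 := by
    rw [← integral_rotLaplacian (F := lap V) fun x =>
      (SmoothOff.contDiffAt hV.lap x.coe_ne_zero).of_le (by norm_cast)]
    refine integral_congr_ae (.of_forall fun x => ?_)
    have := S2.sum_sq x
    simp only [rotLaplacian_lap hV hpos heq hom x.coe_ne_zero, Fin.sum_univ_three]
    rw [show (x : E3) 0 * (x : E3) 0 + (x : E3) 1 * (x : E3) 1 + (x : E3) 2 * (x : E3) 2 = 1 by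
      linarith, one_mul]
  rw [integral_eq_zero_iff_of_nonneg (fun x => lap_lap_nonneg hV hpos heq hom x.coe_ne_zero)
    (integrable_sphere hc), Continuous.ae_eq_iff_eq _ hc continuous_zero] at h0
  have hn : ‖y‖ ≠ 0 := norm_ne_zero_iff.2 hy
  have e : ‖y‖ • (rayPoint y hy : E3) = y := by
    rw [coe_rayPoint, smul_smul, mul_inv_cancel₀ hn, one_smul]
  have h1 := lap_smul hn (lap_smul hn (hom ‖y‖ (norm_pos_iff.2 hy))) (rayPoint y hy : E3)
  rw [e] at h1
  rw [h1, show lap (lap V) (rayPoint y hy : E3) = 0 from congr_fun h0 _, mul_zero]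

/-- The only even homogeneous solution is the norm. -/
lemma sq_eq_of_mul_lap_eq (hV : SmoothOff V) (hpos : ∀ y ≠ 0, 0 < V y)
    (heq : ∀ y ≠ 0, V y * lap V y = 1 + ∑ j, pd j V y * pd j V y)
    (hom : ∀ c : ℝ, 0 < c → ∀ y, V (c • y) = c * V y)
    (heven : ∀ y, V (-y) = V y) (hy : y ≠ 0) : V y ^ 2 = ∑ k, y k * y k := by
  -- Equality in the trace inequality: the Hessian is a multiple of the projection orthogonal to
  -- `y`.
  have hB {y : E3} (hy : y ≠ 0) (i j : Fin 3) : (∑ k, y k * y k) * pd i (pd j V) y =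
      1 / 2 * lap V y * ((∑ k, y k * y k) * (if i = j then 1 else 0) - y i * y j) := by
    have h1 := mul_lap_lap_eq hV heq hy
    have h2 := sum_sq_traceless hV hom hy
    rw [lap_lap_eq_zero hV hpos heq hom hy] at h1
    rw [show (∑ i, ∑ j, pd i (pd j V) y ^ 2) - 1 / 2 * lap V y ^ 2 = 0 by linarith, mul_zero,
      Finset.sum_eq_zero_iff_of_nonneg fun i _ => Finset.sum_nonneg fun j _ => sq_nonneg _] at h2
    have h3 := h2 i (Finset.mem_univ i)
    rw [Finset.sum_eq_zero_iff_of_nonneg fun j _ => sq_nonneg _] at h3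
    have h4 := pow_eq_zero_iff two_ne_zero |>.1 (h3 j (Finset.mem_univ j))
    linarith
  -- Inserting the pure trace Hessian into the once differentiated equation shows that `∇ΔV` is
  -- radial.
  have hQ {y : E3} (hy : y ≠ 0) (i : Fin 3) :
      (∑ k, y k * y k) * pd i (lap V) y = -(lap V y * y i) := by
    have h1 := pd_of_mul_lap_eq hV heq i hy
    have h2 := sum_mul_pd_of_homogeneous hV hom hy
    have h3 : ∑ j, 2 * (pd j V y * ((∑ k, y k * y k) * pd i (pd j V) y)) =
        lap V y * ((∑ k, y k * y k) * pd i V y - y i * V y) := by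
      simp only [hB hy, ← h2]
      fin_cases i <;> simp [Fin.sum_univ_three] <;> ring
    have h4 : ∑ j, 2 * (pd j V y * ((∑ k, y k * y k) * pd i (pd j V) y)) =
        (∑ k, y k * y k) * ∑ j, 2 * (pd j V y * pd i (pd j V) y) := by
      rw [Finset.mul_sum]
      exact Finset.sum_congr rfl fun j _ => by ring
    refine mul_left_cancel₀ (hpos y hy).ne' ?_
    linear_combination (∑ k, y k * y k) * h1 + h3 - h4
  have hG (i : Fin 3) : SmoothOff fun y => pd i V y - 1 / 2 * (y i * lap V y) :=
    (hV.pd i).sub (contDiffOn_const.mul ((smoothOff_coord i).mul hV.lap))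
  have hG0 {y : E3} (hy : y ≠ 0) (i j : Fin 3) :
      pd j (fun y => pd i V y - 1 / 2 * (y i * lap V y)) y = 0 := by
    have hs := sum_mul_self_pos hy
    rw [pd_sub (hV.pd i) (contDiffOn_const.mul ((smoothOff_coord i).mul hV.lap)) j hy,
      pd_const_mul ((smoothOff_coord i).mul hV.lap) j _ hy, pd_mul (smoothOff_coord i) hV.lap j hy,
      pd_coord]
    refine mul_left_cancel₀ hs.ne' ?_
    linear_combination hB hy j i - 1 / 2 * y i * hQ hy j
  have hneg : -y ≠ 0 := neg_ne_zero.2 hy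
  -- The vector `∇V - (ΔV / 2) y` is constant on the connected punctured space and odd because `V`
  -- is even; comparing `y` with `-y` gives zero.
  have h1 (i : Fin 3) : pd i V y = 1 / 2 * (y i * lap V y) := by
    have hconn : IsPreconnected ({0}ᶜ : Set E3) :=
      (isConnected_compl_singleton_of_one_lt_rank
        (by rw [← Module.finrank_eq_rank, finrank_euclideanSpace_fin]; norm_num) 0).isPreconnected
    have hk := isOpen_compl_singleton.is_const_of_fderiv_eq_zero hconn
      ((hG i).differentiableOn (by simp)) (fun z hz => by
        ext v
        rw [fderiv_eq_sum_pd]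
        simp only [hG0 (show z ≠ 0 from hz), mul_zero, Finset.sum_const_zero]
        rfl) (show y ∈ ({0}ᶜ : Set E3) from hy)
      (show -y ∈ ({0}ᶜ : Set E3) from hneg)
    have he : ∀ y : E3, V ((-1 : ℝ) • y) = 1 * V y := fun y => by simp [heven]
    have e1 := pd_smul' (by norm_num) he i y
    have e2 := lap_smul (by norm_num) he y
    rw [neg_one_smul] at e1 e2
    simp only [e1, e2, PiLp.neg_apply] at hk
    norm_num at hk
    linarith
  have h2 := sum_mul_pd_of_homogeneous hV hom hy
  have h3 := heq y hy
  have hs := sum_mul_self_pos hy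
  simp only [h1, Fin.sum_univ_three] at h2 h3 hs ⊢
  set s := y 0 * y 0 + y 1 * y 1 + y 2 * y 2 with hsdef
  have h4 : V y = 1 / 2 * s * lap V y := by rw [← h2, hsdef]; ring
  rw [h4] at h3
  -- Euler's identity gives `V = s ΔV / 2`, and the original equation becomes `s (ΔV)² / 2 = 1 + s
  -- (ΔV)² / 4`.
  have h5 : s * lap V y ^ 2 = 4 := by rw [hsdef] at h3 ⊢; linarith
  rw [h4]
  linear_combination s / 4 * h5

end Rigidity

/-- Even solutions on the sphere of the equation of constant curvature one vanish. -/
lemma eq_zero_of_rotLaplacian_eq {W : E3 → ℝ} (hray : RayConst W) (hW : SmoothOff W)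
    (heven : ∀ y, W (-y) = W y)
    (h : ∀ x : S2, rotLaplacian W x = 2 - 2 * Real.exp (W x)) (x : S2) : W x = 0 := by
  set q : E3 → ℝ := fun y => ∑ k, y k * y k with hq
  have hqs : SmoothOff q := ContDiffOn.sum fun k _ => (smoothOff_coord k).mul (smoothOff_coord k)
  have hqn (y : E3) : q y = ‖y‖ ^ 2 := by
    rw [EuclideanSpace.norm_sq_eq]
    simp [hq, sq]
  have hqpos {y : E3} (hy : y ≠ 0) : 0 < q y := sum_mul_self_pos hy
  have hqpd {y : E3} (hy : y ≠ 0) (i : Fin 3) : pd i q y = 2 * y i := by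
    rw [hq, pd_sum (fun k => (smoothOff_coord k).mul (smoothOff_coord k)) i hy]
    simp only [pd_mul (smoothOff_coord _) (smoothOff_coord _) i hy, pd_coord]
    simp [Finset.sum_add_distrib]
    ring
  have hqinv : SmoothOff fun y => (q y)⁻¹ := hqs.inv fun y hy => (hqpos hy).ne'
  -- Here `g = log |y| - W / 2` is the logarithm of the homogeneous function `V`. Since `Δ log |y| =
  -- |y|⁻²` in 3-space, the curvature equation becomes `Δg = e^W |y|⁻²`.
  set g : E3 → ℝ := fun y => 1 / 2 * Real.log (q y) - 1 / 2 * W y with hg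
  have hlog : SmoothOff fun y => Real.log (q y) := hqs.log fun y hy => (hqpos hy).ne'
  have hgs : SmoothOff g := (contDiffOn_const.mul hlog).sub (contDiffOn_const.mul hW)
  have hg1 {y : E3} (hy : y ≠ 0) (i : Fin 3) :
      pd i g y = y i * (q y)⁻¹ - 1 / 2 * pd i W y := by
    rw [hg, pd_sub (contDiffOn_const.mul hlog) (contDiffOn_const.mul hW) i hy,
      pd_const_mul hlog i _ hy, pd_const_mul hW i _ hy, pd_log hqs i hy (hqpos hy).ne', hqpd hy]
    ring
  have hg2 {y : E3} (hy : y ≠ 0) (i : Fin 3) : pd i (pd i g) y =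
      (q y)⁻¹ - 2 * (y i * y i) * ((q y)⁻¹ * (q y)⁻¹) - 1 / 2 * pd i (pd i W) y := by
    rw [pd_congr (fun z hz => hg1 hz i) i hy, pd_sub ((smoothOff_coord i).mul hqinv)
      (contDiffOn_const.mul (hW.pd i)) i hy, pd_const_mul (hW.pd i) i _ hy,
      pd_mul (smoothOff_coord i) hqinv i hy, pd_coord, pd_inv hqs i hy (hqpos hy).ne', hqpd hy]
    simp
    ring
  have hlapW {y : E3} (hy : y ≠ 0) : q y * lap W y = 2 - 2 * Real.exp (W y) := by
    have hn : ‖y‖ ≠ 0 := norm_ne_zero_iff.2 hy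
    have e : ‖y‖ • (rayPoint y hy : E3) = y := by
      rw [coe_rayPoint, smul_smul, mul_inv_cancel₀ hn, one_smul]
    have h1 := lap_smul (F := W) hn (k := 1) (fun z => by
      rw [hray _ (norm_pos_iff.2 hy), one_mul]) (rayPoint y hy : E3)
    have h2 := hray.laplacian_eq (rayPoint y hy)
      ((SmoothOff.contDiffAt hW (rayPoint y hy).coe_ne_zero).of_le (by norm_cast))
    rw [laplacian_eq_sum_fderiv, h] at h2
    simp only [← pd_pd hW _ _ (rayPoint y hy).coe_ne_zero] at h2
    have h3 : W (rayPoint y hy : E3) = W y := by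
      rw [← hray _ (norm_pos_iff.2 hy), e]
    rw [e, show lap W (rayPoint y hy : E3) = _ from h2, h3] at h1
    rw [h1, hqn]
    field_simp
  have hlapg {y : E3} (hy : y ≠ 0) : lap g y = Real.exp (W y) * (q y)⁻¹ := by
    have h1 := hlapW hy
    have hqy : q y = y 0 * y 0 + y 1 * y 1 + y 2 * y 2 := by simp [hq, Fin.sum_univ_three]
    have hq0 := (hqpos hy).ne'
    have e : lap g y = 3 * (q y)⁻¹ - 2 * q y * ((q y)⁻¹ * (q y)⁻¹) - 1 / 2 * lap W y := by
      simp only [lap, hg2 hy, Fin.sum_univ_three]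
      rw [show 2 * q y = 2 * (y 0 * y 0) + 2 * (y 1 * y 1) + 2 * (y 2 * y 2) by rw [hqy]; ring]
      ring
    rw [e]
    field_simp
    linarith
  set V : E3 → ℝ := fun y => ‖y‖ * Real.exp (-(1 / 2) * W y) with hVdef
  have hVg (y : E3) (hy : y ≠ 0) : V y = Real.exp (g y) := by
    have hn := norm_pos_iff.2 hy
    simp only [hVdef, hg, hqn]
    rw [Real.log_pow, sub_eq_add_neg, Real.exp_add, ← neg_mul]
    congr 1
    rw [← Real.exp_log hn]
    simp
  have hV : SmoothOff V := ContDiffOn.congr hgs.exp hVg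
  have hpos (y : E3) (hy : y ≠ 0) : 0 < V y := by rw [hVg y hy]; exact Real.exp_pos _
  have hV1 {y : E3} (hy : y ≠ 0) (i : Fin 3) : pd i V y = V y * pd i g y := by
    rw [pd_congr hVg i hy, hVg y hy, pd_exp hgs i hy]
  have hVsq (y : E3) : V y * V y = q y * Real.exp (-W y) := by
    rw [hqn, show -W y = -(1 / 2) * W y + -(1 / 2) * W y by ring, Real.exp_add]
    simp only [hVdef]
    ring
  -- From `V = e^g`, `V ΔV = |∇V|² + V² Δg`, and `V² = |y|² e^{-W}` makes the last term equal to
  -- `1`.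
  have heq (y : E3) (hy : y ≠ 0) : V y * lap V y = 1 + ∑ j, pd j V y * pd j V y := by
    have e (i : Fin 3) : pd i (pd i V) y =
        V y * pd i g y * pd i g y + V y * pd i (pd i g) y := by
      rw [pd_congr (fun z hz => hV1 hz i) i hy, pd_mul hV (hgs.pd i) i hy, hV1 hy]
    have e2 : V y * V y * lap g y = 1 := by
      rw [hlapg hy, hVsq, Real.exp_neg]
      have := (hqpos hy).ne'
      field_simp
    simp only [lap, e, hV1 hy, Fin.sum_univ_three] at e2 ⊢
    linear_combination e2
  have hom (c : ℝ) (hc : 0 < c) (y : E3) : V (c • y) = c * V y := by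
    simp only [hVdef, hray c hc y, norm_smul, Real.norm_of_nonneg hc.le, mul_assoc]
  have hVeven (y : E3) : V (-y) = V y := by simp only [hVdef, norm_neg, heven]
  have hfin := sq_eq_of_mul_lap_eq hV hpos heq hom hVeven x.coe_ne_zero
  have hfin : V x ^ 2 = q x := hfin
  rw [sq, hVsq, hqn, S2.norm_coe] at hfin
  norm_num at hfin
  exact hfin

end

noncomputable section

open Filter Topology
open scoped ContDiff

/-! ### Metrics of constant curvature -/

lemma coe_neg_S2 (x : S2) : ((-x : S2) : E3) = -(x : E3) := rfl

lemma ae_neg {p : S2 → Prop} (h : ∀ᵐ x ∂sphereArea, p x) : ∀ᵐ x ∂sphereArea, p (-x) := by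
  have hL := measurePreserving_sphereMap (LinearIsometryEquiv.neg ℝ)
  have e : sphereMap (LinearIsometryEquiv.neg ℝ) = fun x => -x := by
    ext1 x; ext1; simp
  rw [e] at hL
  exact hL.quasiMeasurePreserving.ae h

variable {μ : SignedMeasure S2} {u : RP2 → EReal}

/-- Among potentials, only the zero potential gives constant curvature. -/
lemma HasConstantGaussianCurvature.measure_eq_zero (hμ : μ univ = 0)
    (hu : ∀ x : S2, u (toRP2 x) = greenPotential μ x) (h : HasConstantGaussianCurvature u) :
    μ = 0 := by
  obtain ⟨K, κ, hK, hmass, hae⟩ := h.exists_integral_eq hμ hu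
  have hm := measurable_lift hu
  have hpi := Real.pi_pos
  set f : S2 → ℝ := fun x => (u (toRP2 x)).exp.toReal with hf
  have hfm : Measurable f := (measurable_exp_lift hm).ennreal_toReal
  have hfi : Integrable f sphereArea :=
    integrable_toReal_of_lintegral_ne_top (measurable_exp_lift hm).aemeasurable
      (lintegral_exp_ne_top hm h.1)
  obtain ⟨W, hray, hWn, hWlap, hfW⟩ := exists_smooth_of_integral_eq hfm
    (fun x => ENNReal.toReal_nonneg) hfi (a := K / (2 * Real.pi)) (b := κ) (by positivity) (by
      filter_upwards [hae] with x hx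
      refine ⟨hx.1, ?_⟩
      conv_lhs => rw [hf]
      simp only
      rw [hx.2, EReal.exp_coe, ENNReal.toReal_ofReal (Real.exp_pos _).le])
  have hWs : SmoothOff W := contDiffOn_infty.2 hWn
  have hWc : Continuous fun x : S2 => W x := continuousOn_sphere hWs.continuousOn
  -- This is where the projective plane enters: `u` takes the same value at antipodal points, and
  -- continuity upgrades the almost everywhere identity.
  have hS (x : S2) : W (-(x : E3)) = W x := by
    have hc' : Continuous fun x : S2 => W (-(x : E3)) :=
      hWs.continuousOn.comp_continuous continuous_subtype_val.neg
        fun x => neg_ne_zero.2 x.coe_ne_zero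
    have hae : (fun x : S2 => W (-(x : E3))) =ᵐ[sphereArea] fun x : S2 => W x := by
      filter_upwards [hfW, ae_neg hfW] with x h1 h2
      simp only [hf, toRP2_neg, coe_neg_S2] at h1 h2
      exact Real.exp_injective (h2.symm.trans h1)
    exact congr_fun ((Continuous.ae_eq_iff_eq _ hc' hWc).1 hae) x
  have heven (y : E3) : W (-y) = W y := by
    rcases eq_or_ne y 0 with rfl | hy
    · rw [neg_zero]
    have hn := inv_pos.2 (norm_pos_iff.2 hy)
    rw [← hray _ hn y, ← hray _ hn (-y), smul_neg]
    exact hS (rayPoint y hy)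
  -- Adding `log K` normalizes the curvature to one: Gauss–Bonnet gives the constant term `2`, and
  -- `4π a = 2 K`.
  have hrot (x : S2) : rotLaplacian (fun y => W y + Real.log K) x =
      2 - 2 * Real.exp (W x + Real.log K) := by
    have e : rotLaplacian (fun y => W y + Real.log K) x = rotLaplacian W x := by
      have e1 (i j : Fin 3) : rotDeriv i j (fun y => W y + Real.log K) = rotDeriv i j W := by
        ext y; simp only [rotDeriv, fderiv_add_const]
      simp only [rotLaplacian, e1]
    rw [e, hWlap, Real.exp_add, Real.exp_log hK]
    have : K / (2 * Real.pi) * ∫ x, f x ∂sphereArea = 2 := by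
      rw [div_mul_eq_mul_div, hmass]; field_simp; norm_num
    rw [this]
    field_simp
    ring
  have hzero := eq_zero_of_rotLaplacian_eq (W := fun y => W y + Real.log K)
    (fun c hc y => by simp only [hray c hc y]) (hWs.add contDiffOn_const)
    (fun y => by simp only [heven]) hrot
  refine h.eq_zero_of_ae_const hμ hu (c := Real.exp (-Real.log K)) (Real.exp_pos _).le ?_
  filter_upwards [hfW, ae_exp_lt_top hm h.1] with x hx hx'
  have hz : W x = -Real.log K := by linarith [hzero x]
  rw [← hz, ← hx, ENNReal.ofReal_toReal hx'.ne]

end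

noncomputable section

open Filter Topology

/-! ### Finiteness of the systole -/

instance neBot_ae_sphereArea : NeBot (ae sphereArea) := by
  rw [ae_neBot]
  intro h0
  have := sphereArea_univ
  rw [h0] at this
  simp at this
  linarith [Real.pi_pos]

open scoped Pointwise in
lemma sphereArea_greatCircle (p : S2) :
    sphereArea {x : S2 | inner ℝ (x : E3) (p : E3) = 0} = 0 := by
  have hms : MeasurableSet {x : S2 | inner ℝ (x : E3) (p : E3) = 0} := by
    have : Continuous fun x : S2 => inner ℝ (x : E3) (p : E3) := by fun_prop
    exact this.measurable (measurableSet_singleton 0)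
  rw [sphereArea, Measure.toSphere_apply' _ hms]
  have hsub : (Ioo (0 : ℝ) 1 • (Subtype.val '' {x : S2 | inner ℝ (x : E3) (p : E3) = 0}) : Set E3) ⊆
      ((ℝ ∙ (p : E3))ᗮ : Submodule ℝ E3) := by
    rintro _ ⟨r, _, _, ⟨q, hq, rfl⟩, rfl⟩
    refine Submodule.smul_mem _ _ (Submodule.mem_orthogonal_singleton_iff_inner_left.2 hq)
  have htop : (ℝ ∙ (p : E3))ᗮ ≠ ⊤ := by
    intro h
    have h1 : (p : E3) ∈ (ℝ ∙ (p : E3))ᗮ := h ▸ Submodule.mem_top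
    rw [Submodule.mem_orthogonal_singleton_iff_inner_left, S2.inner_self] at h1
    exact one_ne_zero h1
  rw [measure_mono_null hsub (Measure.addHaar_submodule _ _ htop), mul_zero]

/-- For fixed `y`, the poles `p` orthogonal to `y` form a great circle of zero area. By Fubini
almost every pole works. -/
lemma exists_greatCircle_null (ν : Measure S2) [IsFiniteMeasure ν] :
    ∃ p : S2, ν {y | inner ℝ (p : E3) (y : E3) = 0} = 0 := by
  have hms : MeasurableSet {q : S2 × S2 | inner ℝ (q.1 : E3) (q.2 : E3) = 0} := by
    have : Continuous fun q : S2 × S2 => inner ℝ (q.1 : E3) (q.2 : E3) := by fun_prop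
    exact this.measurable (measurableSet_singleton 0)
  have h : (sphereArea.prod ν) {q : S2 × S2 | inner ℝ (q.1 : E3) (q.2 : E3) = 0} = 0 := by
    rw [Measure.prod_apply_symm hms]
    have (y : S2) : sphereArea ((fun x => (x, y)) ⁻¹'
        {q : S2 × S2 | inner ℝ (q.1 : E3) (q.2 : E3) = 0}) = 0 := sphereArea_greatCircle y
    simp only [this, lintegral_zero]
  have h' := Measure.ae_ae_of_ae_prod (measure_eq_zero_iff_ae_notMem.1 h)
  obtain ⟨p, hp⟩ := h'.exists
  exact ⟨p, measure_eq_zero_iff_ae_notMem.2 hp⟩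

lemma exists_band_measure_le (ν : Measure S2) [IsFiniteMeasure ν] {ε : ℝ≥0∞} (hε : 0 < ε) :
    ∃ (p : S2) (δ : ℝ), 0 < δ ∧ ν {y | |inner ℝ (p : E3) (y : E3)| < δ} ≤ ε := by
  obtain ⟨p, hp⟩ := exists_greatCircle_null ν
  have hc : Continuous fun y : S2 => |inner ℝ (p : E3) (y : E3)| := by fun_prop
  set s : ℕ → Set S2 := fun n => {y | |inner ℝ (p : E3) (y : E3)| < 1 / ((n : ℝ) + 1)}
  have hs : Antitone s := fun m n hmn y hy =>
    lt_of_lt_of_le hy (one_div_le_one_div_of_le (by positivity : 0 < (m : ℝ) + 1)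
      (by exact_mod_cast Nat.succ_le_succ hmn))
  have hi : ⋂ n, s n = {y : S2 | inner ℝ (p : E3) (y : E3) = 0} := by
    ext y
    simp only [mem_iInter]
    constructor
    · intro h
      by_contra h0
      obtain ⟨n, hn⟩ := exists_nat_one_div_lt (abs_pos.2 (show inner ℝ (p : E3) (y : E3) ≠ 0 from h0))
      exact lt_asymm hn (h n)
    · intro h n
      have h : inner ℝ (p : E3) (y : E3) = 0 := h
      change |inner ℝ (p : E3) (y : E3)| < _
      rw [h, abs_zero]
      positivity
  have ht := tendsto_measure_iInter_atTop (μ := ν) (s := s)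
    (fun n => (measurableSet_lt hc.measurable measurable_const).nullMeasurableSet) hs
    ⟨0, measure_ne_top _ _⟩
  rw [hi, hp] at ht
  obtain ⟨n, hn⟩ := (ht.eventually (gt_mem_nhds hε)).exists
  exact ⟨p, 1 / ((n : ℝ) + 1), by positivity, hn.le⟩

lemma integrable_invSqrtKernel_prod (ν : Measure S2) [IsFiniteMeasure ν] :
    Integrable (fun q : S2 × S2 => invSqrtKernel q.1 q.2) (sphereArea.prod ν) := by
  have hm : AEStronglyMeasurable (fun q : S2 × S2 => invSqrtKernel q.1 q.2) (sphereArea.prod ν) :=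
    measurable_invSqrtKernel_uncurry.aestronglyMeasurable
  rw [integrable_prod_iff' hm]
  refine ⟨.of_forall fun y => ?_, ?_⟩
  · simpa only [invSqrtKernel_comm _ y] using integrable_invSqrtKernel y
  · refine (integrable_const (16 * Real.pi)).mono' hm.norm.prod_swap.integral_prod_right'
      (.of_forall fun y => ?_)
    simp only [Real.norm_of_nonneg (invSqrtKernel_nonneg _ _), invSqrtKernel_comm _ y]
    rw [Real.norm_of_nonneg (integral_nonneg fun x => invSqrtKernel_nonneg _ _)]
    exact integral_invSqrtKernel_le y

/-- The height `⟨p, ·⟩` is 1-Lipschitz, so such points are at chordal distance at least `δ / 2`. -/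
lemma logKernel_le_of_band {p x y : S2} {δ : ℝ} (hδ : 0 < δ)
    (hx : |inner ℝ (p : E3) (x : E3)| < δ / 2) (hy : ¬ |inner ℝ (p : E3) (y : E3)| < δ) :
    logKernel x y ≤ |Real.log (δ ^ 2 / 8)| := by
  have h1 : δ / 2 ≤ ‖(x : E3) - y‖ := by
    have h2 := abs_real_inner_le_norm (p : E3) ((x : E3) - y)
    rw [S2.norm_coe, one_mul, inner_sub_right] at h2
    have h3 := abs_sub_abs_le_abs_sub (inner ℝ (p : E3) (y : E3)) (inner ℝ (p : E3) (x : E3))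
    rw [abs_sub_comm] at h3
    linarith [not_lt.1 hy]
  have h2 : ‖(x : E3) - y‖ ^ 2 = 2 * (1 - inner ℝ (x : E3) (y : E3)) := by
    rw [norm_sub_sq_real, S2.norm_coe, S2.norm_coe]; ring
  have h3 : (δ / 2) ^ 2 ≤ ‖(x : E3) - y‖ ^ 2 := by gcongr
  rw [logKernel]
  have h4 := Real.log_le_log (by positivity) (show δ ^ 2 / 8 ≤ 1 - inner ℝ (x : E3) (y : E3) by
    linarith)
  linarith [neg_abs_le (Real.log (δ ^ 2 / 8))]

section

variable {μ : SignedMeasure S2} {u : RP2 → EReal}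

/-- The positive mass outside `s` sees a bounded kernel, and the negative part contributes at most
its mass since the kernel is at least `-1`. Jensen's inequality with weight `1 / (4π)` handles the
positive mass in `s`. -/
lemma exp_half_logPotential_le {x : S2} {s : Set S2} (hs : MeasurableSet s) {c : ℝ} (hc0 : 0 ≤ c)
    (hc : ∀ y ∉ s, logKernel x y ≤ c)
    (hmass : μ.toJordanDecomposition.posPart.real s ≤ 4 * Real.pi)
    (hp : Integrable (logKernel x) μ.toJordanDecomposition.posPart)
    (hn : Integrable (logKernel x) μ.toJordanDecomposition.negPart)
    (hi : Integrable (invSqrtKernel x) μ.toJordanDecomposition.posPart) :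
    Real.exp (1 / 2 * logPotential μ x) ≤
      Real.exp (1 / (8 * Real.pi) * (c * μ.toJordanDecomposition.posPart.real univ +
        μ.toJordanDecomposition.negPart.real univ)) *
      (1 + 1 / (4 * Real.pi) * ∫ y, (invSqrtKernel x y + 1) ∂μ.toJordanDecomposition.posPart) := by
  set P := μ.toJordanDecomposition.posPart
  set N := μ.toJordanDecomposition.negPart
  have hpi := Real.pi_pos
  have h1 : -∫ y, logKernel x y ∂N ≤ N.real univ := by
    rw [← integral_neg]
    calc _ ≤ ∫ _, (1 : ℝ) ∂N :=
          integral_mono hn.neg (integrable_const 1) fun y => by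
            simp only [Pi.neg_apply]; linarith [neg_one_le_logKernel x y]
      _ = _ := by simp
  have h2 : ∫ y in sᶜ, logKernel x y ∂P ≤ c * P.real univ := by
    calc _ ≤ ∫ _ in sᶜ, c ∂P :=
          setIntegral_mono_on hp.integrableOn (integrable_const c).integrableOn hs.compl
            fun y hy => hc y hy
      _ ≤ _ := by
          rw [setIntegral_const, smul_eq_mul, mul_comm]
          exact mul_le_mul_of_nonneg_left (measureReal_mono (subset_univ _)) hc0
  have h3 := integral_add_compl hs hp
  have hwi : Integrable (fun _ : S2 => 1 / (4 * Real.pi)) (P.restrict s) := integrable_const _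
  have hexp : Integrable (fun y => 1 / (4 * Real.pi) * Real.exp (1 / 2 * logKernel x y))
      (P.restrict s) := by
    refine Integrable.const_mul ((hi.restrict.add (integrable_const 1)).mono'
      (Real.measurable_exp.comp ((measurable_logKernel x).const_mul _)).aestronglyMeasurable
      (.of_forall fun y => ?_)) _
    rw [Function.comp_apply, Real.norm_of_nonneg (Real.exp_pos _).le]
    exact exp_half_logKernel_le x y
  have hJ := exp_integral_le (ν := P.restrict s) (w := fun _ => 1 / (4 * Real.pi))
    (g := fun y => 1 / 2 * logKernel x y) hwi (fun _ => by positivity) (by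
      rw [integral_const, smul_eq_mul, measureReal_restrict_apply_univ]
      rw [mul_one_div, div_le_one (by positivity)]
      exact hmass) ((hp.restrict.const_mul (1 / 2)).const_mul _) hexp
  rw [integral_const_mul, integral_const_mul] at hJ
  have h4 : ∫ y in s, 1 / (4 * Real.pi) * Real.exp (1 / 2 * logKernel x y) ∂P ≤
      1 / (4 * Real.pi) * ∫ y, (invSqrtKernel x y + 1) ∂P := by
    rw [integral_const_mul]
    refine mul_le_mul_of_nonneg_left ?_ (by positivity)
    have hint : Integrable (fun y => Real.exp (1 / 2 * logKernel x y)) (P.restrict s) := by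
      have := hexp.const_mul (4 * Real.pi)
      refine this.congr (.of_forall fun y => ?_)
      simp only
      field_simp
    calc _ ≤ ∫ y in s, (invSqrtKernel x y + 1) ∂P :=
          integral_mono hint (hi.restrict.add (integrable_const 1)) (exp_half_logKernel_le x)
      _ ≤ _ := setIntegral_le_integral (hi.add (integrable_const 1))
          (.of_forall fun y => add_nonneg (invSqrtKernel_nonneg x y) zero_le_one)
  have e : 1 / 2 * logPotential μ x ≤
      1 / (8 * Real.pi) * (c * P.real univ + N.real univ) +
        1 / (4 * Real.pi) * (1 / 2 * ∫ y in s, logKernel x y ∂P) := by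
    have h5 : (∫ y, logKernel x y ∂P) - ∫ y, logKernel x y ∂N ≤
        c * P.real univ + N.real univ + ∫ y in s, logKernel x y ∂P := by linarith
    have h6 := mul_le_mul_of_nonneg_left h5 (show 0 ≤ 1 / (8 * Real.pi) by positivity)
    unfold logPotential
    calc _ = 1 / (8 * Real.pi) * ((∫ y, logKernel x y ∂P) - ∫ y, logKernel x y ∂N) := by
          field_simp; ring
      _ ≤ _ := h6
      _ = _ := by field_simp; ring
  calc _ ≤ _ := Real.exp_le_exp.2 e
    _ = _ := Real.exp_add _ _
    _ ≤ _ := mul_le_mul_of_nonneg_left (by linarith) (Real.exp_pos _).le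

lemma exists_band_lintegral_lt_top (hμ : μ univ = 0)
    (hu : ∀ x : S2, u (toRP2 x) = greenPotential μ x) :
    ∃ (p : S2) (δ : ℝ), 0 < δ ∧
      ∫⁻ x in {x : S2 | |inner ℝ (p : E3) (x : E3)| < δ}, (u (toRP2 x)).exp ^ (1 / 2 : ℝ)
        ∂sphereArea < ∞ := by
  -- The coefficient in `u / 2` is `1 / (8π) = (1 / (4π)) (1 / 2)`. Mass at most `4π` lets `1 /
  -- (4π)` serve as a Jensen weight, leaving the integrable power `exp (k / 2)`.
  obtain ⟨p, δ, hδ, hmass⟩ := exists_band_measure_le μ.toJordanDecomposition.posPart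
    (ε := ENNReal.ofReal (4 * Real.pi)) (by simp [Real.pi_pos])
  -- Halving the band keeps its points away from the measure outside the original one.
  refine ⟨p, δ / 2, by positivity, ?_⟩
  set P := μ.toJordanDecomposition.posPart with hP
  set N := μ.toJordanDecomposition.negPart with hN
  have hband (r : ℝ) : MeasurableSet {y : S2 | |inner ℝ (p : E3) (y : E3)| < r} := by
    have hc : Continuous fun y : S2 => |inner ℝ (p : E3) (y : E3)| := by fun_prop
    exact measurableSet_lt hc.measurable measurable_const
  set g : S2 → ℝ := fun x => Real.exp (1 / (8 * Real.pi) * (|Real.log (δ ^ 2 / 8)| * P.real univ +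
    N.real univ)) * (1 + 1 / (4 * Real.pi) * ∫ y, (invSqrtKernel x y + 1) ∂P) with hg
  have hK := integrable_invSqrtKernel_prod P
  have hgi : Integrable g sphereArea := by
    have h2 : Integrable (fun q : S2 × S2 => invSqrtKernel q.1 q.2 + 1) (sphereArea.prod P) :=
      hK.add (integrable_const 1)
    exact ((integrable_const 1).add (h2.integral_prod_left.const_mul _)).const_mul _
  calc _ ≤ ∫⁻ x in {x : S2 | |inner ℝ (p : E3) (x : E3)| < δ / 2}, ENNReal.ofReal (g x)
        ∂sphereArea := by
        refine lintegral_mono_ae ((ae_restrict_iff' (hband _)).2 ?_)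
        filter_upwards [ae_greenPotential_eq hμ, ae_integrable_logKernel P,
          ae_integrable_logKernel N, hK.prod_right_ae] with x h1 h2 h3 h4 hx
        rw [hu, h1, EReal.exp_coe, ENNReal.ofReal_rpow_of_pos (Real.exp_pos _), ← Real.exp_mul,
          mul_comm]
        exact ENNReal.ofReal_le_ofReal (exp_half_logPotential_le (hband δ) (abs_nonneg _)
          (fun y hy => logKernel_le_of_band hδ hx hy)
          (ENNReal.toReal_le_of_le_ofReal (by positivity) hmass) h2 h3 h4)
    _ ≤ ∫⁻ x, ENNReal.ofReal (g x) ∂sphereArea := setLIntegral_le_lintegral _ _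
    _ < ∞ := hgi.lintegral_lt_top

/-- The points `x`, `y` whose great circle stays in a band around a given great circle. -/
def bandPairs (p : S2) (δ : ℝ) : Set (S2 × S2) :=
  {q | |inner ℝ (p : E3) (q.1 : E3)| * ‖orthPart q.1 q.2‖ + |inner ℝ (p : E3) (orthPart q.1 q.2)| <
    δ * ‖orthPart q.1 q.2‖}

lemma isOpen_bandPairs (p : S2) (δ : ℝ) : IsOpen (bandPairs p δ) := by
  have h := continuous_orthPart
  refine isOpen_lt ?_ (continuous_const.mul h.norm)
  have h1 : Continuous fun q : S2 × S2 => |inner ℝ (p : E3) (q.1 : E3)| := by fun_prop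
  exact (h1.mul h.norm).add (continuous_const.inner h).abs

/-- Two orthogonal vectors, both orthogonal to `p`, span the central great circle. Since the set is
open, it then has positive area. -/
lemma nonempty_bandPairs (p : S2) {δ : ℝ} (hδ : 0 < δ) : (bandPairs p δ).Nonempty := by
  let v (i : Fin 3) : S2 := ⟨stdVec i, by simp⟩
  have hv (i : Fin 3) : (v i : E3) = stdVec i := rfl
  obtain ⟨L, rfl⟩ := exists_sphereMap_eq (v 0) p
  refine ⟨(sphereMap L (v 1), sphereMap L (v 2)), ?_⟩
  have ho : orthPart (v 1) (v 2) = stdVec 2 := by simp [orthPart, hv, stdVec_apply]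
  simp only [bandPairs, mem_ofPred_eq, orthPart_sphereMap, coe_sphereMap, ho, hv, L.inner_map_map,
    L.norm_map, norm_stdVec, inner_stdVec, stdVec_apply]
  simpa using hδ

lemma orthPart_ne_zero_of_mem_bandPairs {p : S2} {δ : ℝ} {q : S2 × S2} (hq : q ∈ bandPairs p δ) :
    orthPart q.1 q.2 ≠ 0 := by
  intro h
  simp [bandPairs, h] at hq

lemma abs_inner_circlePoint_lt {p : S2} {δ : ℝ} {q : S2 × S2} (hq : q ∈ bandPairs p δ) (t : ℝ) :
    |inner ℝ (p : E3) (circlePoint t q.1 q.2 : E3)| < δ := by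
  have h0 := orthPart_ne_zero_of_mem_bandPairs hq
  have hn := norm_pos_iff.2 h0
  have hq : |inner ℝ (p : E3) (q.1 : E3)| * ‖orthPart q.1 q.2‖ +
    |inner ℝ (p : E3) (orthPart q.1 q.2)| < δ * ‖orthPart q.1 q.2‖ := hq
  rw [coe_circlePoint h0, inner_add_right, inner_smul_right, inner_smul_right, inner_smul_right]
  refine lt_of_mul_lt_mul_right (a := ‖orthPart q.1 q.2‖) (lt_of_le_of_lt ?_ hq) hn.le
  refine (mul_le_mul_of_nonneg_right (abs_add_le _ _) hn.le).trans ?_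
  rw [abs_mul, abs_mul, abs_mul, abs_inv, abs_norm, add_mul]
  have h1 := Real.abs_cos_le_one t
  have h2 := Real.abs_sin_le_one t
  refine add_le_add (mul_le_mul_of_nonneg_right (mul_le_of_le_one_left (abs_nonneg _) h1) hn.le) ?_
  rw [mul_assoc, mul_right_comm, inv_mul_cancel₀ hn.ne', one_mul]
  exact mul_le_of_le_one_left (abs_nonneg _) h2

/-- The systole of a potential is finite. -/
lemma systole_lt_top (hμ : μ univ = 0) (hu : ∀ x : S2, u (toRP2 x) = greenPotential μ x) :
    systole u < ∞ := by
  obtain ⟨p, δ, hδ, hfin⟩ := exists_band_lintegral_lt_top hμ hu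
  set B : Set S2 := {x : S2 | |inner ℝ (p : E3) (x : E3)| < δ} with hB
  have hBm : MeasurableSet B := by
    have hc : Continuous fun y : S2 => |inner ℝ (p : E3) (y : E3)| := by fun_prop
    exact measurableSet_lt hc.measurable measurable_const
  rw [← lintegral_indicator hBm] at hfin
  set f : S2 → ℝ≥0∞ := B.indicator fun x => (u (toRP2 x)).exp ^ (1 / 2 : ℝ) with hf
  have hfm : Measurable f := (measurable_exp_half (measurable_lift hu)).indicator hBm
  have hmeas : Measurable fun q : (S2 × S2) × ℝ => f (circlePoint (Real.pi * q.2) q.1.1 q.1.2) *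
      ENNReal.ofReal Real.pi := by
    refine (hfm.comp ?_).mul_const _
    exact measurable_circlePoint_uncurry.comp
      (f := fun q : (S2 × S2) × ℝ => (Real.pi * q.2, q.1.1, q.1.2)) (by fun_prop)
  have hlow : systole u * (sphereArea.prod sphereArea) (bandPairs p δ) ≤
      ∫⁻ q : S2 × S2, (∫⁻ t in Icc (0 : ℝ) 1, f (circlePoint (Real.pi * t) q.1 q.2) *
        ENNReal.ofReal Real.pi) ∂sphereArea.prod sphereArea := by
    calc _ = ∫⁻ _ in bandPairs p δ, systole u ∂sphereArea.prod sphereArea :=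
          (setLIntegral_const _ _).symm
      _ ≤ ∫⁻ q in bandPairs p δ, (∫⁻ t in Icc (0 : ℝ) 1, f (circlePoint (Real.pi * t) q.1 q.2) *
          ENNReal.ofReal Real.pi) ∂sphereArea.prod sphereArea := by
          refine setLIntegral_mono' (isOpen_bandPairs p δ).measurableSet fun q hq => ?_
          have h0 := orthPart_ne_zero_of_mem_bandPairs hq
          refine (systole_le_curveLength_circlePoint u h0).trans_eq ?_
          rw [curveLength_circlePoint u h0]
          refine lintegral_congr fun t => ?_
          rw [hf, indicator_of_mem (show circlePoint (Real.pi * t) q.1 q.2 ∈ B from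
            abs_inner_circlePoint_lt hq _)]
      _ ≤ _ := setLIntegral_le_lintegral _ _
  rw [lintegral_lintegral_swap hmeas.aemeasurable] at hlow
  have hinner (t : ℝ) : ∫⁻ q : S2 × S2, f (circlePoint (Real.pi * t) q.1 q.2) *
      ENNReal.ofReal Real.pi ∂sphereArea.prod sphereArea =
      ENNReal.ofReal (4 * Real.pi) * (∫⁻ x, f x ∂sphereArea) * ENNReal.ofReal Real.pi := by
    have hm : Measurable fun q : S2 × S2 => f (circlePoint (Real.pi * t) q.1 q.2) :=
      hfm.comp (measurable_circlePoint _)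
    rw [lintegral_mul_const _ hm, lintegral_circlePoint _ hfm]
  simp only [hinner, lintegral_const, Measure.restrict_apply MeasurableSet.univ, univ_inter,
    Real.volume_Icc, sub_zero, ENNReal.ofReal_one, mul_one] at hlow
  have hpos : (sphereArea.prod sphereArea) (bandPairs p δ) ≠ 0 :=
    ((isOpen_bandPairs p δ).measure_pos _ (nonempty_bandPairs p hδ)).ne'
  by_contra htop
  rw [not_lt_top_iff.1 htop, ENNReal.top_mul hpos, top_le_iff] at hlow
  exact ENNReal.mul_ne_top (ENNReal.mul_ne_top ENNReal.ofReal_ne_top hfin.ne)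
    ENNReal.ofReal_ne_top hlow

end

end

noncomputable section

open Filter Topology

/-! ### The main theorem -/

variable {μ : SignedMeasure S2} {u : RP2 → EReal}

lemma area_of_eq_zero (hu : ∀ x : S2, u (toRP2 x) = 0) : area u = ENNReal.ofReal (2 * Real.pi) := by
  rw [area_eq (by simp only [hu]; exact measurable_const)]
  simp only [hu, EReal.exp_zero, lintegral_const, sphereArea_univ, one_mul]
  rw [show (2⁻¹ : ℝ≥0∞) = ENNReal.ofReal 2⁻¹ by
    rw [ENNReal.ofReal_inv_of_pos two_pos]; simp, ← ENNReal.ofReal_mul (by norm_num)]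
  congr 1
  ring

/-- A half great circle attains `π`; every noncontractible loop lifts to a path joining antipodal
points. -/
lemma systole_of_eq_zero (hu : ∀ x : S2, u (toRP2 x) = 0) :
    systole u = ENNReal.ofReal Real.pi := by
  refine le_antisymm ?_ ?_
  · let v (i : Fin 3) : S2 := ⟨stdVec i, by simp⟩
    have ho : orthPart (v 0) (v 1) ≠ 0 := by
      have : orthPart (v 0) (v 1) = stdVec 1 := by simp [orthPart, v, stdVec_apply]
      rw [this, ← norm_ne_zero_iff, norm_stdVec]
      exact one_ne_zero
    refine (systole_le_curveLength_circlePoint u ho).trans_eq ?_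
    rw [curveLength_circlePoint u ho]
    simp [hu]
  · refine le_iInf fun x => le_iInf fun c => le_iInf fun hc => le_iInf fun γ => le_iInf fun hγ => ?_
    have h := pi_le_length_of_antipodal hγ.1 (antipodal_of_not_homotopic_refl hc hγ)
    simpa [curveLength, hu] using h

/-- A metric with constant conformal factor has constant curvature. -/
lemma hasConstantGaussianCurvature_of_ae_const {c : ℝ} (hc : 0 < c) (hA : area u ≠ ∞)
    (h : ∀ᵐ x ∂sphereArea, u (toRP2 x) = (Real.log c : EReal)) :
    HasConstantGaussianCurvature u := by
  refine ⟨hA, ?_, ?_, c⁻¹, fun φ hφ => ?_⟩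
  · filter_upwards [h] with x hx
    rw [hx]
    exact ⟨EReal.coe_ne_top _, EReal.coe_ne_bot _⟩
  · refine (integrable_const (Real.log c)).congr ?_
    filter_upwards [h] with x hx
    rw [hx, EReal.toReal_coe]
  · have e1 : ∫ x, (u (toRP2 x)).toReal * sphereLaplacian φ x ∂sphereArea = 0 := by
      calc _ = ∫ x, Real.log c * sphereLaplacian φ x ∂sphereArea := by
            refine integral_congr_ae ?_
            filter_upwards [h] with x hx
            rw [hx, EReal.toReal_coe]
        _ = 0 := by rw [integral_const_mul, integral_sphereLaplacian hφ, mul_zero]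
    have e2 : ∫ x : S2, φ x * (u (toRP2 x)).exp.toReal ∂sphereArea =
        ∫ x : S2, φ x * c ∂sphereArea := by
      refine integral_congr_ae ?_
      filter_upwards [h] with x hx
      rw [hx, EReal.exp_coe, Real.exp_log hc, ENNReal.toReal_ofReal hc.le]
    rw [e1, e2, integral_mul_const]
    field_simp
    ring

theorem mainTheorem3 (μ : SignedMeasure S2) (hμ : μ Set.univ = 0)
    (u : RP2 → EReal) (hu : ∀ x : S2, u (toRP2 x) = greenPotential μ x) :
    ENNReal.ofReal (2 / Real.pi) * systole u ^ 2 ≤ area u ∧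
      (area u = ENNReal.ofReal (2 / Real.pi) * systole u ^ 2 ↔
        HasConstantGaussianCurvature u) := by
  have hm := measurable_lift hu
  refine ⟨systole_sq_le_area hm, fun h => ?_, fun h => ?_⟩
  -- Without a finite systole, equality could read `∞ = ∞` and carry no information.
  · have hA : area u ≠ ∞ := by
      rw [h]
      exact ENNReal.mul_ne_top ENNReal.ofReal_ne_top
        (ENNReal.pow_ne_top (systole_lt_top hμ hu).ne)
    obtain ⟨c, hc0, hc⟩ := ae_const_of_area_eq hm hA h
    -- The potential is finite almost everywhere, so the constant value of `e^u` cannot be zero.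
    have hlog : ∀ᵐ x ∂sphereArea, 0 < c ∧ u (toRP2 x) = (Real.log c : EReal) := by
      filter_upwards [hc, ae_greenPotential_eq hμ] with x h1 h2
      rw [hu, h2] at h1 ⊢
      rw [EReal.exp_coe, ENNReal.ofReal_eq_ofReal_iff (Real.exp_pos _).le hc0] at h1
      rw [← h1, Real.log_exp]
      exact ⟨Real.exp_pos _, rfl⟩
    obtain ⟨_, hc', -⟩ := hlog.exists
    exact hasConstantGaussianCurvature_of_ae_const hc' hA (hlog.mono fun x hx => hx.2)
  · have h0 := h.measure_eq_zero hμ hu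
    -- With the zero measure `u` vanishes at every point. An almost everywhere statement would not
    -- suffice, since lengths of curves depend on sets of zero area.
    subst h0
    simp only [greenPotential_zero] at hu
    rw [area_of_eq_zero hu, systole_of_eq_zero hu, ← ENNReal.ofReal_pow Real.pi_pos.le,
      ← ENNReal.ofReal_mul (by positivity)]
    congr 1
    field_simp

end
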